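/- **Setting.** A learner with $K$ arms interacts with an environment for $T$ rounds, $T\ge\max\{K,2\}$. In each round $t$ the environment chooses a (possibly random) loss vector $\ell^t\in[0,1]^K$, which may depend arbitrarily on the past, and simultaneously the learner draws an arm $i^t\in[K]$ from a distribution $p^t$ and observes $\ell^t_{i^t}$; that is, given the history before round $t$ and $\ell^t$, the arm $i^t$ has law $p^t$. Let $i^\star\in\arg\min_{i}\mathbb E[\sum_{t=1}^T\ell^t_i]$ and let $\mathrm{Reg}^T=\mathbb E\big[\sum_{t=1}^T(\ell^t_{i^t}-\ell^t_{i^\star})\big]$ be the pseudo-regret. **Algorithm.** The learner plays $$p^t=\arg\min_{p}\Big\{\Big\langle p,\sum_{\tau<t}\widehat\ell^\tau\Big\rangle-C_{\log}\sum_{i=1}^K\log p_i-\sum_{i=1}^K\gamma^t_i\log p_i\Big\},$$ the minimum being over the probability simplex in $\mathbb R^K$, where $\widehat\ell^\tau_i=\mathbf 1\{i^\tau=i\}\,\ell^\tau_i/p^\tau_i$ and $$\gamma^t_i=\theta\sqrt{1+\sum_{\tau<t}\big(\max\{p^\tau_i,1/T\}\big)^{1-2\alpha}},\qquad C_{\log}=162,\quad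 \alpha=0,\quad \theta=\sqrt{1/\log T}.$$ **Theorem 1.** There is an absolute constant $\kappa>0$ such that for all $K$, $T$ and all environments as above the following two statements hold simultaneously. 1. Always, $\mathrm{Reg}^T\le\kappa\sqrt{KT\log T}$. 2. Let $\Delta\in[0,1]^K$ and $C\ge 0$ be such that $$\mathrm{Reg}^T\ \ge\ \mathbb E\Big[\sum_{t=1}^T\sum_{i=1}^K p^t_i\Delta_i\Big]-C.$$ Put $U=\{i:\Delta_i=0\}$, $V=\{i:\Delta_i>0\}$, $\Delta_{\min}=\min_{i\in V}\Delta_i$ and $\mathbb G=\frac{|U|}{\Delta_{\min}}+\sum_{i\in V}\frac1{\Delta_i}$ (with $\mathbb G=0$ if $V=\emptyset$), and let $D$ satisfy $$\mathbb E\Big[\sum_{t=1}^T\max_{i\in U}\mathbb E^t\big[\ell^t_i-\ell^t_{i^\star}\big]\Big]\le D,$$ where $\mathbb E^t$ is the conditional expectation given the history $(\ell^1,i^1,\dots,\ell^{t-1},i^{t-1})$ before round $t$ (a maximum over $U=\emptyset$ is read as $0$). Then $$\mathrm{Reg}^T\le\kappa\Big(\mathbb G\log T+\sqrt{C\,\mathbb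 G\log T}+\frac{K^2}{\sqrt{\log T}}+K\log T+D\Big).$$ No uniqueness of the zero-gap arm is assumed. -/

import Mathlib

open MeasureTheory

noncomputable section

namespace Bandit

/-! Rounds are numbered `0, 1, …, T - 1`, arms are the elements of `Fin K`. -/

/-- The probability distributions over `K` arms with full support. Since `-log 0 = +∞`, a
regularizer containing a log-barrier is finite exactly at these points of the simplex, so that
minimizing over the simplex is the same as minimizing over this set. -/
def openSimplex (K : ℕ) : Set (Fin K → ℝ) :=
  {q | (∀ i, 0 < q i) ∧ ∑ i, q i = 1}

/-- The arm-dependent learning rate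
`γ^t_i = θ √(1 + ∑_{τ < t} (max {p^τ_i, 1/T})^(1 - 2α))`. -/
def learningRate {K : ℕ} (θ α : ℝ) (T : ℕ) (p : ℕ → Fin K → ℝ) (t : ℕ) (i : Fin K) : ℝ :=
  θ * √(1 + ∑ τ ∈ Finset.range t, (max (p τ i) (1 / (T : ℝ))) ^ (1 - 2 * α))

/-- The log-barrier regularizer with weights `γ`, plus an extra log-barrier with coefficient
`Clog`. -/
def logBarrier {K : ℕ} (Clog : ℝ) (γ : Fin K → ℝ) (q : Fin K → ℝ) : ℝ :=
  -Clog * ∑ i, Real.log (q i) - ∑ i, γ i * Real.log (q i)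

/-- The importance-weighted estimate of the loss vector `l`, when arm `a` has been drawn from the
distribution `q`. It uses only the observed loss `l a`. -/
def lossEstimate {K : ℕ} (q : Fin K → ℝ) (a : Fin K) (l : Fin K → ℝ) (i : Fin K) : ℝ :=
  (if a = i then l i else 0) / q i

/-- The function minimized in round `t`:
`q ↦ ⟨q, ∑_{τ < t} ℓ̂^τ⟩ + φ^t(q)`. -/
def ftrlObjective {K : ℕ} (Clog θ α : ℝ) (T : ℕ) (p : ℕ → Fin K → ℝ) (arm : ℕ → Fin K)
    (loss : ℕ → Fin K → ℝ) (t : ℕ) (q : Fin K → ℝ) : ℝ :=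
  ∑ i, q i * ∑ τ ∈ Finset.range t, lossEstimate (p τ) (arm τ) (loss τ) i
    + logBarrier Clog (learningRate θ α T p t) q

/-- `p 0, …, p (T - 1)` are the distributions that the algorithm plays along the trajectory
given by the drawn arms and the loss vectors: `p t` is the minimizer of the objective of
round `t`. -/
def IsLogBarrierFTRL {K : ℕ} (Clog θ α : ℝ) (T : ℕ) (p : ℕ → Fin K → ℝ) (arm : ℕ → Fin K)
    (loss : ℕ → Fin K → ℝ) : Prop :=
  ∀ t < T, p t ∈ openSimplex K ∧
    IsMinOn (ftrlObjective Clog θ α T p arm loss t) (openSimplex K) (p t)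

variable {Ω : Type*} [MeasurableSpace Ω] {K : ℕ}

/-- The history before round `t`: the σ-algebra generated by the loss vectors and the arms of the
earlier rounds. -/
abbrev history (loss : ℕ → Ω → Fin K → ℝ) (arm : ℕ → Ω → Fin K) (t : ℕ) : MeasurableSpace Ω :=
  ⨆ (s : ℕ) (_ : s < t),
    (MeasurableSpace.comap (loss s) inferInstance ⊔ MeasurableSpace.comap (arm s) inferInstance)

/-- A `T`-round interaction of a learner playing the distributions `p t` with an environment.
The environment is arbitrary: the loss vector of a round may be random and may depend on
everything that happened earlier. It is chosen simultaneously with the arm, that is, given the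
history and the loss vector of round `t`, the arm of round `t` has distribution `p t`. -/
structure IsInteraction (μ : Measure Ω) (T : ℕ) (loss : ℕ → Ω → Fin K → ℝ)
    (arm : ℕ → Ω → Fin K) (p : ℕ → Ω → Fin K → ℝ) : Prop where
  measurable_loss : ∀ t < T, Measurable (loss t)
  measurable_arm : ∀ t < T, Measurable (arm t)
  loss_mem : ∀ t < T, ∀ ω i, loss t ω i ∈ Set.Icc (0 : ℝ) 1
  arm_law : ∀ t < T, ∀ i,
    μ[Set.indicator {ω | arm t ω = i} (fun _ => (1 : ℝ)) |
        history loss arm t ⊔ MeasurableSpace.comap (loss t) inferInstance]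
      =ᵐ[μ] fun ω => p t ω i

/-- `istar` minimizes the expected cumulative loss. -/
def IsBestArm (μ : Measure Ω) (T : ℕ) (loss : ℕ → Ω → Fin K → ℝ) (istar : Fin K) : Prop :=
  ∀ j, ∫ ω, ∑ t ∈ Finset.range T, loss t ω istar ∂μ ≤ ∫ ω, ∑ t ∈ Finset.range T, loss t ω j ∂μ

/-- The pseudo-regret with respect to the arm `istar`. -/
def regret (μ : Measure Ω) (T : ℕ) (loss : ℕ → Ω → Fin K → ℝ) (arm : ℕ → Ω → Fin K)
    (istar : Fin K) : ℝ :=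
  ∫ ω, ∑ t ∈ Finset.range T, (loss t ω (arm t ω) - loss t ω istar) ∂μ

/-- The self-bounding condition with gap vector `Δ` and constant `C`. -/
def SelfBounding (μ : Measure Ω) (T : ℕ) (loss : ℕ → Ω → Fin K → ℝ) (arm : ℕ → Ω → Fin K)
    (p : ℕ → Ω → Fin K → ℝ) (istar : Fin K) (Δ : Fin K → ℝ) (C : ℝ) : Prop :=
  regret μ T loss arm istar ≥ ∫ ω, ∑ t ∈ Finset.range T, ∑ i, p t ω i * Δ i ∂μ - C

/-- The set `U` of arms with zero gap. -/
def zeroGapArms (Δ : Fin K → ℝ) : Finset (Fin K) := {i | Δ i = 0}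

/-- The set `V` of arms with nonzero gap. -/
def posGapArms (Δ : Fin K → ℝ) : Finset (Fin K) := {i | Δ i ≠ 0}

/-- The smallest nonzero gap. -/
def minGap (Δ : Fin K → ℝ) : ℝ := ⨅ i : {i // i ∈ posGapArms Δ}, Δ i

/-- The instance complexity `|U| / Δ_min + ∑_{i ∈ V} 1 / Δ_i`. If `V` is empty, it is `0`. -/
def complexity (Δ : Fin K → ℝ) : ℝ :=
  ((zeroGapArms Δ).card : ℝ) / minGap Δ + ∑ i ∈ posGapArms Δ, 1 / Δ i

/-- `E[∑_t max_{i ∈ U} E^t[ℓ^t_i - ℓ^t_{i*}]]`, where `E^t` is the conditional expectation given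
the history before round `t`. If `U` is empty, it is `0`. -/
def zeroGapDeviation (μ : Measure Ω) (T : ℕ) (loss : ℕ → Ω → Fin K → ℝ) (arm : ℕ → Ω → Fin K)
    (istar : Fin K) (Δ : Fin K → ℝ) : ℝ :=
  ∫ ω, ∑ t ∈ Finset.range T, ⨆ i : {i // i ∈ zeroGapArms Δ},
    (μ[fun ω' => loss t ω' i - loss t ω' istar | history loss arm t]) ω ∂μ

end Bandit

end

/-! The regret is split at a shadow learner, `competitor`, which solves the same regularized problem
with the same loss estimates and weights, but over the face of the simplex spanned by a set `U` of
arms. With `U` the zero-gap arms, the shadow learner's own regret is at most `D`: it is determined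
by the history and supported on `U`, so loss differences can be replaced by conditional expectations
and then by their maximum over `U`. It remains to compare the two learners at a cost that vanishes
with the mass played outside `U`.

The comparison rests on the potential "minimum over the whole simplex minus minimum over the face"
(`barrierMin`), at the current estimates and weights. It is nonnegative at the start. Raising the
weights only raises it (`barrierMin_sub_mono`): by the envelope theorem a minimum has derivative
minus the log of the minimizer's coordinate in that weight, and passing to a face enlarges every
surviving coordinate. So changing learning rates cost nothing along the way, and only the final
potential is paid, which `barrierMin_sub_le` bounds with an explicit test point. Adding loss to an
arm of `U` moves the two minima almost alike: the difference of the stability terms carries a factor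
B / (A + B), where A and B are sums of p p' / g inside and outside `U` (`stability_sub_le`).

Averaged over the drawn arm, the stability cost is of order ∑ p i / g i outside `U` plus ∑ m j / g j
inside, where m = `outsideShare` satisfies m ≤ p and has total at most the mass outside `U`
(`sum_mul_stabilityBound_le`). Since g i grows like θ times the root of the accumulated p i, both
sums telescope to square roots, and Cauchy–Schwarz over `U` gives `pathComplexity`. The result is
`regret_le`: shadow regret, plus √(log T) times the expected path complexity, plus K log T, up to
constants.

For the worst-case bound take `U = {istar}`: the shadow regret is zero and the path complexity is at
most 2√(KT). For the gap-dependent bound, AM–GM bounds the path term by η times the gap-weighted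
plays plus a multiple of `complexity Δ * log T / η`; the self-bounding condition returns the first
part to the regret, and η is optimized in `le_of_self_bounding`. If no arm has zero gap, `U =
{istar}` is used again. -/

noncomputable section

namespace Bandit

/-! ### Log-barrier minimization on a face of the simplex. -/

section Equilibrium

variable {ι : Type*}

/-- The Bregman generator `r - 1 - log r` of the logarithmic barrier. -/
def logGap (r : ℝ) : ℝ := r - 1 - Real.log r

theorem logGap_nonneg {r : ℝ} (hr : 0 < r) : 0 ≤ logGap r := by
  have := Real.log_le_sub_one_of_pos hr
  unfold logGap; linarith

theorem eq_one_of_logGap_nonpos {r : ℝ} (hr : 0 < r) (h : logGap r ≤ 0) : r = 1 := by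
  by_contra hne
  have := Real.log_lt_sub_one_of_pos hr hne
  unfold logGap at h; linarith

/-- Convexity: `logGap` lies above its tangent at `y`, whose slope is `1 - 1 / y`. -/
theorem logGap_sub_le {x y : ℝ} (hx : 0 < x) (hy : 0 < y) :
    logGap y - logGap x ≤ (y - x) * (1 - 1 / y) := by
  have h := Real.log_le_sub_one_of_pos (div_pos hx hy)
  rw [Real.log_div hx.ne' hy.ne'] at h
  have : (y - x) * (1 - 1 / y) = y - x - 1 + x / y := by field_simp; ring
  unfold logGap; linarith

theorem logGap_mono {x y : ℝ} (hx : 1 ≤ x) (hxy : x ≤ y) : logGap x ≤ logGap y := by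
  have hx0 : 0 < x := by linarith
  have h := logGap_sub_le (lt_of_lt_of_le hx0 hxy) hx0
  have : 1 / x ≤ 1 := by rw [div_le_one hx0]; exact hx
  nlinarith

theorem logGap_anti {x y : ℝ} (hx : 0 < x) (hxy : x ≤ y) (hy : y ≤ 1) :
    logGap y ≤ logGap x := by
  have hy0 : 0 < y := by linarith
  have h := logGap_sub_le hx hy0
  have : 1 ≤ 1 / y := by rw [le_div_iff₀ hy0]; linarith
  nlinarith

/-- Stationarity on the simplex reads `g i / x i = L i + ν`, so ν must give the points `g i / (L i +
ν)` total mass one. The intermediate value theorem applies between two shifts: one gives the arm `k`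
of least `L` the denominator `g k`, so that its term alone is 1; the other makes every denominator
at least `∑ g`, so that the sum is at most 1. -/
theorem exists_multiplier {S : Finset ι} (hS : S.Nonempty) {L g : ι → ℝ}
    (hg : ∀ i ∈ S, 0 < g i) :
    ∃ ν : ℝ, (∀ i ∈ S, 0 < L i + ν) ∧ ∑ i ∈ S, g i / (L i + ν) = 1 := by
  obtain ⟨k, hk, hmin⟩ := S.exists_min_image L hS
  have hgk := hg k hk
  have hsum : g k ≤ ∑ i ∈ S, g i :=
    Finset.single_le_sum (f := g) (fun i hi => (hg i hi).le) hk
  have hpos : ∀ c ∈ Set.Icc (g k - L k) (∑ i ∈ S, g i - L k), ∀ i ∈ S, 0 < L i + c := by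
    intro c hc i hi
    have := hmin i hi
    linarith [hc.1]
  have hcont : ContinuousOn (fun c => ∑ i ∈ S, g i / (L i + c))
      (Set.Icc (g k - L k) (∑ i ∈ S, g i - L k)) := by
    refine continuousOn_finsetSum _ fun i hi => ?_
    refine ContinuousOn.div continuousOn_const (by fun_prop) fun c hc => (hpos c hc i hi).ne'
  have hab : g k - L k ≤ ∑ i ∈ S, g i - L k := by linarith
  have h1 : (1 : ℝ) ≤ ∑ i ∈ S, g i / (L i + (g k - L k)) := by
    have h := Finset.single_le_sum (f := fun i => g i / (L i + (g k - L k)))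
      (fun i hi => (div_pos (hg i hi) (hpos _ (Set.left_mem_Icc.2 hab) i hi)).le) hk
    have e : g k / (L k + (g k - L k)) = 1 := by
      rw [add_sub_cancel, div_self hgk.ne']
    exact e.symm.le.trans h
  have h2 : ∑ i ∈ S, g i / (L i + (∑ i ∈ S, g i - L k)) ≤ 1 := by
    calc ∑ i ∈ S, g i / (L i + (∑ i ∈ S, g i - L k))
        ≤ ∑ i ∈ S, g i / (∑ i ∈ S, g i) := by
          refine Finset.sum_le_sum fun i hi => ?_
          have := hmin i hi
          exact div_le_div_of_nonneg_left (hg i hi).le (by linarith) (by linarith)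
      _ = 1 := by rw [← Finset.sum_div, div_self (by linarith)]
  obtain ⟨ν, hν, hν1⟩ := intermediate_value_Icc' hab hcont ⟨h2, h1⟩
  exact ⟨ν, hpos ν hν, hν1⟩

open Classical in
/-- The Lagrange multiplier of the minimization of `x ↦ ⟨x, L⟩ - ∑ g i log (x i)` over the
simplex spanned by `S`. -/
def multiplier (S : Finset ι) (L g : ι → ℝ) : ℝ :=
  if h : ∃ ν : ℝ, (∀ i ∈ S, 0 < L i + ν) ∧ ∑ i ∈ S, g i / (L i + ν) = 1 then h.choose else 0

open Classical in
/-- The minimizer of `x ↦ ⟨x, L⟩ - ∑ g i log (x i)` over the simplex spanned by `S`. -/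
def barrierPoint (S : Finset ι) (L g : ι → ℝ) (i : ι) : ℝ :=
  if i ∈ S then g i / (L i + multiplier S L g) else 0

/-- The function `x ↦ ⟨x, L⟩ - ∑ g i log (x i)` on the coordinates in `S`. -/
def barrierObjective (S : Finset ι) (L g x : ι → ℝ) : ℝ :=
  ∑ i ∈ S, (x i * L i - g i * Real.log (x i))

/-- The minimum of `x ↦ ⟨x, L⟩ - ∑ g i log (x i)` over the simplex spanned by `S`. -/
def barrierMin (S : Finset ι) (L g : ι → ℝ) : ℝ :=
  barrierObjective S L g (barrierPoint S L g)

variable {S U : Finset ι} {L L' g g' : ι → ℝ}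

theorem multiplier_spec (hS : S.Nonempty) (hg : ∀ i ∈ S, 0 < g i) :
    (∀ i ∈ S, 0 < L i + multiplier S L g) ∧
      ∑ i ∈ S, g i / (L i + multiplier S L g) = 1 := by
  have h := exists_multiplier hS hg (L := L)
  unfold multiplier
  rw [dif_pos h]
  exact h.choose_spec

/-- The total mass is strictly decreasing in the shift. The explicit sublevel sets later give
measurability of the multiplier and its independence of coordinates outside `S`. -/
theorem multiplier_lt_iff (hS : S.Nonempty) (hg : ∀ i ∈ S, 0 < g i) (c : ℝ) :
    multiplier S L g < c ↔
      (∀ i ∈ S, 0 < L i + c) ∧ ∑ i ∈ S, g i / (L i + c) < 1 := by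
  obtain ⟨hp, hs⟩ := multiplier_spec hS hg (L := L)
  constructor
  · intro h
    refine ⟨fun i hi => by linarith [hp i hi], ?_⟩
    rw [← hs]
    refine Finset.sum_lt_sum_of_nonempty hS fun i hi => ?_
    exact div_lt_div_of_pos_left (hg i hi) (hp i hi) (by linarith)
  · rintro ⟨h1, h2⟩
    by_contra! hc
    rw [← hs] at h2
    refine absurd h2 (not_lt.2 (Finset.sum_le_sum fun i hi => ?_))
    exact div_le_div_of_nonneg_left (hg i hi).le (h1 i hi) (by linarith)

theorem barrierPoint_of_mem {i : ι} (hi : i ∈ S) :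
    barrierPoint S L g i = g i / (L i + multiplier S L g) := if_pos hi

theorem barrierPoint_of_notMem {i : ι} (hi : i ∉ S) : barrierPoint S L g i = 0 := if_neg hi

theorem barrierPoint_pos (hS : S.Nonempty) (hg : ∀ i ∈ S, 0 < g i) {i : ι} (hi : i ∈ S) :
    0 < barrierPoint S L g i := by
  rw [barrierPoint_of_mem hi]
  exact div_pos (hg i hi) ((multiplier_spec hS hg).1 i hi)

theorem barrierPoint_nonneg (hS : S.Nonempty) (hg : ∀ i ∈ S, 0 < g i) (i : ι) :
    0 ≤ barrierPoint S L g i := by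
  by_cases hi : i ∈ S
  · exact (barrierPoint_pos hS hg hi).le
  · exact (barrierPoint_of_notMem hi).ge

theorem sum_barrierPoint (hS : S.Nonempty) (hg : ∀ i ∈ S, 0 < g i) :
    ∑ i ∈ S, barrierPoint S L g i = 1 := by
  rw [← (multiplier_spec hS hg (L := L)).2]
  exact Finset.sum_congr rfl fun i hi => barrierPoint_of_mem hi

theorem barrierPoint_le_one (hS : S.Nonempty) (hg : ∀ i ∈ S, 0 < g i) (i : ι) :
    barrierPoint S L g i ≤ 1 := by
  by_cases hi : i ∈ S
  · rw [← sum_barrierPoint hS hg (L := L)]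
    exact Finset.single_le_sum (f := barrierPoint S L g)
      (fun i _ => barrierPoint_nonneg hS hg i) hi
  · rw [barrierPoint_of_notMem hi]; exact zero_le_one

theorem div_barrierPoint (hg : ∀ i ∈ S, 0 < g i) {i : ι} (hi : i ∈ S) :
    g i / barrierPoint S L g i = L i + multiplier S L g := by
  rw [barrierPoint_of_mem hi, div_div_cancel₀ (hg i hi).ne']

/-- The objective at any point of the simplex, expanded around the minimizer. -/
theorem barrierObjective_eq (hS : S.Nonempty) (hg : ∀ i ∈ S, 0 < g i) {x : ι → ℝ}
    (hx : ∀ i ∈ S, 0 < x i) (hx1 : ∑ i ∈ S, x i = 1) :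
    barrierObjective S L g x =
      barrierMin S L g + ∑ i ∈ S, g i * logGap (x i / barrierPoint S L g i) := by
  -- The last term is linear with the constant coefficient `multiplier S L g`, so it sums to zero
  -- because both points have mass one.
  have key : ∀ i ∈ S, x i * L i - g i * Real.log (x i) =
      (barrierPoint S L g i * L i - g i * Real.log (barrierPoint S L g i)) +
        g i * logGap (x i / barrierPoint S L g i)
        - multiplier S L g * (x i - barrierPoint S L g i) := by
    intro i hi
    have hy := barrierPoint_pos hS hg hi (L := L)
    have e := div_barrierPoint hg hi (L := L)
    have e' : g i * (x i / barrierPoint S L g i) = x i * (L i + multiplier S L g) := by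
      rw [← e]; ring
    have e'' : g i = barrierPoint S L g i * (L i + multiplier S L g) := by
      rw [← e]; field_simp
    unfold logGap
    rw [Real.log_div (hx i hi).ne' hy.ne', mul_sub, mul_sub, e', mul_sub, mul_one]
    linear_combination e''
  have e0 : ∑ i ∈ S, (x i - barrierPoint S L g i) = 0 := by
    rw [Finset.sum_sub_distrib, hx1, sum_barrierPoint hS hg, sub_self]
  unfold barrierMin barrierObjective
  rw [Finset.sum_congr rfl key, Finset.sum_sub_distrib, Finset.sum_add_distrib,
    ← Finset.mul_sum, e0, mul_zero, sub_zero]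

theorem barrierMin_le (hS : S.Nonempty) (hg : ∀ i ∈ S, 0 < g i) {x : ι → ℝ}
    (hx : ∀ i ∈ S, 0 < x i) (hx1 : ∑ i ∈ S, x i = 1) :
    barrierMin S L g ≤ barrierObjective S L g x := by
  rw [barrierObjective_eq hS hg hx hx1]
  have : 0 ≤ ∑ i ∈ S, g i * logGap (x i / barrierPoint S L g i) :=
    Finset.sum_nonneg fun i hi => mul_nonneg (hg i hi).le
      (logGap_nonneg (div_pos (hx i hi) (barrierPoint_pos hS hg hi)))
  linarith

theorem eq_barrierPoint_of_le (hS : S.Nonempty) (hg : ∀ i ∈ S, 0 < g i) {x : ι → ℝ}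
    (hx : ∀ i ∈ S, 0 < x i) (hx1 : ∑ i ∈ S, x i = 1)
    (hle : barrierObjective S L g x ≤ barrierMin S L g) {i : ι} (hi : i ∈ S) :
    x i = barrierPoint S L g i := by
  rw [barrierObjective_eq hS hg hx hx1] at hle
  have hp := barrierPoint_pos hS hg hi (L := L)
  have h := Finset.single_le_sum (f := fun i => g i * logGap (x i / barrierPoint S L g i))
    (fun i hi => mul_nonneg (hg i hi).le
      (logGap_nonneg (div_pos (hx i hi) (barrierPoint_pos hS hg hi)))) hi
  have h1 : logGap (x i / barrierPoint S L g i) ≤ 0 := by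
    have : g i * logGap (x i / barrierPoint S L g i) ≤ 0 := by
      linarith
    by_contra! hc
    have := mul_pos (hg i hi) hc
    linarith
  have := eq_one_of_logGap_nonpos (div_pos (hx i hi) hp) h1
  rwa [div_eq_one_iff_eq hp.ne'] at this

/-- At the multiplier of `S` the arms of `U` have mass at most one, so the shift for `U` can only be
lower. Hence passing to a face enlarges the surviving coordinates. -/
theorem multiplier_le_of_subset (hU : U.Nonempty) (hUS : U ⊆ S) (hg : ∀ i ∈ S, 0 < g i) :
    multiplier U L g ≤ multiplier S L g := by
  have hS := hU.mono hUS
  have hgU : ∀ i ∈ U, 0 < g i := fun i hi => hg i (hUS hi)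
  by_contra! hlt
  obtain ⟨hp, hs⟩ := multiplier_spec hS hg (L := L)
  obtain ⟨hp', hs'⟩ := multiplier_spec hU hgU (L := L)
  have h1 : ∑ i ∈ U, g i / (L i + multiplier U L g) <
      ∑ i ∈ U, g i / (L i + multiplier S L g) :=
    Finset.sum_lt_sum_of_nonempty hU fun i hi =>
      div_lt_div_of_pos_left (hgU i hi) (hp i (hUS hi)) (by linarith)
  have h2 : ∑ i ∈ U, g i / (L i + multiplier S L g) ≤
      ∑ i ∈ S, g i / (L i + multiplier S L g) :=
    Finset.sum_le_sum_of_subset_of_nonneg hUS fun i hi _ => (div_pos (hg i hi) (hp i hi)).le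
  linarith

theorem barrierPoint_le_of_subset (hU : U.Nonempty) (hUS : U ⊆ S) (hg : ∀ i ∈ S, 0 < g i)
    {i : ι} (hi : i ∈ U) : barrierPoint S L g i ≤ barrierPoint U L g i := by
  rw [barrierPoint_of_mem hi, barrierPoint_of_mem (hUS hi)]
  refine div_le_div_of_nonneg_left (hg i (hUS hi)).le
    ((multiplier_spec hU fun i hi => hg i (hUS hi)).1 i hi) ?_
  linarith [multiplier_le_of_subset hU hUS hg (L := L)]

theorem multiplier_mono (hS : S.Nonempty) (hg : ∀ i ∈ S, 0 < g i)
    (hgg : ∀ i ∈ S, g i ≤ g' i) : multiplier S L g ≤ multiplier S L g' := by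
  have hg' : ∀ i ∈ S, 0 < g' i := fun i hi => (hg i hi).trans_le (hgg i hi)
  by_contra! hlt
  obtain ⟨hp, hs⟩ := multiplier_spec hS hg (L := L)
  obtain ⟨hp', hs'⟩ := multiplier_spec hS hg' (L := L)
  have : ∑ i ∈ S, g i / (L i + multiplier S L g) < ∑ i ∈ S, g' i / (L i + multiplier S L g') :=
    Finset.sum_lt_sum_of_nonempty hS fun i hi =>
      (div_lt_div_of_pos_left (hg i hi) (hp' i hi) (by linarith)).trans_le
        (div_le_div_of_nonneg_right (hgg i hi) (hp' i hi).le)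
  linarith

/-- A coordinate divided by its weight is `1 / (L i + ν)`, and ν grows with the weights. So a
coordinate grows at most in proportion to its own weight. -/
theorem barrierPoint_mul_le (hS : S.Nonempty) (hg : ∀ i ∈ S, 0 < g i)
    (hgg : ∀ i ∈ S, g i ≤ g' i) {i : ι} (hi : i ∈ S) :
    barrierPoint S L g' i * g i ≤ barrierPoint S L g i * g' i := by
  have hg' : ∀ i ∈ S, 0 < g' i := fun i hi => (hg i hi).trans_le (hgg i hi)
  have hp := (multiplier_spec hS hg (L := L)).1 i hi
  have hm := multiplier_mono hS hg hgg (L := L)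
  rw [barrierPoint_of_mem hi, barrierPoint_of_mem hi, div_mul_eq_mul_div, div_mul_eq_mul_div,
    mul_comm (g' i)]
  exact div_le_div_of_nonneg_left (mul_pos (hg i hi) (hg' i hi)).le hp (by linarith)

/-- A discrete envelope theorem. The old minimizer is tested in the new problem on `U`, and the new
minimizer in the old problem on `S`; what remains is to compare the logs of the new point on `S` and
the old point on `U`. Without the change of weights the former would be the smaller; the change
costs at most `log (g' i / g i) ≤ g' i - g i`, because `1 ≤ g i`, and this is multiplied by another
`g' i - g i`. Arms outside `U` contribute with a favourable sign. -/
theorem barrierMin_sub_ge (hU : U.Nonempty) (hUS : U ⊆ S) (hg : ∀ i ∈ S, 1 ≤ g i)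
    (hgg : ∀ i ∈ S, g i ≤ g' i) :
    barrierMin S L g - barrierMin U L g - ∑ i ∈ U, (g' i - g i) ^ 2 ≤
      barrierMin S L g' - barrierMin U L g' := by
  have hS := hU.mono hUS
  have hg0 : ∀ i ∈ S, 0 < g i := fun i hi => by linarith [hg i hi]
  have hg0' : ∀ i ∈ S, 0 < g' i := fun i hi => (hg0 i hi).trans_le (hgg i hi)
  have hU0 : ∀ i ∈ U, 0 < g i := fun i hi => hg0 i (hUS hi)
  have hU0' : ∀ i ∈ U, 0 < g' i := fun i hi => hg0' i (hUS hi)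
  have shift : ∀ (R : Finset ι) (x : ι → ℝ), barrierObjective R L g' x =
      barrierObjective R L g x - ∑ i ∈ R, (g' i - g i) * Real.log (x i) := by
    intro R x
    unfold barrierObjective
    rw [← Finset.sum_sub_distrib]
    exact Finset.sum_congr rfl fun i _ => by ring
  have hΨ : barrierMin U L g' ≤ barrierMin U L g -
      ∑ i ∈ U, (g' i - g i) * Real.log (barrierPoint U L g i) := by
    have := barrierMin_le hU hU0' (L := L) (fun i hi => barrierPoint_pos hU hU0 hi (L := L))
      (sum_barrierPoint hU hU0)
    rw [shift] at this
    exact this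
  have hΦ : barrierMin S L g -
      ∑ i ∈ S, (g' i - g i) * Real.log (barrierPoint S L g' i) ≤ barrierMin S L g' := by
    have := barrierMin_le hS hg0 (L := L) (fun i hi => barrierPoint_pos hS hg0' hi (L := L))
      (sum_barrierPoint hS hg0')
    have e := shift S (barrierPoint S L g')
    unfold barrierMin at this ⊢
    linarith
  have hsub : ∑ i ∈ S, (g' i - g i) * Real.log (barrierPoint S L g' i) ≤
      ∑ i ∈ U, (g' i - g i) * Real.log (barrierPoint S L g' i) := by
    classical
    rw [← Finset.sum_sdiff hUS]
    have : ∑ i ∈ S \ U, (g' i - g i) * Real.log (barrierPoint S L g' i) ≤ 0 := by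
      refine Finset.sum_nonpos fun i hi => ?_
      have hiS := (Finset.mem_sdiff.1 hi).1
      exact mul_nonpos_of_nonneg_of_nonpos (by linarith [hgg i hiS])
        (Real.log_nonpos (barrierPoint_nonneg hS hg0' i) (barrierPoint_le_one hS hg0' i))
    linarith
  have hlog : ∑ i ∈ U, (g' i - g i) * Real.log (barrierPoint S L g' i) ≤
      ∑ i ∈ U, (g' i - g i) * Real.log (barrierPoint U L g i) + ∑ i ∈ U, (g' i - g i) ^ 2 := by
    rw [← Finset.sum_add_distrib]
    refine Finset.sum_le_sum fun i hi => ?_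
    have hiS := hUS hi
    have hp := barrierPoint_pos hS hg0 hiS (L := L)
    have hp' := barrierPoint_pos hS hg0' hiS (L := L)
    have hq := barrierPoint_le_of_subset hU hUS hg0 hi (L := L)
    have hr := barrierPoint_mul_le hS hg0 hgg hiS (L := L)
    have h0 := hg0 i hiS
    have hd := hgg i hiS
    have h1 : Real.log (barrierPoint S L g' i) + Real.log (g i) ≤
        Real.log (barrierPoint S L g i) + Real.log (g' i) := by
      rw [← Real.log_mul hp'.ne' h0.ne', ← Real.log_mul hp.ne' (hg0' i hiS).ne']
      exact Real.log_le_log (mul_pos hp' h0) hr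
    have h2 : Real.log (g' i) - Real.log (g i) ≤ g' i - g i := by
      rw [← Real.log_div (hg0' i hiS).ne' h0.ne']
      refine (Real.log_le_sub_one_of_pos (div_pos (hg0' i hiS) h0)).trans ?_
      rw [div_sub_one h0.ne']
      exact div_le_self (by linarith) (hg i hiS)
    have h3 := Real.log_le_log hp hq
    nlinarith
  linarith

/-- Cutting the unit interval into n + 1 equal steps makes the total quadratic loss c / (n + 1),
which tends to zero. This removes the error of the discrete envelope argument without
differentiating the minimum. -/
theorem le_of_sub_sq_le {f : ℝ → ℝ} {c : ℝ}
    (h : ∀ x y, 0 ≤ x → x ≤ y → y ≤ 1 → f x - c * (y - x) ^ 2 ≤ f y) : f 0 ≤ f 1 := by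
  have step : ∀ n : ℕ, ∀ m ≤ n + 1,
      f 0 - m * (c / ((n : ℝ) + 1) ^ 2) ≤ f (m / ((n : ℝ) + 1)) := by
    intro n m
    induction m with
    | zero => intro _; simp
    | succ m ih =>
      intro hm
      have hn : (0 : ℝ) < (n : ℝ) + 1 := by positivity
      have h1 := ih (by omega)
      have h2 := h (m / ((n : ℝ) + 1)) ((m + 1 : ℕ) / ((n : ℝ) + 1)) (by positivity)
        (by gcongr; simp) (by rw [div_le_one hn]; exact_mod_cast hm)
      have e : c * (((m + 1 : ℕ) : ℝ) / ((n : ℝ) + 1) - m / ((n : ℝ) + 1)) ^ 2 =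
          c / ((n : ℝ) + 1) ^ 2 := by
        push_cast; field_simp; ring
      rw [e] at h2
      push_cast at h2 ⊢
      linarith
  have step' : ∀ n : ℕ, f 0 - c * (1 / ((n : ℝ) + 1)) ≤ f 1 := by
    intro n
    have h1 := step n (n + 1) le_rfl
    have hn : (0 : ℝ) < (n : ℝ) + 1 := by positivity
    push_cast at h1
    rw [div_self hn.ne'] at h1
    convert h1 using 2
    field_simp
  have hlim : Filter.Tendsto (fun n : ℕ => f 0 - c * (1 / ((n : ℝ) + 1))) Filter.atTop
      (nhds (f 0 - c * 0)) :=
    tendsto_const_nhds.sub (tendsto_one_div_add_atTop_nhds_zero_nat.const_mul c)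
  have := le_of_tendsto' hlim step'
  simpa using this

/-- The difference of the minima over a large and a small simplex increases with the weights. -/
theorem barrierMin_sub_mono (hU : U.Nonempty) (hUS : U ⊆ S) (hg : ∀ i ∈ S, 1 ≤ g i)
    (hgg : ∀ i ∈ S, g i ≤ g' i) :
    barrierMin S L g - barrierMin U L g ≤ barrierMin S L g' - barrierMin U L g' := by
  have h := le_of_sub_sq_le (c := ∑ i ∈ U, (g' i - g i) ^ 2)
    (f := fun s => barrierMin S L (fun i => g i + s * (g' i - g i)) -
      barrierMin U L (fun i => g i + s * (g' i - g i))) (by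
    intro x y hx hxy _
    have := barrierMin_sub_ge (L := L) hU hUS (g := fun i => g i + x * (g' i - g i))
      (g' := fun i => g i + y * (g' i - g i))
      (fun i hi => by nlinarith [hg i hi, hgg i hi, mul_nonneg hx (sub_nonneg.2 (hgg i hi))])
      (fun i hi => by nlinarith [hgg i hi, mul_nonneg (sub_nonneg.2 hxy) (sub_nonneg.2 (hgg i hi))])
    have e : ∑ i ∈ U, (g i + y * (g' i - g i) - (g i + x * (g' i - g i))) ^ 2 =
        (∑ i ∈ U, (g' i - g i) ^ 2) * (y - x) ^ 2 := by
      rw [Finset.sum_mul]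
      exact Finset.sum_congr rfl fun i _ => by ring
    rw [e] at this
    exact this)
  simpa using h

end Equilibrium

/-! ### Response of the minima to one additional loss. -/

section Stability

variable {ι : Type*} [DecidableEq ι] {S U : Finset ι} {L g : ι → ℝ} {j : ι} {s : ℝ}

/-- Increase the coordinate `j` of `L` by `s`. -/
def addAt (L : ι → ℝ) (j : ι) (s : ℝ) (i : ι) : ℝ := L i + if j = i then s else 0

theorem barrierObjective_addAt (hj : j ∈ S) (x : ι → ℝ) :
    barrierObjective S (addAt L j s) g x = barrierObjective S L g x + s * x j := by
  have : ∀ i ∈ S, x i * addAt L j s i - g i * Real.log (x i) =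
      (x i * L i - g i * Real.log (x i)) + if j = i then s * x i else 0 := by
    intro i _
    unfold addAt
    split_ifs <;> ring
  unfold barrierObjective
  rw [Finset.sum_congr rfl this, Finset.sum_add_distrib, Finset.sum_ite_eq, if_pos hj]

theorem barrierMin_addAt_of_notMem (hS : S.Nonempty) (hg : ∀ i ∈ S, 0 < g i) (hj : j ∉ S) :
    barrierMin S (addAt L j s) g = barrierMin S L g := by
  have h : ∀ i ∈ S, addAt L j s i = L i := by
    intro i hi
    have : j ≠ i := fun h => hj (h ▸ hi)
    simp [addAt, this]
  -- The multiplier is chosen from an existence statement, so equality is obtained by comparing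
  -- sublevel sets, which see only coordinates in `S`.
  have hm : multiplier S (addAt L j s) g = multiplier S L g := by
    refine eq_of_forall_gt_iff fun c => ?_
    rw [multiplier_lt_iff hS hg, multiplier_lt_iff hS hg,
      Finset.sum_congr rfl fun i hi => by rw [h i hi]]
    exact and_congr (forall₂_congr fun i hi => by rw [h i hi]) Iff.rfl
  unfold barrierMin barrierObjective
  refine Finset.sum_congr rfl fun i hi => ?_
  rw [barrierPoint_of_mem hi, barrierPoint_of_mem hi, hm, h i hi]

/-- The new minimizer is inserted into the old objective, which is expanded around the old
minimizer. The Bregman term is kept exactly, because `stability_sub_le` needs it to cancel between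
`S` and `U`. -/
theorem barrierMin_addAt (hg : ∀ i ∈ S, 0 < g i) (hj : j ∈ S) :
    barrierMin S (addAt L j s) g = barrierMin S L g +
      ∑ i ∈ S, g i * logGap (barrierPoint S (addAt L j s) g i / barrierPoint S L g i) +
      s * barrierPoint S (addAt L j s) g j := by
  have hS : S.Nonempty := ⟨j, hj⟩
  conv_lhs => unfold barrierMin
  rw [barrierObjective_addAt hj, barrierObjective_eq hS hg
    (fun i hi => barrierPoint_pos hS hg hi) (sum_barrierPoint hS hg)]

theorem multiplier_addAt_le (hg : ∀ i ∈ S, 0 < g i) (hj : j ∈ S) (hs : 0 ≤ s) :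
    multiplier S (addAt L j s) g ≤ multiplier S L g := by
  have hS : S.Nonempty := ⟨j, hj⟩
  by_contra! hlt
  rw [multiplier_lt_iff hS hg] at hlt
  obtain ⟨hp', h1⟩ := multiplier_spec hS hg (L := addAt L j s)
  refine absurd h1 (ne_of_lt (lt_of_le_of_lt (Finset.sum_le_sum fun i hi => ?_) hlt.2))
  refine div_le_div_of_nonneg_left (hg i hi).le (hlt.1 i hi) ?_
  unfold addAt
  split_ifs <;> linarith

theorem multiplier_sub_le_addAt (hg : ∀ i ∈ S, 0 < g i) (hj : j ∈ S) (hs : 0 ≤ s) :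
    multiplier S L g - s ≤ multiplier S (addAt L j s) g := by
  have hS : S.Nonempty := ⟨j, hj⟩
  by_contra! hlt
  obtain ⟨hp', h1⟩ := multiplier_spec hS hg (L := addAt L j s)
  obtain ⟨hp, h2⟩ := multiplier_spec hS hg (L := L)
  have : ∑ i ∈ S, g i / (L i + multiplier S L g) <
      ∑ i ∈ S, g i / (addAt L j s i + multiplier S (addAt L j s) g) := by
    refine Finset.sum_lt_sum_of_nonempty hS fun i hi => ?_
    have h3 : addAt L j s i ≤ L i + s := by
      unfold addAt
      split_ifs <;> linarith
    exact div_lt_div_of_pos_left (hg i hi) (hp' i hi) (by linarith)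
  linarith

/-- One coordinate of the change of the minimizer when `L j` grows by `s`. -/
theorem barrierPoint_addAt (hS : S.Nonempty) (hg : ∀ i ∈ S, 0 < g i) {i : ι} (hi : i ∈ S) :
    barrierPoint S (addAt L j s) g i = barrierPoint S L g i +
      barrierPoint S L g i * barrierPoint S (addAt L j s) g i / g i *
        (multiplier S L g - multiplier S (addAt L j s) g - if j = i then s else 0) := by
  have h1 := div_barrierPoint hg hi (L := L)
  have h2 := div_barrierPoint hg hi (L := addAt L j s)
  have hp := barrierPoint_pos hS hg hi (L := L)
  have hp' := barrierPoint_pos hS hg hi (L := addAt L j s)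
  have hg0 := hg i hi
  have e : multiplier S L g - multiplier S (addAt L j s) g - (if j = i then s else 0) =
      g i / barrierPoint S L g i - g i / barrierPoint S (addAt L j s) g i := by
    rw [h1, h2]; unfold addAt; ring
  rw [e]
  field_simp
  ring

/-- The stability term of the loss of an arm, without cancellation. -/
theorem stability_le_sq (hg : ∀ i ∈ S, 0 < g i) (hj : j ∈ S) (hs : 0 ≤ s) :
    s * barrierPoint S L g j - (barrierMin S (addAt L j s) g - barrierMin S L g) ≤
      s ^ 2 * barrierPoint S L g j ^ 2 / g j := by
  have hS : S.Nonempty := ⟨j, hj⟩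
  have hp := barrierPoint_pos hS hg hj (L := L)
  have hp' := barrierPoint_pos hS hg hj (L := addAt L j s)
  have hgj := hg j hj
  rw [barrierMin_addAt hg hj]
  have h1 := Finset.single_le_sum
    (f := fun i => g i * logGap (barrierPoint S (addAt L j s) g i / barrierPoint S L g i))
    (fun i hi => mul_nonneg (hg i hi).le (logGap_nonneg
      (div_pos (barrierPoint_pos hS hg hi) (barrierPoint_pos hS hg hi)))) hj
  set p := barrierPoint S L g j
  set p' := barrierPoint S (addAt L j s) g j
  -- With y = s p / g j and r = p' / p this says `y - y ^ 2 ≤ logGap r + y * r`. The right side is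
  -- at least `log (1 + y)`, its minimum over r.
  have h2 : s * p - s * p' - s ^ 2 * p ^ 2 / g j ≤ g j * logGap (p' / p) := by
    set y := s * p / g j with hy
    have hy0 : 0 ≤ y := by positivity
    have e1 : s * p = g j * y := by rw [hy]; field_simp
    have e2 : s ^ 2 * p ^ 2 / g j = g j * y ^ 2 := by rw [hy]; field_simp
    have e3 : s * p' = g j * (y * (p' / p)) := by rw [hy]; field_simp
    rw [e1, e2, e3, ← mul_sub, ← mul_sub]
    refine mul_le_mul_of_nonneg_left ?_ hgj.le
    have hr : 0 < p' / p := div_pos hp' hp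
    have hl := Real.log_le_sub_one_of_pos (mul_pos hr (show 0 < 1 + y by linarith))
    rw [Real.log_mul hr.ne' (by linarith)] at hl
    have hl2 : y - y ^ 2 ≤ Real.log (1 + y) := by
      have := Real.one_sub_inv_le_log_of_pos (show 0 < 1 + y by linarith)
      refine le_trans ?_ this
      have : 1 - (1 + y)⁻¹ = y / (1 + y) := by field_simp; ring
      rw [this, le_div_iff₀ (by linarith)]
      nlinarith [mul_nonneg hy0 (sq_nonneg y)]
    unfold logGap
    nlinarith
  linarith

set_option maxHeartbeats 1600000 in
/-- The difference of the stability terms over a large and a small simplex, for the loss of an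
arm of the small one. -/
theorem stability_sub_le (hUS : U ⊆ S) (hg : ∀ i ∈ S, 0 < g i) (hj : j ∈ U) (hs : 0 ≤ s)
    {a : ι → ℝ} (ha : ∀ i, a i = barrierPoint S L g i * barrierPoint S (addAt L j s) g i / g i) :
    s * (barrierPoint S L g j - barrierPoint U L g j) -
      ((barrierMin S (addAt L j s) g - barrierMin U (addAt L j s) g) -
        (barrierMin S L g - barrierMin U L g)) ≤
      2 * s ^ 2 * a j ^ 2 * (∑ i ∈ S \ U, a i) /
        ((∑ i ∈ U, a i) * (∑ i ∈ U, a i + ∑ i ∈ S \ U, a i)) := by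
  have hjS := hUS hj
  have hU : U.Nonempty := ⟨j, hj⟩
  have hS : S.Nonempty := ⟨j, hjS⟩
  have hgU : ∀ i ∈ U, 0 < g i := fun i hi => hg i (hUS hi)
  have hp : ∀ i ∈ S, 0 < barrierPoint S L g i := fun i hi => barrierPoint_pos hS hg hi
  have hp' : ∀ i ∈ S, 0 < barrierPoint S (addAt L j s) g i :=
    fun i hi => barrierPoint_pos hS hg hi
  have hq : ∀ i ∈ U, 0 < barrierPoint U L g i := fun i hi => barrierPoint_pos hU hgU hi
  have hpq : ∀ i ∈ U, barrierPoint S L g i ≤ barrierPoint U L g i :=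
    fun i hi => barrierPoint_le_of_subset hU hUS hg hi
  have ha0 : ∀ i ∈ S, 0 < a i := fun i hi => by
    rw [ha]; exact div_pos (mul_pos (hp i hi) (hp' i hi)) (hg i hi)
  have hδ0 := multiplier_addAt_le hg hjS hs (L := L)
  have hδs := multiplier_sub_le_addAt hg hjS hs (L := L)
  have hstep : ∀ i ∈ S, barrierPoint S (addAt L j s) g i = barrierPoint S L g i +
      a i * (multiplier S L g - multiplier S (addAt L j s) g - if j = i then s else 0) :=
    fun i hi => by rw [ha]; exact barrierPoint_addAt hS hg hi
  have hsum := sum_barrierPoint hS hg (L := addAt L j s)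
  rw [Finset.sum_congr rfl hstep, Finset.sum_add_distrib, sum_barrierPoint hS hg] at hsum
  have hq1 := sum_barrierPoint hU hgU (L := L)
  rw [barrierMin_addAt hg hjS]
  have hsplit : ∑ i ∈ S, g i *
      logGap (barrierPoint S (addAt L j s) g i / barrierPoint S L g i) ≥
      ∑ i ∈ U, g i * logGap (barrierPoint S (addAt L j s) g i / barrierPoint S L g i) :=
    Finset.sum_le_sum_of_subset_of_nonneg hUS fun i hi _ => mul_nonneg (hg i hi).le
      (logGap_nonneg (div_pos (hp' i hi) (hp i hi)))
  have hstepj := hstep j hjS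
  rw [if_pos rfl] at hstepj
  set p := barrierPoint S L g
  set p' := barrierPoint S (addAt L j s) g
  set q := barrierPoint U L g
  set δ := multiplier S L g - multiplier S (addAt L j s) g with hδ
  set A := ∑ i ∈ U, a i with hA
  set B := ∑ i ∈ S \ U, a i with hB
  have hA0 : 0 < A := Finset.sum_pos (fun i hi => ha0 i (hUS hi)) hU
  have hB0 : 0 ≤ B := Finset.sum_nonneg fun i hi => (ha0 i (Finset.mem_sdiff.1 hi).1).le
  have hAB : ∑ i ∈ S, a i = A + B := by
    rw [← Finset.sum_sdiff hUS, add_comm]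
  have haj := ha0 j hjS
  have hajA : a j ≤ A := Finset.single_le_sum (f := a) (fun i hi => (ha0 i (hUS hi)).le) hj
  have hspike : ∀ R : Finset ι, j ∈ R → ∀ c : ℝ,
      ∑ i ∈ R, a i * (c - if j = i then s else 0) = (∑ i ∈ R, a i) * c - a j * s := by
    intro R hR c
    simp only [mul_sub, Finset.sum_sub_distrib, ← Finset.sum_mul, mul_ite, mul_zero,
      Finset.sum_ite_eq, if_pos hR]
  have hδeq : (A + B) * δ = a j * s := by
    rw [hspike S hjS, hAB] at hsum; linarith
  -- δ is the drop of the multiplier on `S`, fixed by (A + B) δ = s a j. The number η is the drop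
  -- that would balance the same increments `a` on `U` alone. Their difference a j s B / (A (A + B))
  -- produces the factor B of the bound.
  set η := a j * s / A with hη
  have hηeq : A * η = a j * s := by rw [hη]; field_simp
  have hη0 : 0 ≤ η := by positivity
  have hηs : η ≤ s := by
    rw [hη, div_le_iff₀ hA0]; nlinarith
  have hδη : δ ≤ η := by
    have : A * δ ≤ A * η := by nlinarith [mul_nonneg hB0 (sub_nonneg.2 hδ0)]
    exact le_of_mul_le_mul_left this hA0
  have hδnn : 0 ≤ δ := by linarith
  have hδs' : δ ≤ s := by linarith
  -- The competitor on the small simplex.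
  set x : ι → ℝ := fun i => q i + a i * (η - if j = i then s else 0) with hx
  have hxj : x j = q j - a j * (s - η) := by simp only [hx, if_pos]; ring
  have hxne : ∀ i, j ≠ i → x i = q i + a i * η := by
    intro i hi; simp only [hx, if_neg hi]; ring
  have hratio : p' j / p j ≤ x j / q j := by
    have h1 : p' j = p j - a j * (s - δ) := by rw [hstepj]; ring
    rw [hxj, h1, sub_div, sub_div, div_self (hp j hjS).ne', div_self (hq j hj).ne']
    have h3 : a j * (s - η) ≤ a j * (s - δ) := mul_le_mul_of_nonneg_left (by linarith) haj.le
    have : a j * (s - η) / q j ≤ a j * (s - δ) / p j :=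
      div_le_div₀ (mul_nonneg haj.le (by linarith)) h3 (hp j hjS) (hpq j hj)
    linarith
  have hxpos : ∀ i ∈ U, 0 < x i := by
    intro i hi
    by_cases hij : j = i
    · subst hij
      have := lt_of_lt_of_le (div_pos (hp' j hjS) (hp j hjS)) hratio
      exact (div_pos_iff_of_pos_right (hq j hj)).1 this
    · rw [hxne i hij]
      have := mul_nonneg (ha0 i (hUS hi)).le hη0
      linarith [hq i hi]
  have hx1 : ∑ i ∈ U, x i = 1 := by
    simp only [hx]
    rw [Finset.sum_add_distrib, hspike U hj, hq1, ← hA]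
    linarith
  have hΨ := barrierMin_le hU hgU (L := addAt L j s) hxpos hx1
  rw [barrierObjective_addAt hj, barrierObjective_eq hU hgU hxpos hx1] at hΨ
  -- At `j` both ratios are at most 1 and the competitor's is the larger, so monotonicity suffices.
  -- Elsewhere p ≤ q lets q be replaced by p in the ratio, and the tangent inequality compares the
  -- increments a η and a δ; the weights cancel because `a i = p i * p' i / g i`.
  have hgap : ∀ i ∈ U, g i * logGap (x i / q i) ≤ g i * logGap (p' i / p i) +
      a i * ((η - δ) * η) := by
    intro i hi
    have hiS := hUS hi
    have hpi := hp i hiS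
    have hpi' := hp' i hiS
    have hqi := hq i hi
    have hgi := hg i hiS
    by_cases hij : j = i
    · subst hij
      have h1 : x j / q j ≤ 1 := by
        rw [div_le_one hqi, hxj]
        have := mul_nonneg haj.le (sub_nonneg.2 hηs)
        linarith
      have h2 := logGap_anti (div_pos hpi' hpi) hratio h1
      have h3 := mul_le_mul_of_nonneg_left h2 hgi.le
      have h4 := mul_nonneg haj.le (mul_nonneg (sub_nonneg.2 hδη) hη0)
      linarith
    · have h0 := ha0 i hiS
      have e1 : p' i = p i + a i * δ := by rw [hstep i hiS, if_neg hij, sub_zero]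
      have hz0 : 0 < (p i + a i * η) / p i := by positivity
      have h1 : logGap (x i / q i) ≤ logGap ((p i + a i * η) / p i) := by
        refine logGap_mono ?_ ?_
        · rw [one_le_div hqi, hxne i hij]
          have := mul_nonneg h0.le hη0
          linarith
        · rw [hxne i hij, add_div, add_div, div_self hqi.ne', div_self hpi.ne']
          have : a i * η / q i ≤ a i * η / p i :=
            div_le_div_of_nonneg_left (mul_nonneg h0.le hη0) hpi (hpq i hi)
          linarith
      have h2 := logGap_sub_le (div_pos hpi' hpi) hz0
      have h3 : g i * (((p i + a i * η) / p i - p' i / p i) *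
          (1 - 1 / ((p i + a i * η) / p i))) ≤ a i * ((η - δ) * η) := by
        have e2 : ((p i + a i * η) / p i - p' i / p i) *
          (1 - 1 / ((p i + a i * η) / p i)) =
            a i * (η - δ) / p i * (a i * η / (p i + a i * η)) := by
          rw [e1]
          have : p i + a i * η ≠ 0 := by positivity
          field_simp
          ring
        have h4 : a i * η / (p i + a i * η) ≤ a i * η / p' i := by
          refine div_le_div_of_nonneg_left (mul_nonneg h0.le hη0) hpi' ?_
          rw [e1]
          have := mul_le_mul_of_nonneg_left hδη h0.le
          linarith
        have e3 : g i * (a i * (η - δ) / p i * (a i * η / p' i)) = a i * ((η - δ) * η) := by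
          have : a i * (p i * p' i / g i)⁻¹ = 1 := by
            rw [← ha]; exact mul_inv_cancel₀ h0.ne'
          have e4 : g i * (a i * (η - δ) / p i * (a i * η / p' i)) =
              a i * (p i * p' i / g i)⁻¹ * (a i * ((η - δ) * η)) := by field_simp
          rw [e4, this, one_mul]
        rw [e2, ← e3]
        refine mul_le_mul_of_nonneg_left (mul_le_mul_of_nonneg_left h4 ?_) hgi.le
        exact div_nonneg (mul_nonneg h0.le (by linarith)) hpi.le
      nlinarith
  have hgapsum := Finset.sum_le_sum hgap
  rw [Finset.sum_add_distrib, ← Finset.sum_mul, ← hA] at hgapsum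
  have hfinal : 2 * s ^ 2 * a j ^ 2 * B / (A * (A + B)) = 2 * (s * a j) * (η - δ) := by
    have hABp : 0 < A + B := by linarith
    have e1 : δ = a j * s / (A + B) := by rw [eq_div_iff hABp.ne']; linarith
    rw [e1, hη]
    field_simp
    ring
  rw [hfinal]
  have hA2 : A * ((η - δ) * η) = (η - δ) * (a j * s) := by rw [← hηeq]; ring
  rw [hA2] at hgapsum
  -- The linear terms give one copy of s a j (η - δ) and the Bregman terms the other, whence the
  -- factor 2.
  have h9 : s * (p j - q j) - s * p' j + s * x j = s * a j * (η - δ) := by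
    rw [hxj, hstepj]; ring
  nlinarith

end Stability

/-! ### Stability cost of one round, and the initial and final potentials. -/

section StabilityBound

variable {ι : Type*} [DecidableEq ι] {S U : Finset ι} {L g : ι → ℝ} {j : ι} {s : ℝ}

theorem le_barrierPoint_addAt (hg : ∀ i ∈ S, 0 < g i) (hj : j ∈ S) (hs : 0 ≤ s) {i : ι}
    (hi : i ∈ S) (hij : j ≠ i) : barrierPoint S L g i ≤ barrierPoint S (addAt L j s) g i := by
  have hS : S.Nonempty := ⟨j, hj⟩
  have h := barrierPoint_addAt hS hg hi (L := L) (j := j) (s := s)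
  rw [if_neg hij, sub_zero] at h
  have h1 := multiplier_addAt_le hg hj hs (L := L)
  have := mul_nonneg (div_nonneg (mul_nonneg (barrierPoint_nonneg hS hg i (L := L))
    (barrierPoint_nonneg hS hg i (L := addAt L j s))) (hg i hi).le) (sub_nonneg.2 h1)
  linarith

theorem barrierPoint_addAt_le_self (hg : ∀ i ∈ S, 0 < g i) (hj : j ∈ S) (hs : 0 ≤ s) :
    barrierPoint S (addAt L j s) g j ≤ barrierPoint S L g j := by
  have hS : S.Nonempty := ⟨j, hj⟩
  have h := barrierPoint_addAt hS hg hj (L := L) (j := j) (s := s)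
  rw [if_pos rfl] at h
  have h1 := multiplier_sub_le_addAt hg hj hs (L := L)
  have := mul_nonneg (div_nonneg (mul_nonneg (barrierPoint_nonneg hS hg j (L := L))
    (barrierPoint_nonneg hS hg j (L := addAt L j s))) (hg j hj).le)
    (show 0 ≤ s - (multiplier S L g - multiplier S (addAt L j s) g) by linarith)
  linarith

theorem barrierPoint_sub_addAt_le (hg : ∀ i ∈ S, 0 < g i) (hj : j ∈ S) (hs : 0 ≤ s)
    (hsp : s * barrierPoint S L g j ≤ 1) :
    barrierPoint S L g j - barrierPoint S (addAt L j s) g j ≤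
      barrierPoint S (addAt L j s) g j / g j := by
  have hS : S.Nonempty := ⟨j, hj⟩
  have h := barrierPoint_addAt hS hg hj (L := L) (j := j) (s := s)
  rw [if_pos rfl] at h
  have h1 := multiplier_addAt_le hg hj hs (L := L)
  have hp := barrierPoint_nonneg hS hg j (L := L)
  have hp' := barrierPoint_nonneg hS hg j (L := addAt L j s)
  have h2 := div_nonneg (mul_nonneg hp hp') (hg j hj).le
  have h3 : barrierPoint S L g j * barrierPoint S (addAt L j s) g j / g j * s ≤
      barrierPoint S (addAt L j s) g j / g j := by
    have := mul_le_mul_of_nonneg_right hsp (div_nonneg hp' (hg j hj).le)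
    calc _ = s * barrierPoint S L g j * (barrierPoint S (addAt L j s) g j / g j) := by ring
      _ ≤ _ := by linarith
  nlinarith [mul_nonneg h2 (sub_nonneg.2 h1)]

theorem half_le_barrierPoint_addAt (hg : ∀ i ∈ S, 1 ≤ g i) (hj : j ∈ S) (hs : 0 ≤ s)
    (hsp : s * barrierPoint S L g j ≤ 1) :
    barrierPoint S L g j / 2 ≤ barrierPoint S (addAt L j s) g j := by
  have hg0 : ∀ i ∈ S, 0 < g i := fun i hi => by linarith [hg i hi]
  have h := barrierPoint_sub_addAt_le hg0 hj hs hsp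
  have := div_le_self (barrierPoint_nonneg ⟨j, hj⟩ hg0 j (L := addAt L j s)) (hg j hj)
  linarith

/-- The mass gained by `i` is at most what `j` loses, which is at most p j / 2. If p i more than
doubled, the new value would therefore be at most p j; but doubling also forces g i < p' i δ ≤ p j s
≤ 1, against `2 ≤ g i`. -/
theorem barrierPoint_addAt_le_two_mul (hg : ∀ i ∈ S, 2 ≤ g i) (hj : j ∈ S) (hs : 0 ≤ s)
    (hsp : s * barrierPoint S L g j ≤ 1) {i : ι} (hi : i ∈ S) (hij : j ≠ i) :
    barrierPoint S (addAt L j s) g i ≤ 2 * barrierPoint S L g i := by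
  have hg0 : ∀ i ∈ S, 0 < g i := fun i hi => by linarith [hg i hi]
  have hS : S.Nonempty := ⟨j, hj⟩
  have hpj := barrierPoint_sub_addAt_le hg0 hj hs hsp
  have hpj' := barrierPoint_addAt_le_self hg0 hj hs (L := L)
  have h := barrierPoint_addAt hS hg0 hi (L := L) (j := j) (s := s)
  rw [if_neg hij, sub_zero] at h
  have hδs := multiplier_sub_le_addAt hg0 hj hs (L := L)
  have hmass : barrierPoint S (addAt L j s) g i - barrierPoint S L g i ≤
      barrierPoint S L g j - barrierPoint S (addAt L j s) g j := by
    have h1 := sum_barrierPoint hS hg0 (L := L)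
    have h2 := sum_barrierPoint hS hg0 (L := addAt L j s)
    rw [← Finset.add_sum_erase _ _ hj] at h1 h2
    have h3 := Finset.single_le_sum
      (f := fun i => barrierPoint S (addAt L j s) g i - barrierPoint S L g i)
      (s := S.erase j) (fun k hk => sub_nonneg.2 (le_barrierPoint_addAt hg0 hj hs
        (Finset.mem_of_mem_erase hk) (Finset.ne_of_mem_erase hk).symm))
      (Finset.mem_erase.2 ⟨hij.symm, hi⟩)
    simp only [Finset.sum_sub_distrib] at h3
    linarith
  have hgi := hg i hi
  have hgj := hg j hj
  have hp := barrierPoint_pos hS hg0 hi (L := L)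
  have hpjpos := barrierPoint_pos hS hg0 hj (L := L)
  set p := barrierPoint S L g i
  set p' := barrierPoint S (addAt L j s) g i
  set pj := barrierPoint S L g j
  set δ := multiplier S L g - multiplier S (addAt L j s) g
  by_contra! hlt
  have h1 : p' ≤ pj := by
    have : barrierPoint S (addAt L j s) g j / g j ≤ pj / 2 :=
      div_le_div₀ hpjpos.le hpj' two_pos hgj
    linarith
  have h2 : g i < p' * δ := by
    have h4 : p * g i < p * (p' * δ) := by
      have : p * p' / g i * δ * g i = p * (p' * δ) := by field_simp
      rw [← this]
      exact mul_lt_mul_of_pos_right (by linarith) (by linarith)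
    exact lt_of_mul_lt_mul_left h4 hp.le
  have h3 : p' * δ ≤ pj * s := mul_le_mul h1 (by linarith) (by
    by_contra! hneg
    nlinarith) hpjpos.le
  linarith

/-- A bound for the stability term of one round when arm `j` is played, with `p` the distribution
on all arms, `g` the weights of the barrier, and `U` the arms of the competitor. -/
def stabilityBound [Fintype ι] (U : Finset ι) (g p : ι → ℝ) (j : ι) : ℝ :=
  if j ∈ U then
    16 * (1 / g j) * (p j ^ 2 / g j / ∑ i ∈ U, p i ^ 2 / g i) *
      ((∑ i ∈ Uᶜ, p i ^ 2 / g i) / (∑ i ∈ U, p i ^ 2 / g i + ∑ i ∈ Uᶜ, p i ^ 2 / g i))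
  else 1 / g j

theorem ratio_le_of_le_two_mul {A A' B B' : ℝ} (hA : 0 < A) (hA' : A / 2 ≤ A') (hB : 0 ≤ B')
    (hB' : B' ≤ 2 * B) : B' / (A' * (A' + B')) ≤ 8 * (B / (A * (A + B))) := by
  have hB0 : 0 ≤ B := by linarith
  have h1 : 0 < A' := by linarith
  rw [← mul_div_assoc, div_le_div_iff₀ (by positivity) (by positivity)]
  have h2 : B' * (A + B) ≤ 2 * B * (2 * (A' + B')) := by
    nlinarith [mul_nonneg hB (sub_nonneg.2 hA'), mul_nonneg hB0 (sub_nonneg.2 hA'),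
      mul_nonneg hB0 hA.le, mul_nonneg hB0 hB]
  have h3 : 0 ≤ B * (A' + B') := by positivity
  calc B' * (A * (A + B)) = A * (B' * (A + B)) := by ring
    _ ≤ A * (2 * B * (2 * (A' + B'))) := mul_le_mul_of_nonneg_left h2 hA.le
    _ = 4 * A * (B * (A' + B')) := by ring
    _ ≤ 8 * A' * (B * (A' + B')) := mul_le_mul_of_nonneg_right (by linarith) h3
    _ = 8 * B * (A' * (A' + B')) := by ring

set_option maxHeartbeats 800000 in
-- Replaces the unknown next point by the current one. Since `s * p j ≤ 1`, coordinates lose at most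
-- a factor 2, and those outside `U` gain at most a factor 2 when `j ∈ U`; the quotient of sums then
-- changes by at most 8, and 2 * 8 = 16. If `j ∉ U`, the face does not see the loss and the crude
-- quadratic bound is enough.
theorem stability_sub_le_stabilityBound [Fintype ι] (hU : U.Nonempty) (hg : ∀ i, 2 ≤ g i)
    (hs : 0 ≤ s) (hsp : s * barrierPoint Finset.univ L g j ≤ 1) :
    s * (barrierPoint Finset.univ L g j - barrierPoint U L g j) -
      ((barrierMin Finset.univ (addAt L j s) g - barrierMin U (addAt L j s) g) -
        (barrierMin Finset.univ L g - barrierMin U L g)) ≤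
      stabilityBound U g (barrierPoint Finset.univ L g) j := by
  have hg0 : ∀ i, 0 < g i := fun i => by linarith [hg i]
  have hg0' : ∀ i ∈ Finset.univ, 0 < g i := fun i _ => hg0 i
  have hS : (Finset.univ : Finset ι).Nonempty := ⟨j, Finset.mem_univ j⟩
  have hp : ∀ i, 0 < barrierPoint Finset.univ L g i :=
    fun i => barrierPoint_pos hS hg0' (Finset.mem_univ i)
  unfold stabilityBound
  split_ifs with hj
  · refine (stability_sub_le (Finset.subset_univ U) hg0' hj hs (fun i => rfl)).trans ?_
    rw [← Finset.compl_eq_univ_sdiff]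
    have hself := barrierPoint_addAt_le_self hg0' (Finset.mem_univ j) hs (L := L)
    have hhalf := half_le_barrierPoint_addAt (fun i _ => by linarith [hg i])
      (Finset.mem_univ j) hs hsp
    have hother : ∀ i, j ≠ i → _ :=
      fun i hij => le_barrierPoint_addAt hg0' (Finset.mem_univ j) hs (L := L) (Finset.mem_univ i) hij
    have htwo : ∀ i, j ≠ i → _ := fun i hij => barrierPoint_addAt_le_two_mul (fun i _ => hg i)
      (Finset.mem_univ j) hs hsp (Finset.mem_univ i) hij
    have hp' : ∀ i, 0 < barrierPoint Finset.univ (addAt L j s) g i :=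
      fun i => barrierPoint_pos hS hg0' (Finset.mem_univ i)
    set p := barrierPoint Finset.univ L g
    set p' := barrierPoint Finset.univ (addAt L j s) g
    set A := ∑ i ∈ U, p i ^ 2 / g i with hA
    set B := ∑ i ∈ Uᶜ, p i ^ 2 / g i with hB
    have hA0 : 0 < A := Finset.sum_pos (fun i _ => div_pos (pow_pos (hp i) 2) (hg0 i)) hU
    have hA' : A / 2 ≤ ∑ i ∈ U, p i * p' i / g i := by
      rw [hA, Finset.sum_div]
      refine Finset.sum_le_sum fun i _ => ?_
      rw [div_right_comm]
      refine div_le_div_of_nonneg_right ?_ (hg0 i).le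
      have : p i / 2 ≤ p' i := by
        by_cases hij : j = i
        · exact hij ▸ hhalf
        · linarith [hother i hij, hp i]
      nlinarith [hp i]
    have hB' : ∑ i ∈ Uᶜ, p i * p' i / g i ≤ 2 * B := by
      rw [hB, Finset.mul_sum]
      refine Finset.sum_le_sum fun i hi => ?_
      rw [← mul_div_assoc]
      refine div_le_div_of_nonneg_right ?_ (hg0 i).le
      have hij : j ≠ i := fun h => Finset.mem_compl.1 hi (h ▸ hj)
      nlinarith [hp i, htwo i hij]
    have hB0 : 0 ≤ ∑ i ∈ Uᶜ, p i * p' i / g i :=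
      Finset.sum_nonneg fun i _ => (div_pos (mul_pos (hp i) (hp' i)) (hg0 i)).le
    have hratio := ratio_le_of_le_two_mul hA0 hA' hB0 hB'
    have haj : s ^ 2 * (p j * p' j / g j) ^ 2 ≤ 1 / g j * (p j ^ 2 / g j) := by
      have h1 : s ^ 2 * (p j * p' j / g j) ^ 2 = (s * p j) ^ 2 * p' j ^ 2 / g j / g j := by ring
      have h2 : 1 / g j * (p j ^ 2 / g j) = 1 * p j ^ 2 / g j / g j := by ring
      rw [h1, h2]
      have h3 : (s * p j) ^ 2 ≤ 1 := pow_le_one₀ (mul_nonneg hs (hp j).le) hsp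
      have h4 : p' j ^ 2 ≤ p j ^ 2 := pow_le_pow_left₀ (hp' j).le hself 2
      have := hg0 j
      gcongr
    have hB00 : 0 ≤ B := by linarith
    calc _ = 2 * (s ^ 2 * (p j * p' j / g j) ^ 2) * ((∑ i ∈ Uᶜ, p i * p' i / g i) /
          ((∑ i ∈ U, p i * p' i / g i) *
            (∑ i ∈ U, p i * p' i / g i + ∑ i ∈ Uᶜ, p i * p' i / g i))) := by ring
      _ ≤ 2 * (1 / g j * (p j ^ 2 / g j)) * (8 * (B / (A * (A + B)))) := by
          have := hg0 j
          have := hp j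
          refine mul_le_mul (by linarith) hratio (div_nonneg hB0 ?_) (by positivity)
          have : 0 < ∑ i ∈ U, p i * p' i / g i := by linarith
          positivity
      _ = _ := by
          have : 0 < A + B := by linarith
          have := hg0 j
          field_simp
          ring
  · rw [barrierMin_addAt_of_notMem hU (fun i _ => hg0 i) hj, barrierPoint_of_notMem hj]
    have h := stability_le_sq hg0' (Finset.mem_univ j) hs (L := L)
    have h2 : s ^ 2 * barrierPoint Finset.univ L g j ^ 2 / g j ≤ 1 / g j := by
      refine div_le_div_of_nonneg_right ?_ (hg0 j).le
      rw [← mul_pow]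
      exact pow_le_one₀ (mul_nonneg hs (hp j).le) hsp
    linarith

theorem stabilityBound_nonneg [Fintype ι] {p : ι → ℝ} (hg : ∀ i, 1 ≤ g i) (j : ι) :
    0 ≤ stabilityBound U g p j := by
  have hg0 : ∀ i, 0 < g i := fun i => by linarith [hg i]
  have h0 : ∀ i, 0 ≤ p i ^ 2 / g i := fun i => div_nonneg (sq_nonneg _) (hg0 i).le
  have h1 : ∀ R : Finset ι, 0 ≤ ∑ i ∈ R, p i ^ 2 / g i := fun R => Finset.sum_nonneg fun i _ => h0 i
  have := hg0 j
  have := h0 j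
  have := h1 U
  have := h1 Uᶜ
  unfold stabilityBound
  split_ifs <;> positivity

theorem stabilityBound_le [Fintype ι] {p : ι → ℝ} (hg : ∀ i, 1 ≤ g i) (j : ι) :
    stabilityBound U g p j ≤ 16 := by
  have hg0 : ∀ i, 0 < g i := fun i => by linarith [hg i]
  have h0 : ∀ i, 0 ≤ p i ^ 2 / g i := fun i => div_nonneg (sq_nonneg _) (hg0 i).le
  have h1 : ∀ R : Finset ι, 0 ≤ ∑ i ∈ R, p i ^ 2 / g i := fun R => Finset.sum_nonneg fun i _ => h0 i
  have h2 : 1 / g j ≤ 1 := by rw [div_le_one (hg0 j)]; exact hg j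
  have h20 : 0 ≤ 1 / g j := (div_pos one_pos (hg0 j)).le
  unfold stabilityBound
  split_ifs with hj
  · have h3 : p j ^ 2 / g j / ∑ i ∈ U, p i ^ 2 / g i ≤ 1 :=
      div_le_one_of_le₀ (Finset.single_le_sum (fun i _ => h0 i) hj) (h1 U)
    have h30 := div_nonneg (h0 j) (h1 U)
    have h4 : (∑ i ∈ Uᶜ, p i ^ 2 / g i) /
        (∑ i ∈ U, p i ^ 2 / g i + ∑ i ∈ Uᶜ, p i ^ 2 / g i) ≤ 1 :=
      div_le_one_of_le₀ (by linarith [h1 U]) (add_nonneg (h1 U) (h1 Uᶜ))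
    have h40 := div_nonneg (h1 Uᶜ) (add_nonneg (h1 U) (h1 Uᶜ))
    have h5 := mul_le_one₀ h2 h30 h3
    have h6 := mul_le_one₀ h5 h40 h4
    linarith
  · linarith

/-- The share of arm `j ∈ U` in the mass that `p` puts outside `U`. -/
def outsideShare [Fintype ι] (U : Finset ι) (g p : ι → ℝ) (j : ι) : ℝ :=
  (p j ^ 2 / g j / ∑ i ∈ U, p i ^ 2 / g i) * min (p j) (∑ i ∈ Uᶜ, p i)

section Share

variable [Fintype ι] {p : ι → ℝ}

theorem outsideShare_nonneg (hg : ∀ i, 1 ≤ g i) (hp : ∀ i, 0 < p i) (j : ι) :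
    0 ≤ outsideShare U g p j := by
  have hg0 : ∀ i, 0 < g i := fun i => by linarith [hg i]
  have h0 : ∀ i, 0 ≤ p i ^ 2 / g i := fun i => div_nonneg (sq_nonneg _) (hg0 i).le
  exact mul_nonneg (div_nonneg (h0 j) (Finset.sum_nonneg fun i _ => h0 i))
    (le_min (hp j).le (Finset.sum_nonneg fun i _ => (hp i).le))

theorem outsideShare_le (hg : ∀ i, 1 ≤ g i) (hp : ∀ i, 0 < p i) (hj : j ∈ U) :
    outsideShare U g p j ≤ p j := by
  have hg0 : ∀ i, 0 < g i := fun i => by linarith [hg i]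
  have h0 : ∀ i, 0 ≤ p i ^ 2 / g i := fun i => div_nonneg (sq_nonneg _) (hg0 i).le
  have h3 : p j ^ 2 / g j / ∑ i ∈ U, p i ^ 2 / g i ≤ 1 :=
    div_le_one_of_le₀ (Finset.single_le_sum (fun i _ => h0 i) hj)
      (Finset.sum_nonneg fun i _ => h0 i)
  exact (mul_le_of_le_one_left (le_min (hp j).le (Finset.sum_nonneg fun i _ => (hp i).le))
    h3).trans (min_le_left _ _)

theorem sum_outsideShare_le (hg : ∀ i, 1 ≤ g i) (hp : ∀ i, 0 < p i) :
    ∑ j ∈ U, outsideShare U g p j ≤ ∑ i ∈ Uᶜ, p i := by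
  have hg0 : ∀ i, 0 < g i := fun i => by linarith [hg i]
  have h0 : ∀ i, 0 ≤ p i ^ 2 / g i := fun i => div_nonneg (sq_nonneg _) (hg0 i).le
  have hV : 0 ≤ ∑ i ∈ Uᶜ, p i := Finset.sum_nonneg fun i _ => (hp i).le
  calc ∑ j ∈ U, outsideShare U g p j
      ≤ ∑ j ∈ U, (p j ^ 2 / g j / ∑ i ∈ U, p i ^ 2 / g i) * ∑ i ∈ Uᶜ, p i :=
        Finset.sum_le_sum fun j _ => mul_le_mul_of_nonneg_left (min_le_right _ _)
          (div_nonneg (h0 j) (Finset.sum_nonneg fun i _ => h0 i))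
    _ ≤ _ := by
        rw [← Finset.sum_mul, ← Finset.sum_div]
        exact mul_le_of_le_one_left hV (div_self_le_one _)

/-- The weights `p j ^ 2 / g j / A` sum to one over `U`, so it suffices to bound p j / g j * (B / (A
+ B)). If p j is at most the outside mass, the fraction is bounded by 1 and the minimum in
`outsideShare` is p j. Otherwise A + B ≥ p j ^ 2 / g j reduces it to B / p j, and every outside
coordinate is at most p j, which leaves ∑ p i / g i. The direct cost of arms outside `U` raises 16
to 17. -/
theorem sum_mul_stabilityBound_le (hU : U.Nonempty) (hg : ∀ i, 1 ≤ g i) (hp : ∀ i, 0 < p i) :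
    ∑ j, p j * stabilityBound U g p j ≤
      17 * ∑ i ∈ Uᶜ, p i / g i + 16 * ∑ j ∈ U, outsideShare U g p j / g j := by
  have hg0 : ∀ i, 0 < g i := fun i => by linarith [hg i]
  have h0 : ∀ i, 0 < p i ^ 2 / g i := fun i => div_pos (pow_pos (hp i) 2) (hg0 i)
  set A := ∑ i ∈ U, p i ^ 2 / g i with hA
  set B := ∑ i ∈ Uᶜ, p i ^ 2 / g i with hB
  set X := ∑ i ∈ Uᶜ, p i / g i with hX
  have hA0 : 0 < A := Finset.sum_pos (fun i _ => h0 i) hU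
  have hB0 : 0 ≤ B := Finset.sum_nonneg fun i _ => (h0 i).le
  have hX0 : 0 ≤ X := Finset.sum_nonneg fun i _ => (div_pos (hp i) (hg0 i)).le
  have hin : ∀ j ∈ U, p j * stabilityBound U g p j ≤
      16 * (p j ^ 2 / g j / A * X) + 16 * (outsideShare U g p j / g j) := by
    intro j hj
    have hw : 0 ≤ p j ^ 2 / g j / A := (div_pos (h0 j) hA0).le
    have key : p j / g j * (B / (A + B)) ≤ X + min (p j) (∑ i ∈ Uᶜ, p i) / g j := by
      rcases le_total (p j) (∑ i ∈ Uᶜ, p i) with h | h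
      · rw [min_eq_left h]
        have h1 : B / (A + B) ≤ 1 := div_le_one_of_le₀ (by linarith) (by linarith)
        have := mul_le_of_le_one_right (div_pos (hp j) (hg0 j)).le h1
        linarith
      · have h1 : p j / g j * (B / (A + B)) ≤ X := by
          have h2 : p j ^ 2 / g j ≤ A + B := by
            have := Finset.single_le_sum (f := fun i => p i ^ 2 / g i) (fun i _ => (h0 i).le) hj
            linarith
          have h3 : p j / g j * (B / (A + B)) ≤ p j / g j * (B / (p j ^ 2 / g j)) :=
            mul_le_mul_of_nonneg_left (div_le_div_of_nonneg_left hB0 (h0 j) h2)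
              (div_pos (hp j) (hg0 j)).le
          refine h3.trans ?_
          have h4 : p j / g j * (B / (p j ^ 2 / g j)) = B / p j := by
            have := hp j
            have := hg0 j
            field_simp
          rw [h4, div_le_iff₀ (hp j), hB, hX, Finset.sum_mul]
          refine Finset.sum_le_sum fun i hi => ?_
          have h5 : p i ≤ p j :=
            (Finset.single_le_sum (f := p) (fun i _ => (hp i).le) hi).trans h
          rw [div_mul_eq_mul_div]
          refine div_le_div_of_nonneg_right ?_ (hg0 i).le
          rw [sq]
          exact mul_le_mul_of_nonneg_left h5 (hp i).le
        have : 0 ≤ min (p j) (∑ i ∈ Uᶜ, p i) / g j :=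
          div_nonneg (le_min (hp j).le (Finset.sum_nonneg fun i _ => (hp i).le)) (hg0 j).le
        linarith
    have h6 := mul_le_mul_of_nonneg_left key hw
    unfold stabilityBound outsideShare
    rw [if_pos hj, ← hA, ← hB]
    calc _ = 16 * (p j ^ 2 / g j / A * (p j / g j * (B / (A + B)))) := by ring
      _ ≤ 16 * (p j ^ 2 / g j / A * (X + min (p j) (∑ i ∈ Uᶜ, p i) / g j)) := by linarith
      _ = _ := by ring
  have hout : ∀ j ∈ Uᶜ, p j * stabilityBound U g p j ≤ p j / g j := by
    intro j hj
    unfold stabilityBound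
    rw [if_neg (Finset.mem_compl.1 hj), mul_one_div]
  have h1 := Finset.sum_le_sum hin
  have h2 := Finset.sum_le_sum hout
  rw [Finset.sum_add_distrib, ← Finset.mul_sum, ← Finset.mul_sum, ← Finset.sum_mul,
    ← Finset.sum_div, ← hA, div_self hA0.ne', one_mul] at h1
  rw [← Finset.sum_add_sum_compl U]
  linarith

end Share

section Endpoints

variable [Fintype ι]

omit [DecidableEq ι] in
theorem barrierMin_sub_nonneg (hU : U.Nonempty) (hg : ∀ i, 0 < g i) :
    0 ≤ barrierMin Finset.univ 0 g - barrierMin U 0 g := by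
  have hS : (Finset.univ : Finset ι).Nonempty := hU.mono (Finset.subset_univ U)
  have hg0 : ∀ i ∈ Finset.univ, 0 < g i := fun i _ => hg i
  unfold barrierMin barrierObjective
  rw [sub_nonneg]
  refine (Finset.sum_le_sum fun i hi => ?_).trans
    (Finset.sum_le_sum_of_subset_of_nonneg (Finset.subset_univ U) fun i _ _ => ?_)
  · have := Real.log_le_log (barrierPoint_pos hS hg0 (Finset.mem_univ i) (L := 0))
      (barrierPoint_le_of_subset hU (Finset.subset_univ U) hg0 hi)
    have := mul_le_mul_of_nonneg_left this (hg i).le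
    simp only [Pi.zero_apply, mul_zero]
    linarith
  · have := Real.log_nonpos (barrierPoint_nonneg hS hg0 i (L := 0))
      (barrierPoint_le_one hS hg0 i)
    simp only [Pi.zero_apply, mul_zero]
    nlinarith [hg i]

/-- The test point puts mass ε on each arm outside `U` and scales the minimizer on `U` by 1 - m,
where m is the mass moved. Scaling costs `-log (1 - m) ≤ 2 * m` per unit of weight; the new arms
cost their estimated losses and `log (1 / ε)`. -/
theorem barrierMin_sub_le (hU : U.Nonempty) (hg : ∀ i, 0 < g i) (hL : ∀ i, 0 ≤ L i) {ε : ℝ}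
    (hε : 0 < ε) (hεU : ε * (Uᶜ.card : ℝ) ≤ 1 / 2) :
    barrierMin Finset.univ L g - barrierMin U L g ≤
      ε * ∑ i ∈ Uᶜ, L i + Real.log (1 / ε) * ∑ i ∈ Uᶜ, g i
        + 2 * (ε * (Uᶜ.card : ℝ)) * ∑ i ∈ U, g i := by
  have hS : (Finset.univ : Finset ι).Nonempty := hU.mono (Finset.subset_univ U)
  have hgU : ∀ i ∈ U, 0 < g i := fun i _ => hg i
  have hq : ∀ i ∈ U, 0 < barrierPoint U L g i := fun i hi => barrierPoint_pos hU hgU hi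
  set q := barrierPoint U L g with hqdef
  set m := ε * (Uᶜ.card : ℝ) with hm
  have hm0 : 0 ≤ m := by positivity
  set x : ι → ℝ := fun i => if i ∈ U then (1 - m) * q i else ε with hx
  have hxU : ∀ i ∈ U, x i = (1 - m) * q i := fun i hi => if_pos hi
  have hxV : ∀ i ∈ Uᶜ, x i = ε := fun i hi => if_neg (Finset.mem_compl.1 hi)
  have hxpos : ∀ i ∈ Finset.univ, 0 < x i := by
    intro i _
    simp only [hx]
    split_ifs with hi
    · exact mul_pos (by linarith) (hq i hi)
    · exact hε
  have hx1 : ∑ i, x i = 1 := by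
    rw [← Finset.sum_add_sum_compl U, Finset.sum_congr rfl hxU, Finset.sum_congr rfl hxV,
      ← Finset.mul_sum, sum_barrierPoint hU hgU, Finset.sum_const, nsmul_eq_mul, hm]
    ring
  have h := barrierMin_le hS (fun i _ => hg i) (L := L) hxpos hx1
  have e : barrierObjective Finset.univ L g x =
      ∑ i ∈ U, (x i * L i - g i * Real.log (x i)) +
        ∑ i ∈ Uᶜ, (x i * L i - g i * Real.log (x i)) := (Finset.sum_add_sum_compl U _).symm
  have hlogm : -(2 * m) ≤ Real.log (1 - m) := by
    have h1 := Real.one_sub_inv_le_log_of_pos (show 0 < 1 - m by linarith)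
    refine le_trans ?_ h1
    have e1 : 1 - (1 - m)⁻¹ = -(m / (1 - m)) := by
      have : 1 - m ≠ 0 := by linarith
      field_simp; ring
    rw [e1, neg_le_neg_iff, div_le_iff₀ (by linarith)]
    nlinarith
  have h1 : ∑ i ∈ U, (x i * L i - g i * Real.log (x i)) ≤
      barrierMin U L g + 2 * m * ∑ i ∈ U, g i := by
    unfold barrierMin barrierObjective
    rw [← hqdef, Finset.mul_sum, ← Finset.sum_add_distrib]
    refine Finset.sum_le_sum fun i hi => ?_
    rw [hxU i hi, Real.log_mul (by linarith) (hq i hi).ne']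
    have := mul_nonneg hm0 (mul_nonneg (hq i hi).le (hL i))
    nlinarith [hg i]
  have h2 : ∑ i ∈ Uᶜ, (x i * L i - g i * Real.log (x i)) =
      ε * ∑ i ∈ Uᶜ, L i + Real.log (1 / ε) * ∑ i ∈ Uᶜ, g i := by
    rw [Finset.mul_sum, Finset.mul_sum, ← Finset.sum_add_distrib]
    refine Finset.sum_congr rfl fun i hi => ?_
    rw [hxV i hi, one_div, Real.log_inv]
    ring
  linarith

end Endpoints

end StabilityBound

/-! ### The deterministic comparison along one trajectory. -/

section Trajectory

/-- The sum of the loss estimates of the rounds before `t`. -/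
def cumulativeEstimate {K : ℕ} (p : ℕ → Fin K → ℝ) (arm : ℕ → Fin K) (loss : ℕ → Fin K → ℝ)
    (t : ℕ) (i : Fin K) : ℝ :=
  ∑ τ ∈ Finset.range t, lossEstimate (p τ) (arm τ) (loss τ) i

/-- The total coefficient of `-log (q i)` in the regularizer of round `t`, for `α = 0`. -/
def barrierWeight {K : ℕ} (θ : ℝ) (T : ℕ) (p : ℕ → Fin K → ℝ) (t : ℕ) (i : Fin K) : ℝ :=
  162 + learningRate θ 0 T p t i

variable {K T : ℕ} {θ : ℝ} {p : ℕ → Fin K → ℝ} {arm : ℕ → Fin K} {loss : ℕ → Fin K → ℝ}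

theorem barrierWeight_eq (t : ℕ) (i : Fin K) : barrierWeight θ T p t i =
    162 + θ * √(1 + ∑ τ ∈ Finset.range t, max (p τ i) (1 / (T : ℝ))) := by
  unfold barrierWeight learningRate
  simp

theorem barrierWeight_ge (hθ : 0 ≤ θ) (t : ℕ) (i : Fin K) : 162 ≤ barrierWeight θ T p t i := by
  rw [barrierWeight_eq]
  have := mul_nonneg hθ
    (Real.sqrt_nonneg (1 + ∑ τ ∈ Finset.range t, max (p τ i) (1 / (T : ℝ))))
  linarith

theorem barrierWeight_le_succ (hθ : 0 ≤ θ) (t : ℕ) (i : Fin K) :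
    barrierWeight θ T p t i ≤ barrierWeight θ T p (t + 1) i := by
  rw [barrierWeight_eq, barrierWeight_eq, Finset.sum_range_succ]
  have : 0 ≤ max (p t i) (1 / (T : ℝ)) := le_max_of_le_right (by positivity)
  gcongr
  linarith

theorem ftrlObjective_eq (t : ℕ) (q : Fin K → ℝ) :
    ftrlObjective 162 θ 0 T p arm loss t q =
      barrierObjective Finset.univ (cumulativeEstimate p arm loss t) (barrierWeight θ T p t) q := by
  unfold ftrlObjective logBarrier barrierObjective barrierWeight cumulativeEstimate
  rw [Finset.mul_sum, ← Finset.sum_sub_distrib, ← Finset.sum_add_distrib]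
  exact Finset.sum_congr rfl fun i _ => by ring

/-- Strict convexity identifies the played distribution with the closed form. This is also the
source of all measurability of the plays. -/
theorem IsLogBarrierFTRL.eq_barrierPoint (hθ : 0 ≤ θ)
    (h : IsLogBarrierFTRL 162 θ 0 T p arm loss) {t : ℕ} (ht : t < T) :
    p t = barrierPoint Finset.univ (cumulativeEstimate p arm loss t) (barrierWeight θ T p t) := by
  obtain ⟨⟨hpos, hsum⟩, hmin⟩ := h t ht
  have hg : ∀ i ∈ Finset.univ, 0 < barrierWeight θ T p t i := fun i _ => by
    linarith [barrierWeight_ge hθ t i (T := T) (p := p)]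
  have hS : (Finset.univ : Finset (Fin K)).Nonempty := by
    by_contra! h0
    rw [h0, Finset.sum_empty] at hsum
    exact zero_ne_one hsum
  funext i
  refine eq_barrierPoint_of_le hS hg (fun i _ => hpos i) hsum ?_ (Finset.mem_univ i)
  have := hmin (show barrierPoint Finset.univ (cumulativeEstimate p arm loss t)
    (barrierWeight θ T p t) ∈ openSimplex K from
      ⟨fun i => barrierPoint_pos hS hg (Finset.mem_univ i), sum_barrierPoint hS hg⟩)
  simp only [Set.mem_ofPred_eq, ftrlObjective_eq] at this
  exact this

theorem cumulativeEstimate_succ (t : ℕ) :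
    cumulativeEstimate p arm loss (t + 1) =
      addAt (cumulativeEstimate p arm loss t) (arm t) (loss t (arm t) / p t (arm t)) := by
  funext i
  unfold cumulativeEstimate addAt lossEstimate
  rw [Finset.sum_range_succ]
  split_ifs with h
  · rw [h]
  · rw [zero_div]

theorem sum_mul_lossEstimate (q l : Fin K → ℝ) (a : Fin K) (x : Fin K → ℝ) :
    ∑ i, x i * lossEstimate q a l i = l a / q a * x a := by
  unfold lossEstimate
  rw [Finset.sum_eq_single a]
  · rw [if_pos rfl]; ring
  · intro i _ hi
    rw [if_neg hi.symm, zero_div, mul_zero]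
  · intro h; exact absurd (Finset.mem_univ a) h

/-- The distribution of the same algorithm run on the arms in `U` only. -/
def competitor (θ : ℝ) (T : ℕ) (p : ℕ → Fin K → ℝ) (arm : ℕ → Fin K) (loss : ℕ → Fin K → ℝ)
    (U : Finset (Fin K)) (t : ℕ) : Fin K → ℝ :=
  barrierPoint U (cumulativeEstimate p arm loss t) (barrierWeight θ T p t)

variable {U : Finset (Fin K)}

/-- A telescoping potential argument: each round pays its stability bound, and the subsequent
increase of the weights only raises the potential. -/
theorem sum_sub_competitor_le (hU : U.Nonempty) (hθ : 0 ≤ θ)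
    (h : IsLogBarrierFTRL 162 θ 0 T p arm loss)
    (hloss : ∀ t < T, ∀ i, loss t i ∈ Set.Icc (0 : ℝ) 1) :
    ∑ t ∈ Finset.range T, ∑ i, (p t i - competitor θ T p arm loss U t i) *
        lossEstimate (p t) (arm t) (loss t) i ≤
      ∑ t ∈ Finset.range T, stabilityBound U (barrierWeight θ T p t) (p t) (arm t) +
        (barrierMin Finset.univ (cumulativeEstimate p arm loss T) (barrierWeight θ T p T) -
          barrierMin U (cumulativeEstimate p arm loss T) (barrierWeight θ T p T)) := by
  have main : ∀ n ≤ T, ∑ t ∈ Finset.range n, ∑ i, (p t i - competitor θ T p arm loss U t i) *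
        lossEstimate (p t) (arm t) (loss t) i ≤
      ∑ t ∈ Finset.range n, stabilityBound U (barrierWeight θ T p t) (p t) (arm t) +
        (barrierMin Finset.univ (cumulativeEstimate p arm loss n) (barrierWeight θ T p n) -
          barrierMin U (cumulativeEstimate p arm loss n) (barrierWeight θ T p n)) := by
    intro n
    induction n with
    | zero =>
      intro _
      have e : cumulativeEstimate p arm loss 0 = 0 := by
        funext i; simp [cumulativeEstimate]
      have := barrierMin_sub_nonneg hU (g := barrierWeight θ T p 0)
        (fun i => by linarith [barrierWeight_ge hθ 0 i (T := T) (p := p)])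
      simpa [e] using this
    | succ n ih =>
      intro hn
      have hnT : n < T := hn
      have ih := ih hnT.le
      rw [Finset.sum_range_succ, Finset.sum_range_succ, sum_mul_lossEstimate]
      have hpos := (h n hnT).1.1 (arm n)
      have hl := hloss n hnT (arm n)
      have hp := h.eq_barrierPoint hθ hnT
      have h1 := stability_sub_le_stabilityBound hU (g := barrierWeight θ T p n)
        (L := cumulativeEstimate p arm loss n) (j := arm n)
        (s := loss n (arm n) / p n (arm n))
        (fun i => by linarith [barrierWeight_ge hθ n i (T := T) (p := p)])
        (div_nonneg hl.1 hpos.le) (by rw [← hp, div_mul_cancel₀ _ hpos.ne']; exact hl.2)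
      rw [← hp, ← cumulativeEstimate_succ] at h1
      have h2 := barrierMin_sub_mono hU (Finset.subset_univ U)
        (g := barrierWeight θ T p n) (g' := barrierWeight θ T p (n + 1))
        (L := cumulativeEstimate p arm loss (n + 1))
        (fun i _ => by linarith [barrierWeight_ge hθ n i (T := T) (p := p)])
        (fun i _ => barrierWeight_le_succ hθ n i)
      unfold competitor at ih ⊢
      linarith
  exact main T le_rfl

theorem sum_div_sqrt_le {m : ℕ → ℝ} (n : ℕ) (h0 : ∀ t < n, 0 ≤ m t) (h1 : ∀ t < n, m t ≤ 1) :
    ∑ t ∈ Finset.range n, m t / √(1 + ∑ τ ∈ Finset.range t, m τ) ≤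
      3 * √(∑ t ∈ Finset.range n, m t) := by
  have main : ∀ k ≤ n, ∑ t ∈ Finset.range k, m t / √(1 + ∑ τ ∈ Finset.range t, m τ) ≤
      3 * √(1 + ∑ t ∈ Finset.range k, m t) - 3 := by
    intro k
    induction k with
    | zero => intro _; simp
    | succ k ih =>
      intro hk
      have ih := ih (by omega)
      have hm0 := h0 k hk
      have hm1 := h1 k hk
      rw [Finset.sum_range_succ, Finset.sum_range_succ (fun t => m t)]
      have hS : 0 ≤ ∑ t ∈ Finset.range k, m t :=
        Finset.sum_nonneg fun t ht => h0 t (by have := Finset.mem_range.1 ht; omega)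
      set S := ∑ t ∈ Finset.range k, m t
      have hx : 0 < √(1 + S) := Real.sqrt_pos.2 (by linarith)
      have hx2 := Real.sq_sqrt (show 0 ≤ 1 + S by linarith)
      have hy2 := Real.sq_sqrt (show 0 ≤ 1 + (S + m k) by linarith)
      have hy0 := Real.sqrt_nonneg (1 + (S + m k))
      have hxy : √(1 + S) ≤ √(1 + (S + m k)) := Real.sqrt_le_sqrt (by linarith)
      -- Since `m k ≤ 1`, the new root is at most twice the old, so the sum of the two roots is at
      -- most three times the old one.
      have hstep : m k / √(1 + S) ≤ 3 * (√(1 + (S + m k)) - √(1 + S)) := by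
        rw [div_le_iff₀ hx]
        have h4 : √(1 + (S + m k)) ≤ 2 * √(1 + S) := by
          refine Real.sqrt_le_iff.2 ⟨by positivity, ?_⟩
          rw [mul_pow, hx2]; linarith
        have h5 : m k = (√(1 + (S + m k)) - √(1 + S)) * (√(1 + (S + m k)) + √(1 + S)) := by
          nlinarith
        have h6 : (√(1 + (S + m k)) - √(1 + S)) * (√(1 + (S + m k)) + √(1 + S)) ≤
            (√(1 + (S + m k)) - √(1 + S)) * (3 * √(1 + S)) :=
          mul_le_mul_of_nonneg_left (by linarith) (by linarith)
        linarith
      linarith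
  have hS : 0 ≤ ∑ t ∈ Finset.range n, m t :=
    Finset.sum_nonneg fun t ht => h0 t (Finset.mem_range.1 ht)
  have h2 : √(1 + ∑ t ∈ Finset.range n, m t) ≤ 1 + √(∑ t ∈ Finset.range n, m t) := by
    refine Real.sqrt_le_iff.2 ⟨by positivity, ?_⟩
    have := Real.sq_sqrt hS
    nlinarith [Real.sqrt_nonneg (∑ t ∈ Finset.range n, m t)]
  linarith [main n le_rfl]

/-- Any `m` dominated by the plays may be used, since the learning rate then dominates θ√(1 + ∑ m).
This allows the sum to be controlled by `outsideShare` instead of all plays of an arm in `U`. -/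
theorem sum_div_barrierWeight_le (hθ : 0 < θ) {i : Fin K} {m : ℕ → ℝ}
    (h0 : ∀ t < T, 0 ≤ m t) (h1 : ∀ t < T, m t ≤ 1) (hmp : ∀ t < T, m t ≤ p t i) :
    ∑ t ∈ Finset.range T, m t / barrierWeight θ T p t i ≤
      1 / θ * (3 * √(∑ t ∈ Finset.range T, m t)) := by
  refine le_trans ?_ (mul_le_mul_of_nonneg_left (sum_div_sqrt_le T h0 h1) (by positivity))
  rw [Finset.mul_sum]
  refine Finset.sum_le_sum fun t ht => ?_
  have ht' := Finset.mem_range.1 ht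
  have hS : 0 ≤ ∑ τ ∈ Finset.range t, m τ :=
    Finset.sum_nonneg fun τ hτ => h0 τ (by have := Finset.mem_range.1 hτ; omega)
  have hle : ∑ τ ∈ Finset.range t, m τ ≤
      ∑ τ ∈ Finset.range t, max (p τ i) (1 / (T : ℝ)) :=
    Finset.sum_le_sum fun τ hτ =>
      (hmp τ (by have := Finset.mem_range.1 hτ; omega)).trans (le_max_left _ _)
  rw [one_div_mul_eq_div, div_div, mul_comm _ θ]
  have hpos : 0 < θ * √(1 + ∑ τ ∈ Finset.range t, m τ) :=
    mul_pos hθ (Real.sqrt_pos.2 (by linarith))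
  refine div_le_div_of_nonneg_left (h0 t ht') hpos ?_
  rw [barrierWeight_eq]
  have := mul_le_mul_of_nonneg_left (Real.sqrt_le_sqrt (show 1 + ∑ τ ∈ Finset.range t, m τ ≤
    1 + ∑ τ ∈ Finset.range t, max (p τ i) (1 / (T : ℝ)) by linarith)) hθ.le
  linarith

theorem sum_sqrt_le_sqrt_card_mul {ι : Type*} (U : Finset ι) {x : ι → ℝ} (hx : ∀ i ∈ U, 0 ≤ x i) :
    ∑ i ∈ U, √(x i) ≤ √((U.card : ℝ) * ∑ i ∈ U, x i) := by
  refine Real.le_sqrt_of_sq_le ?_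
  have h := sq_sum_le_card_mul_sum_sq (s := U) (f := fun i => √(x i))
  rwa [Finset.sum_congr rfl fun i hi => Real.sq_sqrt (hx i hi)] at h

/-- The number of plays outside `U`, weighed as in the regret bound. -/
def pathComplexity (T : ℕ) (p : ℕ → Fin K → ℝ) (U : Finset (Fin K)) : ℝ :=
  ∑ i ∈ Uᶜ, √(∑ t ∈ Finset.range T, p t i) +
    √((U.card : ℝ) * ∑ i ∈ Uᶜ, ∑ t ∈ Finset.range T, p t i)

/-- Inside `U` the roots of the accumulated shares are combined by Cauchy–Schwarz, and the shares
sum to at most the plays outside `U`. The constant is 17 * 3. -/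
theorem sum_sum_mul_stabilityBound_le (hU : U.Nonempty) (hθ : 0 < θ)
    (hp : ∀ t < T, p t ∈ openSimplex K) :
    ∑ t ∈ Finset.range T, ∑ j, p t j * stabilityBound U (barrierWeight θ T p t) (p t) j ≤
      51 * (1 / θ) * pathComplexity T p U := by
  have hpos : ∀ t < T, ∀ i, 0 < p t i := fun t ht => (hp t ht).1
  have hle1 : ∀ t < T, ∀ i, p t i ≤ 1 := fun t ht i => by
    rw [← (hp t ht).2]
    exact Finset.single_le_sum (f := p t) (fun i _ => (hpos t ht i).le) (Finset.mem_univ i)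
  have hg : ∀ t i, 1 ≤ barrierWeight θ T p t i := fun t i => by
    linarith [barrierWeight_ge hθ.le t i (T := T) (p := p)]
  set m : ℕ → Fin K → ℝ := fun t j => outsideShare U (barrierWeight θ T p t) (p t) j with hm
  have hm0 : ∀ t < T, ∀ j, 0 ≤ m t j := fun t ht j => outsideShare_nonneg (hg t) (hpos t ht) j
  have hstep : ∑ t ∈ Finset.range T,
      ∑ j, p t j * stabilityBound U (barrierWeight θ T p t) (p t) j ≤
      17 * ∑ i ∈ Uᶜ, ∑ t ∈ Finset.range T, p t i / barrierWeight θ T p t i +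
        16 * ∑ j ∈ U, ∑ t ∈ Finset.range T, m t j / barrierWeight θ T p t j := by
    rw [Finset.sum_comm (s := Uᶜ), Finset.sum_comm (s := U), Finset.mul_sum, Finset.mul_sum,
      ← Finset.sum_add_distrib]
    exact Finset.sum_le_sum fun t ht =>
      sum_mul_stabilityBound_le hU (hg t) (hpos t (Finset.mem_range.1 ht))
  have h1 : ∑ i ∈ Uᶜ, ∑ t ∈ Finset.range T, p t i / barrierWeight θ T p t i ≤
      1 / θ * (3 * ∑ i ∈ Uᶜ, √(∑ t ∈ Finset.range T, p t i)) := by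
    rw [Finset.mul_sum, Finset.mul_sum]
    exact Finset.sum_le_sum fun i _ => sum_div_barrierWeight_le hθ
      (fun t ht => (hpos t ht i).le) (fun t ht => hle1 t ht i) (fun t _ => le_rfl)
  have h2 : ∑ j ∈ U, ∑ t ∈ Finset.range T, m t j / barrierWeight θ T p t j ≤
      1 / θ * (3 * ∑ j ∈ U, √(∑ t ∈ Finset.range T, m t j)) := by
    rw [Finset.mul_sum, Finset.mul_sum]
    refine Finset.sum_le_sum fun j hj => ?_
    have hmp : ∀ t < T, m t j ≤ p t j := fun t ht => outsideShare_le (hg t) (hpos t ht) hj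
    exact sum_div_barrierWeight_le hθ (fun t ht => hm0 t ht j)
      (fun t ht => (hmp t ht).trans (hle1 t ht j)) hmp
  have h3 : ∑ j ∈ U, √(∑ t ∈ Finset.range T, m t j) ≤
      √((U.card : ℝ) * ∑ i ∈ Uᶜ, ∑ t ∈ Finset.range T, p t i) := by
    refine (sum_sqrt_le_sqrt_card_mul U fun j _ => Finset.sum_nonneg fun t ht =>
      hm0 t (Finset.mem_range.1 ht) j).trans ?_
    refine Real.sqrt_le_sqrt (mul_le_mul_of_nonneg_left ?_ (Nat.cast_nonneg _))
    rw [Finset.sum_comm (s := U), Finset.sum_comm (s := Uᶜ)]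
    exact Finset.sum_le_sum fun t ht =>
      sum_outsideShare_le (hg t) (hpos t (Finset.mem_range.1 ht))
  have hθ' : 0 ≤ 1 / θ := by positivity
  have h4 := mul_le_mul_of_nonneg_left h3 hθ'
  have h5 := mul_nonneg hθ'
    (Real.sqrt_nonneg ((U.card : ℝ) * ∑ i ∈ Uᶜ, ∑ t ∈ Finset.range T, p t i))
  unfold pathComplexity
  nlinarith

theorem half_lt_log {T : ℕ} (hT : 2 ≤ T) : 1 / 2 < Real.log T := by
  have h2 : (2 : ℝ) ≤ T := by exact_mod_cast hT
  have := Real.log_le_log two_pos h2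
  linarith [Real.log_two_gt_d9]

theorem one_div_sqrt_one_div_log {T : ℕ} : 1 / √(1 / Real.log T) = √(Real.log T) := by
  rw [Real.sqrt_div zero_le_one, Real.sqrt_one, one_div_one_div]

/-- The floor 1 / T adds at most 1 to the accumulated plays over T rounds, and the choice of θ turns
log T times θ into √(log T). -/
theorem barrierWeight_final_le (hT : 2 ≤ T) (hp : ∀ t < T, p t ∈ openSimplex K) (i : Fin K) :
    Real.log T * barrierWeight (√(1 / Real.log T)) T p T i ≤
      166 * Real.log T + √(Real.log T) * √(∑ t ∈ Finset.range T, p t i) := by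
  have hΛ := half_lt_log hT
  have hT0 : (0 : ℝ) < T := by
    have : 0 < T := by omega
    exact_mod_cast this
  have hP : 0 ≤ ∑ t ∈ Finset.range T, p t i :=
    Finset.sum_nonneg fun t ht => ((hp t (Finset.mem_range.1 ht)).1 i).le
  have hmax : ∑ t ∈ Finset.range T, max (p t i) (1 / (T : ℝ)) ≤
      ∑ t ∈ Finset.range T, p t i + 1 := by
    have e : ∑ t ∈ Finset.range T, (p t i + 1 / (T : ℝ)) = ∑ t ∈ Finset.range T, p t i + 1 := by
      rw [Finset.sum_add_distrib, Finset.sum_const, Finset.card_range, nsmul_eq_mul,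
        mul_one_div_cancel hT0.ne']
    rw [← e]
    refine Finset.sum_le_sum fun t ht => ?_
    have := (hp t (Finset.mem_range.1 ht)).1 i
    have : 0 < 1 / (T : ℝ) := by positivity
    exact max_le (by linarith) (by linarith)
  rw [barrierWeight_eq, mul_add, ← mul_assoc]
  have hsΛ : √(Real.log T) ^ 2 = Real.log T := Real.sq_sqrt (by linarith)
  have hs0 : 0 < √(Real.log T) := Real.sqrt_pos.2 (by linarith)
  have e1 : Real.log T * √(1 / Real.log T) = √(Real.log T) := by
    rw [Real.sqrt_div zero_le_one, Real.sqrt_one, mul_one_div, div_eq_iff hs0.ne', ← sq, hsΛ]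
  rw [e1]
  have h1 : √(1 + ∑ t ∈ Finset.range T, max (p t i) (1 / (T : ℝ))) ≤
      2 + √(∑ t ∈ Finset.range T, p t i) := by
    refine Real.sqrt_le_iff.2 ⟨by positivity, ?_⟩
    have := Real.sq_sqrt hP
    nlinarith [Real.sqrt_nonneg (∑ t ∈ Finset.range T, p t i)]
  have h2 : √(Real.log T) ≤ 2 * Real.log T := by
    refine Real.sqrt_le_iff.2 ⟨by linarith, ?_⟩
    nlinarith
  have := mul_le_mul_of_nonneg_left h1 hs0.le
  linarith

/-- The choice ε = 1 / (2 T²) keeps log (1 / ε) at most 3 log T, while the moved mass, at most 1 /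
(2 T), times the weights on `U` is O(K). The estimated losses remain, to be averaged later: their
expected total is at most K T. -/
theorem barrierMin_final_le (hU : U.Nonempty) (hK : K ≤ T) (hT : 2 ≤ T)
    (hp : ∀ t < T, p t ∈ openSimplex K) {L : Fin K → ℝ} (hL : ∀ i, 0 ≤ L i) :
    barrierMin Finset.univ L (barrierWeight (√(1 / Real.log T)) T p T) -
        barrierMin U L (barrierWeight (√(1 / Real.log T)) T p T) ≤
      1 / (2 * (T : ℝ) ^ 2) * ∑ i, L i + 3 * √(Real.log T) * pathComplexity T p U +
        1000 * (K * Real.log T) := by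
  have hΛ := half_lt_log hT
  have hT2 : (2 : ℝ) ≤ T := by exact_mod_cast hT
  have hKT : (K : ℝ) ≤ T := by exact_mod_cast hK
  have hK0 : (0 : ℝ) ≤ K := Nat.cast_nonneg K
  set θ := √(1 / Real.log T) with hθ
  have hθ0 : 0 ≤ θ := Real.sqrt_nonneg _
  have hθ2 : θ ≤ 2 := by
    refine Real.sqrt_le_iff.2 ⟨by norm_num, ?_⟩
    rw [div_le_iff₀ (by linarith)]; linarith
  have hg162 : ∀ i, 162 ≤ barrierWeight θ T p T i := fun i => barrierWeight_ge hθ0 T i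
  have hcardV : (Uᶜ.card : ℝ) ≤ K := by
    have := Finset.card_le_univ Uᶜ
    rw [Fintype.card_fin] at this
    exact_mod_cast this
  have hcardU : (U.card : ℝ) ≤ K := by
    have := Finset.card_le_univ U
    rw [Fintype.card_fin] at this
    exact_mod_cast this
  have hε : 0 < 1 / (2 * (T : ℝ) ^ 2) := by positivity
  have hεU : 1 / (2 * (T : ℝ) ^ 2) * (Uᶜ.card : ℝ) ≤ 1 / (2 * T) := by
    rw [one_div_mul_eq_div, div_le_div_iff₀ (by positivity) (by positivity)]
    nlinarith
  have hεU' : 1 / (2 * (T : ℝ)) ≤ 1 / 2 := by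
    rw [div_le_div_iff₀ (by positivity) (by positivity)]; linarith
  refine (barrierMin_sub_le hU (fun i => by linarith [hg162 i]) hL hε
    (hεU.trans hεU')).trans ?_
  rw [one_div_one_div]
  have hlog : Real.log (2 * (T : ℝ) ^ 2) ≤ 3 * Real.log T := by
    rw [Real.log_mul two_ne_zero (by positivity), Real.log_pow]
    have := Real.log_le_log two_pos hT2
    push_cast
    linarith
  have hg0 : 0 ≤ ∑ i ∈ Uᶜ, barrierWeight θ T p T i :=
    Finset.sum_nonneg fun i _ => by linarith [hg162 i]
  have hA : ∑ i ∈ Uᶜ, L i ≤ ∑ i, L i :=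
    Finset.sum_le_sum_of_subset_of_nonneg (Finset.subset_univ _) fun i _ _ => hL i
  have hB : Real.log T * ∑ i ∈ Uᶜ, barrierWeight θ T p T i ≤
      166 * (K * Real.log T) + √(Real.log T) * pathComplexity T p U := by
    rw [Finset.mul_sum]
    refine (Finset.sum_le_sum fun i _ => barrierWeight_final_le hT hp i).trans ?_
    rw [Finset.sum_add_distrib, Finset.sum_const, nsmul_eq_mul, ← Finset.mul_sum]
    unfold pathComplexity
    have h1 := mul_le_mul_of_nonneg_right hcardV (show 0 ≤ 166 * Real.log T by linarith)
    have h2 := mul_nonneg (Real.sqrt_nonneg (Real.log T))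
      (Real.sqrt_nonneg ((U.card : ℝ) * ∑ i ∈ Uᶜ, ∑ t ∈ Finset.range T, p t i))
    linarith
  have hC : ∀ i, barrierWeight θ T p T i ≤ 85 * T := by
    intro i
    have hP : ∑ t ∈ Finset.range T, max (p t i) (1 / (T : ℝ)) ≤ T := by
      calc _ ≤ ∑ t ∈ Finset.range T, (1 : ℝ) := by
            refine Finset.sum_le_sum fun t ht => max_le ?_ ?_
            · have h := hp t (Finset.mem_range.1 ht)
              rw [← h.2]
              exact Finset.single_le_sum (f := p t) (fun i _ => (h.1 i).le) (Finset.mem_univ i)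
            · rw [div_le_one (by linarith)]; linarith
        _ = T := by simp
    rw [barrierWeight_eq]
    have h1 : √(1 + ∑ t ∈ Finset.range T, max (p t i) (1 / (T : ℝ))) ≤ T := by
      refine Real.sqrt_le_iff.2 ⟨by linarith, ?_⟩
      nlinarith
    have := mul_le_mul hθ2 h1 (Real.sqrt_nonneg _) zero_le_two
    linarith
  have hD : 2 * (1 / (2 * (T : ℝ) ^ 2) * (Uᶜ.card : ℝ)) * ∑ i ∈ U, barrierWeight θ T p T i ≤
      85 * K := by
    have h1 : ∑ i ∈ U, barrierWeight θ T p T i ≤ K * (85 * T) := by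
      refine (Finset.sum_le_card_nsmul U _ _ fun i _ => hC i).trans ?_
      rw [nsmul_eq_mul]
      exact mul_le_mul_of_nonneg_right hcardU (by linarith)
    calc _ ≤ 2 * (1 / (2 * (T : ℝ))) * (K * (85 * T)) := by
          refine mul_le_mul (by linarith) h1 (Finset.sum_nonneg fun i _ => by
            linarith [hg162 i]) (by positivity)
      _ = 85 * K := by field_simp
  have h6 := mul_le_mul_of_nonneg_right hlog hg0
  have h7 := mul_le_mul_of_nonneg_left hA hε.le
  have h8 : (K : ℝ) ≤ 2 * (K * Real.log T) := by nlinarith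
  linarith

end Trajectory

/-! ### Measurability and boundedness of the plays. -/

section BoundedMeasurable

variable {Ω : Type*}

/-- Real functions that are measurable and bounded. -/
def BoundedMeasurable [MeasurableSpace Ω] (f : Ω → ℝ) : Prop :=
  Measurable f ∧ ∃ B, ∀ ω, |f ω| ≤ B

namespace BoundedMeasurable

theorem mono {m m' : MeasurableSpace Ω} (hm : m ≤ m') {f : Ω → ℝ}
    (hf : @BoundedMeasurable Ω m f) : @BoundedMeasurable Ω m' f :=
  ⟨hf.1.mono hm le_rfl, hf.2⟩

variable [MeasurableSpace Ω] {f g : Ω → ℝ}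

theorem const (c : ℝ) : BoundedMeasurable (fun _ : Ω => c) := ⟨measurable_const, |c|, fun _ => le_rfl⟩

theorem add (hf : BoundedMeasurable f) (hg : BoundedMeasurable g) :
    BoundedMeasurable (fun ω => f ω + g ω) := by
  obtain ⟨hf, B, hB⟩ := hf
  obtain ⟨hg, C, hC⟩ := hg
  exact ⟨hf.add hg, B + C, fun ω => (abs_add_le _ _).trans (add_le_add (hB ω) (hC ω))⟩

theorem sub (hf : BoundedMeasurable f) (hg : BoundedMeasurable g) :
    BoundedMeasurable (fun ω => f ω - g ω) := by
  obtain ⟨hf, B, hB⟩ := hf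
  obtain ⟨hg, C, hC⟩ := hg
  exact ⟨hf.sub hg, B + C, fun ω => (abs_sub _ _).trans (add_le_add (hB ω) (hC ω))⟩

theorem mul (hf : BoundedMeasurable f) (hg : BoundedMeasurable g) :
    BoundedMeasurable (fun ω => f ω * g ω) := by
  obtain ⟨hf, B, hB⟩ := hf
  obtain ⟨hg, C, hC⟩ := hg
  refine ⟨hf.mul hg, B * C, fun ω => ?_⟩
  rw [abs_mul]
  exact mul_le_mul (hB ω) (hC ω) (abs_nonneg _) ((abs_nonneg _).trans (hB ω))

theorem sum {ι : Type*} (s : Finset ι) {F : ι → Ω → ℝ} (h : ∀ i ∈ s, BoundedMeasurable (F i)) :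
    BoundedMeasurable (fun ω => ∑ i ∈ s, F i ω) := by
  classical
  induction s using Finset.induction_on with
  | empty => simpa using const 0
  | insert a s ha ih =>
    simp only [Finset.sum_insert ha]
    exact (h a (Finset.mem_insert_self a s)).add
      (ih fun i hi => h i (Finset.mem_insert_of_mem hi))

theorem of_mem_Icc (hf : Measurable f) {a b : ℝ} (h : ∀ ω, f ω ∈ Set.Icc a b) :
    BoundedMeasurable f :=
  ⟨hf, max |a| |b|, fun ω => abs_le_max_abs_abs (h ω).1 (h ω).2⟩

theorem sqrt (hf : BoundedMeasurable f) : BoundedMeasurable (fun ω => √(f ω)) := by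
  obtain ⟨hf, B, hB⟩ := hf
  refine ⟨hf.sqrt, √B, fun ω => ?_⟩
  rw [abs_of_nonneg (Real.sqrt_nonneg _)]
  exact Real.sqrt_le_sqrt ((le_abs_self _).trans (hB ω))

theorem apply_arm {K : ℕ} {F : Ω → Fin K → ℝ} (hF : ∀ i, BoundedMeasurable fun ω => F ω i)
    {a : Ω → Fin K} (ha : Measurable a) : BoundedMeasurable (fun ω => F ω (a ω)) := by
  have e : (fun ω => F ω (a ω)) = fun ω => ∑ i, if a ω = i then F ω i else 0 := by
    funext ω
    rw [Finset.sum_ite_eq, if_pos (Finset.mem_univ _)]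
  rw [e]
  refine sum _ fun i _ => ?_
  obtain ⟨hm, B, hB⟩ := hF i
  refine ⟨Measurable.ite (ha (measurableSet_singleton i)) hm measurable_const, |B|, fun ω => ?_⟩
  by_cases h : a ω = i
  · simp only [if_pos h]
    exact (hB ω).trans (le_abs_self B)
  · simp only [if_neg h, abs_zero]
    exact abs_nonneg B

theorem integrable {μ : Measure Ω} [IsFiniteMeasure μ] (hf : BoundedMeasurable f) :
    Integrable f μ := by
  obtain ⟨hf, B, hB⟩ := hf
  exact Integrable.of_bound hf.aestronglyMeasurable B (Filter.Eventually.of_forall hB)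

end BoundedMeasurable

end BoundedMeasurable

section MeasurableBarrier

variable {Ω : Type*} [MeasurableSpace Ω] {ι : Type*} {S : Finset ι} {L g : Ω → ι → ℝ}

theorem measurable_multiplier (hS : S.Nonempty) (hL : ∀ i, Measurable fun ω => L ω i)
    (hg : ∀ i, Measurable fun ω => g ω i) (hg0 : ∀ ω, ∀ i ∈ S, 0 < g ω i) :
    Measurable fun ω => multiplier S (L ω) (g ω) := by
  refine measurable_of_Iio fun c => ?_
  have e : (fun ω => multiplier S (L ω) (g ω)) ⁻¹' Set.Iio c =
      (⋂ i ∈ S, {ω | 0 < L ω i + c}) ∩ {ω | ∑ i ∈ S, g ω i / (L ω i + c) < 1} := by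
    ext ω
    simp only [Set.mem_preimage, Set.mem_Iio, multiplier_lt_iff hS (hg0 ω), Set.mem_inter_iff,
      Set.mem_iInter, Set.mem_ofPred_eq]
  rw [e]
  refine (Finset.measurableSet_biInter S fun i _ => ?_).inter ?_
  · exact measurableSet_lt measurable_const ((hL i).add_const c)
  · exact measurableSet_lt (Finset.measurable_fun_sum S fun i _ =>
      (hg i).div ((hL i).add_const c)) measurable_const

theorem measurable_barrierPoint (hS : S.Nonempty) (hL : ∀ i, Measurable fun ω => L ω i)
    (hg : ∀ i, Measurable fun ω => g ω i) (hg0 : ∀ ω, ∀ i ∈ S, 0 < g ω i) (i : ι) :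
    Measurable fun ω => barrierPoint S (L ω) (g ω) i := by
  by_cases hi : i ∈ S
  · simp only [barrierPoint_of_mem hi]
    exact (hg i).div ((hL i).add (measurable_multiplier hS hL hg hg0))
  · simp only [barrierPoint_of_notMem hi]
    exact measurable_const

end MeasurableBarrier

theorem multiplier_le_sum {ι : Type*} {S : Finset ι} {L g : ι → ℝ} (hS : S.Nonempty)
    (hg : ∀ i ∈ S, 0 < g i) (hL : ∀ i ∈ S, 0 ≤ L i) : multiplier S L g ≤ ∑ i ∈ S, g i := by
  have hG : 0 < ∑ i ∈ S, g i := Finset.sum_pos hg hS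
  obtain ⟨hp, hs⟩ := multiplier_spec hS hg (L := L)
  by_contra! hlt
  have : ∑ i ∈ S, g i / (L i + multiplier S L g) < ∑ i ∈ S, g i / ∑ i ∈ S, g i :=
    Finset.sum_lt_sum_of_nonempty hS fun i hi =>
      div_lt_div_of_pos_left (hg i hi) hG (by linarith [hL i hi])
  rw [← Finset.sum_div, div_self hG.ne', hs] at this
  exact lt_irrefl _ this

theorem history_le {Ω : Type*} [m : MeasurableSpace Ω] {K T : ℕ} {loss : ℕ → Ω → Fin K → ℝ}
    {arm : ℕ → Ω → Fin K} (hl : ∀ t < T, Measurable (loss t)) (ha : ∀ t < T, Measurable (arm t))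
    {t : ℕ} (ht : t ≤ T) : history loss arm t ≤ m := by
  refine iSup₂_le fun s hs => sup_le ?_ ?_
  · exact (hl s (by omega)).comap_le
  · exact (ha s (by omega)).comap_le

theorem history_mono {Ω : Type*} {K : ℕ} {loss : ℕ → Ω → Fin K → ℝ}
    {arm : ℕ → Ω → Fin K} {s t : ℕ} (h : s ≤ t) : history loss arm s ≤ history loss arm t :=
  iSup₂_le fun r hr => le_iSup₂_of_le r (hr.trans_le h) le_rfl

theorem measurable_loss_history {Ω : Type*} {K : ℕ} {loss : ℕ → Ω → Fin K → ℝ}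
    {arm : ℕ → Ω → Fin K} {s t : ℕ} (h : s < t) : Measurable[history loss arm t] (loss s) :=
  measurable_iff_comap_le.2 (le_iSup₂_of_le s h le_sup_left)

theorem measurable_arm_history {Ω : Type*} {K : ℕ} {loss : ℕ → Ω → Fin K → ℝ}
    {arm : ℕ → Ω → Fin K} {s t : ℕ} (h : s < t) : Measurable[history loss arm t] (arm s) :=
  measurable_iff_comap_le.2 (le_iSup₂_of_le s h le_sup_right)

section Measurability

variable {Ω : Type*} {K T : ℕ} {θ : ℝ} {loss : ℕ → Ω → Fin K → ℝ} {arm : ℕ → Ω → Fin K}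
  {p : ℕ → Ω → Fin K → ℝ} {U : Finset (Fin K)}

theorem measurable_cumulativeEstimate [MeasurableSpace Ω] {t : ℕ}
    (hl : ∀ s < t, Measurable (loss s)) (ha : ∀ s < t, Measurable (arm s))
    (hp : ∀ s < t, ∀ i, Measurable fun ω => p s ω i) (i : Fin K) :
    Measurable fun ω => cumulativeEstimate (fun s => p s ω) (fun s => arm s ω)
      (fun s => loss s ω) t i := by
  unfold cumulativeEstimate lossEstimate
  refine Finset.measurable_fun_sum _ fun s hs => ?_
  have hs := Finset.mem_range.1 hs
  refine Measurable.div (Measurable.ite ?_ ?_ measurable_const) (hp s hs i)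
  · exact (ha s hs) (measurableSet_singleton i)
  · exact (measurable_pi_apply i).comp (hl s hs)

theorem measurable_barrierWeight [MeasurableSpace Ω] {t : ℕ}
    (hp : ∀ s < t, ∀ i, Measurable fun ω => p s ω i) (i : Fin K) :
    Measurable fun ω => barrierWeight θ T (fun s => p s ω) t i := by
  simp only [barrierWeight_eq]
  have : Measurable fun ω => ∑ τ ∈ Finset.range t, max (p τ ω i) (1 / (T : ℝ)) :=
    Finset.measurable_fun_sum _ fun s hs =>
      (hp s (Finset.mem_range.1 hs) i).max measurable_const
  exact ((this.const_add 1).sqrt.const_mul θ).const_add 162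

/-- Induction over rounds: earlier plays determine the estimates and weights, and the minimizer is a
measurable function of these. -/
theorem measurable_history_play [NeZero K] (hθ : 0 ≤ θ)
    (hF : ∀ ω, IsLogBarrierFTRL 162 θ 0 T (fun t => p t ω) (fun t => arm t ω)
      (fun t => loss t ω)) {t : ℕ} (ht : t < T) (i : Fin K) :
    Measurable[history loss arm t] fun ω => p t ω i := by
  induction t using Nat.strong_induction_on generalizing i with
  | _ t ih =>
    have hp : ∀ s < t, ∀ i, Measurable[history loss arm t] fun ω => p s ω i :=
      fun s hs i => (ih s hs (by omega) i).mono (history_mono hs.le) le_rfl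
    have e : (fun ω => p t ω i) = fun ω => barrierPoint Finset.univ
        (cumulativeEstimate (fun s => p s ω) (fun s => arm s ω) (fun s => loss s ω) t)
        (barrierWeight θ T (fun s => p s ω) t) i := by
      funext ω
      exact congrFun ((hF ω).eq_barrierPoint hθ ht) i
    rw [e]
    let _ := history loss arm t
    exact measurable_barrierPoint Finset.univ_nonempty
      (measurable_cumulativeEstimate (fun s hs => measurable_loss_history hs)
        (fun s hs => measurable_arm_history hs) hp)
      (measurable_barrierWeight hp)
      (fun ω i _ => by linarith [barrierWeight_ge hθ t i (T := T) (p := fun s => p s ω)]) i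

theorem measurable_history_competitor [NeZero K] (hU : U.Nonempty) (hθ : 0 ≤ θ)
    (hF : ∀ ω, IsLogBarrierFTRL 162 θ 0 T (fun t => p t ω) (fun t => arm t ω)
      (fun t => loss t ω)) {t : ℕ} (ht : t < T) (i : Fin K) :
    Measurable[history loss arm t] fun ω => competitor θ T (fun s => p s ω) (fun s => arm s ω)
      (fun s => loss s ω) U t i := by
  have hp : ∀ s < t, ∀ i, Measurable[history loss arm t] fun ω => p s ω i :=
    fun s hs i => (measurable_history_play hθ hF (by omega) i).mono (history_mono hs.le) le_rfl
  let _ := history loss arm t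
  exact measurable_barrierPoint hU
    (measurable_cumulativeEstimate (fun s hs => measurable_loss_history hs)
      (fun s hs => measurable_arm_history hs) hp)
    (measurable_barrierWeight hp)
    (fun ω i _ => by linarith [barrierWeight_ge hθ t i (T := T) (p := fun s => p s ω)]) i

-- A lower bound on earlier plays bounds the estimates, hence the denominator `L i + ν` of the
-- closed form, while the numerator is at least 162. The bound is uniform in ω, so the
-- importance-weighted losses are bounded and integrable.
theorem exists_play_lower_bound (hθ : 0 ≤ θ)
    (hF : ∀ ω, IsLogBarrierFTRL 162 θ 0 T (fun t => p t ω) (fun t => arm t ω)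
      (fun t => loss t ω))
    (hloss : ∀ t < T, ∀ ω i, loss t ω i ∈ Set.Icc (0 : ℝ) 1) {t : ℕ} (ht : t < T) :
    ∃ ε > 0, ∀ ω i, ε ≤ p t ω i := by
  induction t using Nat.strong_induction_on with
  | _ t ih =>
    have hT : (1 : ℝ) ≤ T := by
      have : 1 ≤ T := by omega
      exact_mod_cast this
    choose! ε hε0 hε using fun s (hs : s < t) => ih s hs (by omega)
    set B := ∑ s ∈ Finset.range t, 1 / ε s
    set G := 162 + θ * √(1 + t)
    have hB : 0 ≤ B := Finset.sum_nonneg fun s hs =>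
      (one_div_pos.2 (hε0 s (Finset.mem_range.1 hs))).le
    have hG : 0 < G := by positivity
    refine ⟨162 / (B + (1 + K) * G), by positivity, fun ω i => ?_⟩
    rw [show p t ω = _ from (hF ω).eq_barrierPoint hθ ht, barrierPoint_of_mem (Finset.mem_univ i)]
    have hg : ∀ i, 162 ≤ barrierWeight θ T (fun s => p s ω) t i := fun i => barrierWeight_ge hθ t i
    have hg0 : ∀ i ∈ Finset.univ, 0 < barrierWeight θ T (fun s => p s ω) t i :=
      fun i _ => by linarith [hg i]
    have hS : (Finset.univ : Finset (Fin K)).Nonempty := ⟨i, Finset.mem_univ i⟩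
    have hpos : ∀ s < t, ∀ i, 0 < p s ω i := fun s hs => (hF ω s (by omega)).1.1
    have hle1 : ∀ s < t, ∀ i, p s ω i ≤ 1 := fun s hs i => by
      rw [← (hF ω s (by omega)).1.2]
      exact Finset.single_le_sum (f := p s ω) (fun i _ => (hpos s hs i).le) (Finset.mem_univ i)
    have hgG : ∀ i, barrierWeight θ T (fun s => p s ω) t i ≤ G := by
      intro i
      rw [barrierWeight_eq]
      have : ∑ τ ∈ Finset.range t, max (p τ ω i) (1 / (T : ℝ)) ≤ t := by
        calc _ ≤ ∑ τ ∈ Finset.range t, (1 : ℝ) := by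
              refine Finset.sum_le_sum fun s hs => max_le (hle1 s (Finset.mem_range.1 hs) i) ?_
              rw [div_le_one (by linarith)]; exact hT
          _ = t := by simp
      have := mul_le_mul_of_nonneg_left (Real.sqrt_le_sqrt (add_le_add_right this 1)) hθ
      linarith
    have hest : ∀ s < t, ∀ i, 0 ≤ lossEstimate (p s ω) (arm s ω) (loss s ω) i ∧
        lossEstimate (p s ω) (arm s ω) (loss s ω) i ≤ 1 / ε s := by
      intro s hs i
      have hl := hloss s (by omega) ω i
      have hp := hpos s hs i
      unfold lossEstimate
      constructor
      · exact div_nonneg (by split_ifs <;> [exact hl.1; exact le_rfl]) hp.le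
      · exact div_le_div₀ zero_le_one (by split_ifs <;> [exact hl.2; exact zero_le_one])
          (hε0 s hs) (hε s hs ω i)
    have hL0 : ∀ i, 0 ≤ cumulativeEstimate (fun s => p s ω) (fun s => arm s ω)
        (fun s => loss s ω) t i :=
      fun i => Finset.sum_nonneg fun s hs => (hest s (Finset.mem_range.1 hs) i).1
    have hLB : cumulativeEstimate (fun s => p s ω) (fun s => arm s ω)
        (fun s => loss s ω) t i ≤ B :=
      Finset.sum_le_sum fun s hs => (hest s (Finset.mem_range.1 hs) i).2
    have hν := multiplier_le_sum hS hg0 fun i _ => hL0 i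
    have hsum : ∑ i, barrierWeight θ T (fun s => p s ω) t i ≤ K * G := by
      refine (Finset.sum_le_card_nsmul _ _ G fun i _ => hgG i).trans ?_
      rw [nsmul_eq_mul, Finset.card_univ, Fintype.card_fin]
    refine div_le_div₀ (hg0 i (Finset.mem_univ i)).le (hg i)
      ((multiplier_spec hS hg0).1 i (Finset.mem_univ i)) ?_
    linarith

end Measurability

/-! ### Averaging over the drawn arm. -/

section Expectation

/-- The expectation of a quantity indexed by a random arm that is drawn independently of it. -/
theorem integral_apply_eq_of_condExp_indicator {Ω : Type*} {m : MeasurableSpace Ω}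
    [mΩ : MeasurableSpace Ω] {μ : Measure Ω} [IsProbabilityMeasure μ] {K : ℕ} (hm : m ≤ mΩ)
    {a : Ω → Fin K} (ha : Measurable a) {q : Ω → Fin K → ℝ}
    (hq : ∀ i, μ[Set.indicator {ω | a ω = i} (fun _ => (1 : ℝ)) | m] =ᵐ[μ] fun ω => q ω i)
    {f : Ω → Fin K → ℝ} (hf : ∀ i, @BoundedMeasurable Ω m fun ω => f ω i) :
    ∫ ω, f ω (a ω) ∂μ = ∫ ω, ∑ i, q ω i * f ω i ∂μ := by
  have hind : ∀ i, Integrable (Set.indicator {ω | a ω = i} fun _ => (1 : ℝ)) μ :=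
    fun i => (integrable_const 1).indicator (ha (measurableSet_singleton i))
  have hce : ∀ i, μ[(fun ω => f ω i) * Set.indicator {ω | a ω = i} (fun _ => (1 : ℝ)) | m]
      =ᵐ[μ] fun ω => q ω i * f ω i := by
    intro i
    obtain ⟨hmeas, B, hB⟩ := hf i
    refine (condExp_stronglyMeasurable_mul_of_bound hm hmeas.stronglyMeasurable (hind i) B
      (Filter.Eventually.of_forall hB)).trans ?_
    filter_upwards [hq i] with ω hω
    rw [Pi.mul_apply, hω, mul_comm]
  have hint : ∀ i, Integrable ((fun ω => f ω i) *
      Set.indicator {ω | a ω = i} (fun _ => (1 : ℝ))) μ := by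
    intro i
    obtain ⟨hmeas, B, hB⟩ := hf i
    exact (hind i).bdd_mul (hmeas.mono hm le_rfl).aestronglyMeasurable
      (Filter.Eventually.of_forall hB)
  have hsplit : ∀ ω, f ω (a ω) = ∑ i, ((fun ω => f ω i) *
      Set.indicator {ω | a ω = i} (fun _ => (1 : ℝ))) ω := by
    intro ω
    rw [Finset.sum_eq_single (a ω)]
    · simp
    · intro i _ hi
      simp [Set.indicator, hi.symm]
    · intro h; exact absurd (Finset.mem_univ _) h
  calc ∫ ω, f ω (a ω) ∂μ
      = ∫ ω, ∑ i, ((fun ω => f ω i) *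
        Set.indicator {ω | a ω = i} (fun _ => (1 : ℝ))) ω ∂μ := by
        simp only [hsplit]
    _ = ∑ i, ∫ ω, ((fun ω => f ω i) *
        Set.indicator {ω | a ω = i} (fun _ => (1 : ℝ))) ω ∂μ :=
        integral_finsetSum _ fun i _ => hint i
    _ = ∑ i, ∫ ω, q ω i * f ω i ∂μ := by
        refine Finset.sum_congr rfl fun i _ => ?_
        rw [← integral_congr_ae (hce i), integral_condExp hm]
    _ = ∫ ω, ∑ i, q ω i * f ω i ∂μ := by
        refine (integral_finsetSum _ fun i _ => ?_).symm
        exact integrable_condExp.congr (hce i)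

variable {Ω : Type*} [mΩ : MeasurableSpace Ω] {μ : Measure Ω} [IsProbabilityMeasure μ]
  {K T : ℕ} {loss : ℕ → Ω → Fin K → ℝ} {arm : ℕ → Ω → Fin K} {p : ℕ → Ω → Fin K → ℝ}

omit [IsProbabilityMeasure μ] in
theorem IsInteraction.history_sup_le (hI : IsInteraction μ T loss arm p) {t : ℕ} (ht : t < T) :
    history loss arm t ⊔ MeasurableSpace.comap (loss t) inferInstance ≤ mΩ :=
  sup_le (history_le hI.measurable_loss hI.measurable_arm ht.le)
    (hI.measurable_loss t ht).comap_le

/-- Averaging over the arm of round `t`. -/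
theorem IsInteraction.integral_arm (hI : IsInteraction μ T loss arm p) {t : ℕ} (ht : t < T)
    {f : Ω → Fin K → ℝ}
    (hf : ∀ i, @BoundedMeasurable Ω
      (history loss arm t ⊔ MeasurableSpace.comap (loss t) inferInstance) fun ω => f ω i) :
    ∫ ω, f ω (arm t ω) ∂μ = ∫ ω, ∑ i, p t ω i * f ω i ∂μ :=
  integral_apply_eq_of_condExp_indicator (hI.history_sup_le ht) (hI.measurable_arm t ht)
    (hI.arm_law t ht) hf

end Expectation

theorem measurable_stabilityBound {Ω : Type*} [MeasurableSpace Ω] {ι : Type*} [Fintype ι]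
    [DecidableEq ι] {U : Finset ι} {g p : Ω → ι → ℝ} (hg : ∀ i, Measurable fun ω => g ω i)
    (hp : ∀ i, Measurable fun ω => p ω i) (j : ι) :
    Measurable fun ω => stabilityBound U (g ω) (p ω) j := by
  have hb : ∀ i, Measurable fun ω => p ω i ^ 2 / g ω i :=
    fun i => ((hp i).pow_const 2).div (hg i)
  have hs : ∀ R : Finset ι, Measurable fun ω => ∑ i ∈ R, p ω i ^ 2 / g ω i :=
    fun R => Finset.measurable_fun_sum R fun i _ => hb i
  unfold stabilityBound
  by_cases hj : j ∈ U
  · simp only [if_pos hj]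
    exact (((measurable_const.div (hg j)).const_mul 16).mul ((hb j).div (hs U))).mul
      ((hs Uᶜ).div ((hs U).add (hs Uᶜ)))
  · simp only [if_neg hj]
    exact measurable_const.div (hg j)

theorem sum_competitor {K T : ℕ} {θ : ℝ} {p : ℕ → Fin K → ℝ} {arm : ℕ → Fin K}
    {loss : ℕ → Fin K → ℝ} {U : Finset (Fin K)} (hU : U.Nonempty) (hθ : 0 ≤ θ) (t : ℕ) :
    ∑ i, competitor θ T p arm loss U t i = 1 := by
  have hg : ∀ i ∈ U, 0 < barrierWeight θ T p t i := fun i _ => by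
    linarith [barrierWeight_ge hθ t i (T := T) (p := p)]
  rw [← sum_barrierPoint hU hg (L := cumulativeEstimate p arm loss t)]
  refine (Finset.sum_subset (Finset.subset_univ U) fun i _ hi => ?_).symm
  exact barrierPoint_of_notMem hi

theorem competitor_mem_Icc {K T : ℕ} {θ : ℝ} {p : ℕ → Fin K → ℝ} {arm : ℕ → Fin K}
    {loss : ℕ → Fin K → ℝ} {U : Finset (Fin K)} (hU : U.Nonempty) (hθ : 0 ≤ θ) (t : ℕ)
    (i : Fin K) : competitor θ T p arm loss U t i ∈ Set.Icc (0 : ℝ) 1 := by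
  have hg : ∀ i ∈ U, 0 < barrierWeight θ T p t i := fun i _ => by
    linarith [barrierWeight_ge hθ t i (T := T) (p := p)]
  exact ⟨barrierPoint_nonneg hU hg i, barrierPoint_le_one hU hg i⟩

theorem play_le_one {K T : ℕ} {p : ℕ → Fin K → ℝ} (hp : ∀ t < T, p t ∈ openSimplex K) {t : ℕ}
    (ht : t < T) (i : Fin K) : p t i ≤ 1 := by
  rw [← (hp t ht).2]
  exact Finset.single_le_sum (f := p t) (fun i _ => ((hp t ht).1 i).le) (Finset.mem_univ i)

/-! ### Regret against the shadow learner. -/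

section Regret

variable {Ω : Type*} [mΩ : MeasurableSpace Ω] {μ : Measure Ω} [IsProbabilityMeasure μ]
  {K T : ℕ} {loss : ℕ → Ω → Fin K → ℝ} {arm : ℕ → Ω → Fin K} {p : ℕ → Ω → Fin K → ℝ}
  {θ : ℝ} {U : Finset (Fin K)}

omit mΩ in
theorem boundedMeasurable_play [NeZero K] (hθ : 0 ≤ θ)
    (hF : ∀ ω, IsLogBarrierFTRL 162 θ 0 T (fun t => p t ω) (fun t => arm t ω)
      (fun t => loss t ω)) {t : ℕ} (ht : t < T) (i : Fin K) :
    @BoundedMeasurable Ω (history loss arm t) fun ω => p t ω i := by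
  let _ := history loss arm t
  exact BoundedMeasurable.of_mem_Icc (measurable_history_play hθ hF ht i) fun ω =>
    ⟨((hF ω t ht).1.1 i).le, play_le_one (fun t ht => (hF ω t ht).1) ht i⟩

omit mΩ in
theorem boundedMeasurable_inv_play [NeZero K] (hθ : 0 ≤ θ)
    (hF : ∀ ω, IsLogBarrierFTRL 162 θ 0 T (fun t => p t ω) (fun t => arm t ω)
      (fun t => loss t ω))
    (hloss : ∀ t < T, ∀ ω i, loss t ω i ∈ Set.Icc (0 : ℝ) 1) {t : ℕ} (ht : t < T) (i : Fin K) :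
    @BoundedMeasurable Ω (history loss arm t) fun ω => (p t ω i)⁻¹ := by
  obtain ⟨ε, hε0, hε⟩ := exists_play_lower_bound hθ hF hloss ht
  let _ := history loss arm t
  exact BoundedMeasurable.of_mem_Icc (measurable_history_play hθ hF ht i).inv fun ω =>
    ⟨inv_nonneg.2 ((hF ω t ht).1.1 i).le, inv_anti₀ hε0 (hε ω i)⟩

omit mΩ in
theorem boundedMeasurable_competitor [NeZero K] (hU : U.Nonempty) (hθ : 0 ≤ θ)
    (hF : ∀ ω, IsLogBarrierFTRL 162 θ 0 T (fun t => p t ω) (fun t => arm t ω)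
      (fun t => loss t ω)) {t : ℕ} (ht : t < T) (i : Fin K) :
    @BoundedMeasurable Ω (history loss arm t) fun ω => competitor θ T (fun s => p s ω)
      (fun s => arm s ω) (fun s => loss s ω) U t i := by
  let _ := history loss arm t
  exact BoundedMeasurable.of_mem_Icc (measurable_history_competitor hU hθ hF ht i) fun ω =>
    competitor_mem_Icc hU hθ t i

omit mΩ in
theorem boundedMeasurable_stabilityBound [NeZero K] (hθ : 0 ≤ θ)
    (hF : ∀ ω, IsLogBarrierFTRL 162 θ 0 T (fun t => p t ω) (fun t => arm t ω)
      (fun t => loss t ω)) {t : ℕ} (ht : t < T) (i : Fin K) :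
    @BoundedMeasurable Ω (history loss arm t) fun ω =>
      stabilityBound U (barrierWeight θ T (fun s => p s ω) t) (p t ω) i := by
  have hp : ∀ s < t, ∀ i, Measurable[history loss arm t] fun ω => p s ω i :=
    fun s hs i => (measurable_history_play hθ hF (by omega) i).mono (history_mono hs.le) le_rfl
  have hg : ∀ ω i, 1 ≤ barrierWeight θ T (fun s => p s ω) t i := fun ω i => by
    linarith [barrierWeight_ge hθ t i (T := T) (p := fun s => p s ω)]
  let _ := history loss arm t
  exact BoundedMeasurable.of_mem_Icc (measurable_stabilityBound (measurable_barrierWeight hp)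
    (measurable_history_play hθ hF ht) i) fun ω =>
      ⟨stabilityBound_nonneg (hg ω) i, stabilityBound_le (hg ω) i⟩

omit [IsProbabilityMeasure μ] in
theorem IsInteraction.boundedMeasurable_loss (hI : IsInteraction μ T loss arm p) {t : ℕ}
    (ht : t < T) (i : Fin K) : @BoundedMeasurable Ω
      (history loss arm t ⊔ MeasurableSpace.comap (loss t) inferInstance)
      fun ω => loss t ω i := by
  have h : Measurable[history loss arm t ⊔ MeasurableSpace.comap (loss t) inferInstance]
    (loss t) := measurable_iff_comap_le.2 le_sup_right
  have hmem := hI.loss_mem t ht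
  let _ := history loss arm t ⊔ MeasurableSpace.comap (loss t) inferInstance
  exact BoundedMeasurable.of_mem_Icc ((measurable_pi_apply i).comp h) fun ω =>
    hmem ω i

omit [IsProbabilityMeasure μ] in
theorem IsInteraction.boundedMeasurable_pathComplexity [NeZero K]
    (hI : IsInteraction μ T loss arm p) (hθ : 0 ≤ θ)
    (hF : ∀ ω, IsLogBarrierFTRL 162 θ 0 T (fun t => p t ω) (fun t => arm t ω)
      (fun t => loss t ω)) :
    BoundedMeasurable fun ω => pathComplexity T (fun t => p t ω) U := by
  have hP : ∀ i, BoundedMeasurable fun ω => ∑ t ∈ Finset.range T, p t ω i := fun i =>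
    BoundedMeasurable.sum _ fun t ht => (boundedMeasurable_play hθ hF
      (Finset.mem_range.1 ht) i).mono (history_le hI.measurable_loss hI.measurable_arm
        (Finset.mem_range.1 ht).le)
  exact (BoundedMeasurable.sum _ fun i _ => (hP i).sqrt).add
    ((BoundedMeasurable.const _).mul (BoundedMeasurable.sum _ fun i _ => hP i)).sqrt

/-- Everything depending on the drawn arm is collected on the left as one function evaluated at that
arm, so that its expectation can be taken by conditioning round by round. -/
theorem pathwise_bound (hU : U.Nonempty) (hK : K ≤ T) (hT : 2 ≤ T) {p : ℕ → Fin K → ℝ}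
    {arm : ℕ → Fin K} {loss : ℕ → Fin K → ℝ} (hθ : θ = √(1 / Real.log T))
    (hF : IsLogBarrierFTRL 162 θ 0 T p arm loss)
    (hloss : ∀ t < T, ∀ i, loss t i ∈ Set.Icc (0 : ℝ) 1) :
    ∑ t ∈ Finset.range T, ((p t (arm t) - competitor θ T p arm loss U t (arm t)) *
        loss t (arm t) * (p t (arm t))⁻¹ -
          stabilityBound U (barrierWeight θ T p t) (p t) (arm t) -
          1 / (2 * (T : ℝ) ^ 2) * (loss t (arm t) * (p t (arm t))⁻¹)) ≤
      3 * √(Real.log T) * pathComplexity T p U + 1000 * (K * Real.log T) := by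
  have hθ0 : 0 ≤ θ := hθ ▸ Real.sqrt_nonneg _
  have hp : ∀ t < T, p t ∈ openSimplex K := fun t ht => (hF t ht).1
  have h1 := sum_sub_competitor_le hU hθ0 hF hloss
  have hL : ∀ i, 0 ≤ cumulativeEstimate p arm loss T i := fun i =>
    Finset.sum_nonneg fun t ht => by
      have ht := Finset.mem_range.1 ht
      unfold lossEstimate
      exact div_nonneg (by split_ifs <;> [exact (hloss t ht i).1; exact le_rfl])
        ((hp t ht).1 i).le
  have h2 := barrierMin_final_le hU hK hT hp hL
  have h3 : ∑ i, cumulativeEstimate p arm loss T i =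
      ∑ t ∈ Finset.range T, loss t (arm t) * (p t (arm t))⁻¹ := by
    unfold cumulativeEstimate
    rw [Finset.sum_comm]
    refine Finset.sum_congr rfl fun t _ => ?_
    have := sum_mul_lossEstimate (p t) (loss t) (arm t) 1
    simpa [div_eq_mul_inv] using this
  rw [h3, ← hθ] at h2
  have h4 : ∀ t, ∑ i, (p t i - competitor θ T p arm loss U t i) *
      lossEstimate (p t) (arm t) (loss t) i =
      (p t (arm t) - competitor θ T p arm loss U t (arm t)) * loss t (arm t) *
        (p t (arm t))⁻¹ := by
    intro t
    rw [sum_mul_lossEstimate, div_eq_mul_inv]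
    ring
  simp only [h4] at h1
  rw [Finset.sum_sub_distrib, Finset.sum_sub_distrib, ← Finset.mul_sum]
  linarith

/-- The arm-averaged counterpart: the factor `p t i` cancels the importance weight, and subtracting
the loss of `istar` is free because both learners have mass one. -/
theorem averaged_bound (hU : U.Nonempty) (hT : 2 ≤ T) {p q loss : ℕ → Fin K → ℝ}
    (hθ : θ = √(1 / Real.log T)) (hp : ∀ t < T, p t ∈ openSimplex K)
    (hq : ∀ t < T, ∑ i, q t i = 1)
    (hloss : ∀ t < T, ∀ i, loss t i ∈ Set.Icc (0 : ℝ) 1) (istar : Fin K) :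
    ∑ t ∈ Finset.range T, ∑ i, p t i * (loss t i - loss t istar) ≤
      ∑ t ∈ Finset.range T, ∑ i, p t i * ((p t i - q t i) * loss t i * (p t i)⁻¹ -
          stabilityBound U (barrierWeight θ T p t) (p t) i -
          1 / (2 * (T : ℝ) ^ 2) * (loss t i * (p t i)⁻¹)) +
        ∑ t ∈ Finset.range T, ∑ i, q t i * (loss t i - loss t istar) +
        51 * √(Real.log T) * pathComplexity T p U + 2 * (K * Real.log T) := by
  have hΛ := half_lt_log hT
  have hT2 : (2 : ℝ) ≤ T := by exact_mod_cast hT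
  have hθ0 : 0 < θ := hθ ▸ Real.sqrt_pos.2 (one_div_pos.2 (by linarith))
  have h1 := sum_sum_mul_stabilityBound_le hU hθ0 hp
  rw [hθ, one_div_sqrt_one_div_log, ← hθ] at h1
  have h2 : ∑ t ∈ Finset.range T, ∑ i, loss t i ≤ T * K := by
    calc _ ≤ ∑ t ∈ Finset.range T, ∑ i : Fin K, (1 : ℝ) :=
          Finset.sum_le_sum fun t ht => Finset.sum_le_sum fun i _ =>
            (hloss t (Finset.mem_range.1 ht) i).2
      _ = T * K := by simp
  have h3 : 1 / (2 * (T : ℝ) ^ 2) * ∑ t ∈ Finset.range T, ∑ i, loss t i ≤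
      2 * (K * Real.log T) := by
    have hK0 : (0 : ℝ) ≤ K := Nat.cast_nonneg K
    calc _ ≤ 1 / (2 * (T : ℝ) ^ 2) * (T * K) := mul_le_mul_of_nonneg_left h2 (by positivity)
      _ = K / (2 * T) := by field_simp
      _ ≤ K := div_le_self hK0 (by linarith)
      _ ≤ _ := by nlinarith
  have h4 : ∀ t ∈ Finset.range T, ∑ i, p t i * (loss t i - loss t istar) =
      ∑ i, p t i * ((p t i - q t i) * loss t i * (p t i)⁻¹ -
          stabilityBound U (barrierWeight θ T p t) (p t) i -
          1 / (2 * (T : ℝ) ^ 2) * (loss t i * (p t i)⁻¹)) +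
        ∑ i, q t i * (loss t i - loss t istar) +
        ∑ i, p t i * stabilityBound U (barrierWeight θ T p t) (p t) i +
        1 / (2 * (T : ℝ) ^ 2) * ∑ i, loss t i := by
    intro t ht
    have ht := Finset.mem_range.1 ht
    have e1 : ∑ i, p t i * loss t istar = loss t istar := by
      rw [← Finset.sum_mul, (hp t ht).2, one_mul]
    have e2 : ∑ i, q t i * loss t istar = loss t istar := by
      rw [← Finset.sum_mul, hq t ht, one_mul]
    have e3 : ∀ i, p t i * ((p t i - q t i) * loss t i * (p t i)⁻¹ -
          stabilityBound U (barrierWeight θ T p t) (p t) i -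
          1 / (2 * (T : ℝ) ^ 2) * (loss t i * (p t i)⁻¹)) =
        p t i * loss t i - q t i * loss t i -
          p t i * stabilityBound U (barrierWeight θ T p t) (p t) i -
          1 / (2 * (T : ℝ) ^ 2) * loss t i := by
      intro i
      have hi := ((hp t ht).1 i).ne'
      field_simp
    simp only [e3, mul_sub (p t _), mul_sub (q t _), Finset.sum_sub_distrib, e1, e2,
      ← Finset.mul_sum]
    ring
  rw [Finset.sum_congr rfl h4]
  simp only [Finset.sum_add_distrib, ← Finset.mul_sum]
  linarith

set_option maxHeartbeats 800000 in
/-- The regret against the algorithm restricted to the arms in `U`. -/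
theorem regret_le [NeZero K] (hU : U.Nonempty) (hK : K ≤ T) (hT : 2 ≤ T)
    (hI : IsInteraction μ T loss arm p) (hθ : θ = √(1 / Real.log T))
    (hF : ∀ ω, IsLogBarrierFTRL 162 θ 0 T (fun t => p t ω) (fun t => arm t ω)
      (fun t => loss t ω)) (istar : Fin K) :
    regret μ T loss arm istar ≤
      ∫ ω, ∑ t ∈ Finset.range T, ∑ i, competitor θ T (fun s => p s ω) (fun s => arm s ω)
        (fun s => loss s ω) U t i * (loss t ω i - loss t ω istar) ∂μ +
      54 * √(Real.log T) * ∫ ω, pathComplexity T (fun t => p t ω) U ∂μ +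
      1002 * (K * Real.log T) := by
  have hθ0 : 0 ≤ θ := hθ ▸ Real.sqrt_nonneg _
  have hle : ∀ t < T, history loss arm t ≤
      history loss arm t ⊔ MeasurableSpace.comap (loss t) inferInstance := fun t _ => le_sup_left
  have bp := fun t ht i => (boundedMeasurable_play hθ0 hF (t := t) ht i).mono (hle t ht)
  have bi := fun t ht i =>
    (boundedMeasurable_inv_play hθ0 hF hI.loss_mem (t := t) ht i).mono (hle t ht)
  have bq := fun t ht i => (boundedMeasurable_competitor hU hθ0 hF (t := t) ht i).mono (hle t ht)
  have bs := fun t ht i =>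
    (boundedMeasurable_stabilityBound (U := U) hθ0 hF (t := t) ht i).mono (hle t ht)
  have bl := fun t ht i => hI.boundedMeasurable_loss (t := t) ht i
  have bpath := hI.boundedMeasurable_pathComplexity (U := U) hθ0 hF
  set q : ℕ → Ω → Fin K → ℝ := fun t ω => competitor θ T (fun s => p s ω) (fun s => arm s ω)
        (fun s => loss s ω) U t with hq
  set f : ℕ → Ω → Fin K → ℝ := fun t ω i => (p t ω i - q t ω i) * loss t ω i * (p t ω i)⁻¹ -
    stabilityBound U (barrierWeight θ T (fun s => p s ω) t) (p t ω) i -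
    1 / (2 * (T : ℝ) ^ 2) * (loss t ω i * (p t ω i)⁻¹) with hf
  have bf : ∀ t < T, ∀ i, @BoundedMeasurable Ω
      (history loss arm t ⊔ MeasurableSpace.comap (loss t) inferInstance)
      fun ω => f t ω i := by
    intro t ht i
    let _ := history loss arm t ⊔ MeasurableSpace.comap (loss t) inferInstance
    exact (((((bp t ht i).sub (bq t ht i)).mul (bl t ht i)).mul (bi t ht i)).sub (bs t ht i)).sub
      ((BoundedMeasurable.const _).mul ((bl t ht i).mul (bi t ht i)))
  have bd : ∀ t < T, ∀ i, @BoundedMeasurable Ω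
      (history loss arm t ⊔ MeasurableSpace.comap (loss t) inferInstance)
      fun ω => loss t ω i - loss t ω istar := by
    intro t ht i
    let _ := history loss arm t ⊔ MeasurableSpace.comap (loss t) inferInstance
    exact (bl t ht i).sub (bl t ht istar)
  have up : ∀ t < T, ∀ {h : Ω → ℝ}, @BoundedMeasurable Ω
      (history loss arm t ⊔ MeasurableSpace.comap (loss t) inferInstance) h →
      BoundedMeasurable h := fun t ht h hh => hh.mono (hI.history_sup_le ht)
  have bf' : ∀ t < T, ∀ i, BoundedMeasurable fun ω => f t ω i :=
    fun t ht i => up t ht (bf t ht i)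
  have bd' : ∀ t < T, ∀ i, BoundedMeasurable fun ω => loss t ω i - loss t ω istar :=
    fun t ht i => up t ht (bd t ht i)
  -- The σ-algebra includes the loss vector of the round, because `F` may depend on it; this is
  -- where simultaneous choice of loss and arm enters.
  have average : ∀ F : ℕ → Ω → Fin K → ℝ, (∀ t < T, ∀ i, @BoundedMeasurable Ω
      (history loss arm t ⊔ MeasurableSpace.comap (loss t) inferInstance) fun ω => F t ω i) →
      ∫ ω, ∑ t ∈ Finset.range T, F t ω (arm t ω) ∂μ =
        ∫ ω, ∑ t ∈ Finset.range T, ∑ i, p t ω i * F t ω i ∂μ := by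
    intro F hF'
    rw [integral_finsetSum, integral_finsetSum]
    · exact Finset.sum_congr rfl fun t ht =>
        hI.integral_arm (Finset.mem_range.1 ht) (hF' t (Finset.mem_range.1 ht))
    · intro t ht
      have ht := Finset.mem_range.1 ht
      exact (BoundedMeasurable.sum _ fun i _ =>
        (up t ht (bp t ht i)).mul (up t ht (hF' t ht i))).integrable
    · intro t ht
      have ht := Finset.mem_range.1 ht
      exact (BoundedMeasurable.apply_arm (fun i => up t ht (hF' t ht i))
        (hI.measurable_arm t ht)).integrable
  have hreg : regret μ T loss arm istar =
      ∫ ω, ∑ t ∈ Finset.range T, ∑ i, p t ω i * (loss t ω i - loss t ω istar) ∂μ :=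
    average (fun t ω i => loss t ω i - loss t ω istar) bd
  have hfav := average f bf
  have intpath : Integrable (fun ω => pathComplexity T (fun t => p t ω) U) μ := bpath.integrable
  have intfarm : Integrable (fun ω => ∑ t ∈ Finset.range T, f t ω (arm t ω)) μ :=
    (BoundedMeasurable.sum _ fun t ht => BoundedMeasurable.apply_arm
      (bf' t (Finset.mem_range.1 ht)) (hI.measurable_arm t (Finset.mem_range.1 ht))).integrable
  have intpf : Integrable (fun ω => ∑ t ∈ Finset.range T, ∑ i, p t ω i * f t ω i) μ :=
    (BoundedMeasurable.sum _ fun t ht => BoundedMeasurable.sum _ fun i _ =>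
      (up t (Finset.mem_range.1 ht) (bp t (Finset.mem_range.1 ht) i)).mul
        (bf' t (Finset.mem_range.1 ht) i)).integrable
  have intpd : Integrable
      (fun ω => ∑ t ∈ Finset.range T, ∑ i, p t ω i * (loss t ω i - loss t ω istar)) μ :=
    (BoundedMeasurable.sum _ fun t ht => BoundedMeasurable.sum _ fun i _ =>
      (up t (Finset.mem_range.1 ht) (bp t (Finset.mem_range.1 ht) i)).mul
        (bd' t (Finset.mem_range.1 ht) i)).integrable
  have intqd : Integrable
      (fun ω => ∑ t ∈ Finset.range T, ∑ i, q t ω i * (loss t ω i - loss t ω istar)) μ :=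
    (BoundedMeasurable.sum _ fun t ht => BoundedMeasurable.sum _ fun i _ =>
      (up t (Finset.mem_range.1 ht) (bq t (Finset.mem_range.1 ht) i)).mul
        (bd' t (Finset.mem_range.1 ht) i)).integrable
  have hpath : ∫ ω, ∑ t ∈ Finset.range T, f t ω (arm t ω) ∂μ ≤
      ∫ ω, (3 * √(Real.log T) * pathComplexity T (fun t => p t ω) U +
        1000 * (K * Real.log T)) ∂μ :=
    integral_mono intfarm ((intpath.const_mul _).add (integrable_const _)) fun ω =>
      pathwise_bound hU hK hT hθ (hF ω) fun t ht i => hI.loss_mem t ht ω i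
  have havg : ∫ ω, ∑ t ∈ Finset.range T, ∑ i, p t ω i * (loss t ω i - loss t ω istar) ∂μ ≤
      ∫ ω, (∑ t ∈ Finset.range T, ∑ i, p t ω i * f t ω i +
        ∑ t ∈ Finset.range T, ∑ i, q t ω i * (loss t ω i - loss t ω istar) +
        51 * √(Real.log T) * pathComplexity T (fun t => p t ω) U + 2 * (K * Real.log T)) ∂μ :=
    integral_mono intpd
      (((intpf.add intqd).add (intpath.const_mul _)).add (integrable_const _)) fun ω =>
      averaged_bound hU hT hθ (fun t ht => (hF ω t ht).1)
        (fun t _ => sum_competitor hU hθ0 t) (fun t ht i => hI.loss_mem t ht ω i) istar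
  have intpqd : Integrable (fun ω => ∑ t ∈ Finset.range T, ∑ i, p t ω i * f t ω i +
      ∑ t ∈ Finset.range T, ∑ i, q t ω i * (loss t ω i - loss t ω istar)) μ := intpf.add intqd
  have intall : Integrable (fun ω => ∑ t ∈ Finset.range T, ∑ i, p t ω i * f t ω i +
      ∑ t ∈ Finset.range T, ∑ i, q t ω i * (loss t ω i - loss t ω istar) +
      51 * √(Real.log T) * pathComplexity T (fun t => p t ω) U) μ :=
    intpqd.add (intpath.const_mul _)
  rw [integral_add (intpath.const_mul _) (integrable_const _), integral_const_mul,
    integral_const, probReal_univ, one_smul] at hpath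
  rw [integral_add intall (integrable_const _),
    integral_add intpqd (intpath.const_mul _), integral_add intpf intqd,
    integral_const_mul, integral_const, probReal_univ, one_smul] at havg
  linarith

end Regret

theorem integral_mul_condExp_eq {Ω : Type*} {m : MeasurableSpace Ω}
    [mΩ : MeasurableSpace Ω] {μ : Measure Ω} [IsProbabilityMeasure μ] (hm : m ≤ mΩ)
    {f g : Ω → ℝ} (hf : @BoundedMeasurable Ω m f) (hg : Integrable g μ) :
    ∫ ω, f ω * g ω ∂μ = ∫ ω, f ω * (μ[g | m]) ω ∂μ := by
  obtain ⟨hmeas, B, hB⟩ := hf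
  have h := condExp_stronglyMeasurable_mul_of_bound hm hmeas.stronglyMeasurable hg B
    (Filter.Eventually.of_forall hB)
  calc ∫ ω, f ω * g ω ∂μ = ∫ ω, (μ[f * g | m]) ω ∂μ := (integral_condExp hm).symm
    _ = ∫ ω, f ω * (μ[g | m]) ω ∂μ := integral_congr_ae h

/-! ### The shadow learner's own regret. -/

section Deviation

variable {Ω : Type*} [mΩ : MeasurableSpace Ω] {μ : Measure Ω} [IsProbabilityMeasure μ]
  {K T : ℕ} {loss : ℕ → Ω → Fin K → ℝ} {arm : ℕ → Ω → Fin K} {p : ℕ → Ω → Fin K → ℝ}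
  {Δ : Fin K → ℝ}

/-- A predictable `q` can be moved through the conditional expectation; an average over zero-gap
arms is then at most the maximum. -/
theorem integral_le_zeroGapDeviation (hI : IsInteraction μ T loss arm p)
    (hU : (zeroGapArms Δ).Nonempty) (istar : Fin K) {q : ℕ → Ω → Fin K → ℝ}
    (hqm : ∀ t < T, ∀ i, @BoundedMeasurable Ω (history loss arm t) fun ω => q t ω i)
    (hq0 : ∀ t < T, ∀ ω i, 0 ≤ q t ω i)
    (hqU : ∀ t < T, ∀ ω, ∀ i ∉ zeroGapArms Δ, q t ω i = 0)
    (hq1 : ∀ t < T, ∀ ω, ∑ i, q t ω i = 1) :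
    ∫ ω, ∑ t ∈ Finset.range T, ∑ i, q t ω i * (loss t ω i - loss t ω istar) ∂μ ≤
      zeroGapDeviation μ T loss arm istar Δ := by
  have hm : ∀ t < T, history loss arm t ≤ mΩ := fun t ht =>
    history_le hI.measurable_loss hI.measurable_arm ht.le
  have bq : ∀ t < T, ∀ i, BoundedMeasurable fun ω => q t ω i :=
    fun t ht i => (hqm t ht i).mono (hm t ht)
  have bd : ∀ t < T, ∀ i, BoundedMeasurable fun ω => loss t ω i - loss t ω istar := by
    intro t ht i
    exact ((hI.boundedMeasurable_loss ht i).mono (hI.history_sup_le ht)).sub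
      ((hI.boundedMeasurable_loss ht istar).mono (hI.history_sup_le ht))
  have : Nonempty {i // i ∈ zeroGapArms Δ} := hU.to_subtype
  set c : ℕ → Fin K → Ω → ℝ := fun t i =>
    μ[fun ω' => loss t ω' i - loss t ω' istar | history loss arm t] with hc
  have hci : ∀ t i, Integrable (c t i) μ := fun t i => integrable_condExp
  have hcm : ∀ t < T, ∀ i, Measurable (c t i) := fun t ht i =>
    (stronglyMeasurable_condExp.mono (hm t ht)).measurable
  have hbdd : ∀ t ω, BddAbove (Set.range fun i : {i // i ∈ zeroGapArms Δ} => c t i ω) :=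
    fun t ω => Set.finite_range _ |>.bddAbove
  have hsup : ∀ t < T,
      Integrable (fun ω => ⨆ i : {i // i ∈ zeroGapArms Δ}, c t i ω) μ := by
    intro t ht
    refine (integrable_finsetSum Finset.univ fun i _ => (hci t i).abs).mono'
      (Measurable.iSup fun i : {i // i ∈ zeroGapArms Δ} => hcm t ht i).aestronglyMeasurable
      (Filter.Eventually.of_forall fun ω => ?_)
    have habs : ∀ i, |c t i ω| ≤ ∑ i, |c t i ω| := fun i =>
      Finset.single_le_sum (f := fun i => |c t i ω|) (fun i _ => abs_nonneg _)
        (Finset.mem_univ i)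
    obtain ⟨i₀, hi₀⟩ := hU
    rw [Real.norm_eq_abs, abs_le]
    refine ⟨?_, ciSup_le fun i => (le_abs_self _).trans (habs i)⟩
    exact (neg_le_neg (habs i₀)).trans ((neg_abs_le _).trans (le_ciSup (hbdd t ω) ⟨i₀, hi₀⟩))
  have hqc : ∀ t < T, ∀ i, Integrable (fun ω => q t ω i * c t i ω) μ := by
    intro t ht i
    obtain ⟨hmeas, B, hB⟩ := bq t ht i
    exact (hci t i).bdd_mul hmeas.aestronglyMeasurable (Filter.Eventually.of_forall hB)
  have hqd : ∀ t < T, ∀ i, Integrable (fun ω => q t ω i * (loss t ω i - loss t ω istar)) μ :=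
    fun t ht i => ((bq t ht i).mul (bd t ht i)).integrable
  have hround : ∀ t < T, ∫ ω, ∑ i, q t ω i * (loss t ω i - loss t ω istar) ∂μ ≤
      ∫ ω, ⨆ i : {i // i ∈ zeroGapArms Δ}, c t i ω ∂μ := by
    intro t ht
    calc ∫ ω, ∑ i, q t ω i * (loss t ω i - loss t ω istar) ∂μ
        = ∑ i, ∫ ω, q t ω i * (loss t ω i - loss t ω istar) ∂μ :=
          integral_finsetSum _ fun i _ => hqd t ht i
      _ = ∑ i, ∫ ω, q t ω i * c t i ω ∂μ := Finset.sum_congr rfl fun i _ =>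
          integral_mul_condExp_eq (hm t ht) (hqm t ht i) (bd t ht i).integrable
      _ = ∫ ω, ∑ i, q t ω i * c t i ω ∂μ :=
          (integral_finsetSum _ fun i _ => hqc t ht i).symm
      _ ≤ ∫ ω, ⨆ i : {i // i ∈ zeroGapArms Δ}, c t i ω ∂μ := by
          refine integral_mono (integrable_finsetSum _ fun i _ => hqc t ht i) (hsup t ht)
            fun ω => ?_
          calc ∑ i, q t ω i * c t i ω
              ≤ ∑ i, q t ω i * ⨆ i : {i // i ∈ zeroGapArms Δ}, c t i ω := by
                refine Finset.sum_le_sum fun i _ => ?_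
                by_cases hi : i ∈ zeroGapArms Δ
                · exact mul_le_mul_of_nonneg_left (le_ciSup (hbdd t ω) ⟨i, hi⟩) (hq0 t ht ω i)
                · rw [hqU t ht ω i hi, zero_mul, zero_mul]
            _ = _ := by rw [← Finset.sum_mul, hq1 t ht ω, one_mul]
  unfold zeroGapDeviation
  rw [integral_finsetSum _ fun t ht => integrable_finsetSum _ fun i _ =>
      hqd t (Finset.mem_range.1 ht) i,
    integral_finsetSum _ fun t ht => hsup t (Finset.mem_range.1 ht)]
  exact Finset.sum_le_sum fun t ht => hround t (Finset.mem_range.1 ht)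

/-- Playing one fixed zero-gap arm throughout has nonnegative regret against the best arm, and the
deviation dominates it. -/
theorem zeroGapDeviation_nonneg (hI : IsInteraction μ T loss arm p) {istar : Fin K}
    (hstar : IsBestArm μ T loss istar) : 0 ≤ zeroGapDeviation μ T loss arm istar Δ := by
  rcases (zeroGapArms Δ).eq_empty_or_nonempty with h | ⟨i₀, hi₀⟩
  · have : IsEmpty {i // i ∈ zeroGapArms Δ} := by
      rw [h]; exact Finset.isEmpty_coe_sort.2 rfl
    unfold zeroGapDeviation
    simp only [Real.iSup_of_isEmpty, Finset.sum_const_zero, integral_zero, le_refl]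
  · have h := integral_le_zeroGapDeviation hI ⟨i₀, hi₀⟩ istar
      (q := fun _ _ i => if i₀ = i then 1 else 0)
      (fun t ht i => by let _ := history loss arm t; exact BoundedMeasurable.const _)
      (fun _ _ _ i => by split_ifs <;> norm_num)
      (fun _ _ _ i hi => if_neg (by rintro rfl; exact hi hi₀))
      (fun _ _ _ => by rw [Finset.sum_ite_eq, if_pos (Finset.mem_univ _)])
    refine le_trans ?_ h
    have bl : ∀ i, BoundedMeasurable fun ω => ∑ t ∈ Finset.range T, loss t ω i := fun i =>
      BoundedMeasurable.sum _ fun t ht =>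
        (hI.boundedMeasurable_loss (Finset.mem_range.1 ht) i).mono
          (hI.history_sup_le (Finset.mem_range.1 ht))
    have e : ∀ ω, ∑ t ∈ Finset.range T, ∑ i, (if i₀ = i then (1 : ℝ) else 0) *
        (loss t ω i - loss t ω istar) =
        ∑ t ∈ Finset.range T, loss t ω i₀ - ∑ t ∈ Finset.range T, loss t ω istar := by
      intro ω
      rw [← Finset.sum_sub_distrib]
      refine Finset.sum_congr rfl fun t _ => ?_
      simp only [ite_mul, one_mul, zero_mul, Finset.sum_ite_eq, Finset.mem_univ, if_true]
    simp only [e]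
    rw [integral_sub (bl i₀).integrable (bl istar).integrable]
    exact sub_nonneg.2 (hstar i₀)

end Deviation

/-! ### Optimizing the self-bounding inequality. -/

section SelfBoundingArithmetic

theorem mul_sqrt_mul_sqrt_le {c Λ P d η : ℝ} (hΛ : 0 ≤ Λ) (hP : 0 ≤ P) (hd : 0 < d)
    (hη : 0 < η) : c * (√Λ * √P) ≤ η * (d * P) + c ^ 2 / 4 * (Λ / (η * d)) := by
  have h1 := Real.sq_sqrt hΛ
  have h2 := Real.sq_sqrt hP
  have hpos : 0 < η * d := mul_pos hη hd
  have e : η * (d * P) + c ^ 2 / 4 * (Λ / (η * d)) - c * (√Λ * √P) =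
      (2 * (η * d) * √P - c * √Λ) ^ 2 / (4 * (η * d)) := by
    rw [eq_div_iff (by positivity)]
    have : c ^ 2 / 4 * (Λ / (η * d)) * (4 * (η * d)) = c ^ 2 * Λ := by field_simp
    linear_combination this - 4 * (η * d) ^ 2 * h2 - c ^ 2 * h1
  have : 0 ≤ (2 * (η * d) * √P - c * √Λ) ^ 2 / (4 * (η * d)) := by positivity
  linarith

theorem sqrt_sum_le_sum_sqrt {ι : Type*} (s : Finset ι) {x : ι → ℝ} (hx : ∀ i ∈ s, 0 ≤ x i) :
    √(∑ i ∈ s, x i) ≤ ∑ i ∈ s, √(x i) := by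
  refine Real.sqrt_le_iff.2 ⟨Finset.sum_nonneg fun i _ => Real.sqrt_nonneg _, ?_⟩
  have h := Finset.sum_sq_le_sq_sum_of_nonneg (s := s) (f := fun i => √(x i))
    fun i _ => Real.sqrt_nonneg _
  rwa [Finset.sum_congr rfl fun i hi => Real.sq_sqrt (hx i hi)] at h

/-- The ideal η is of order √(A / C), capped at 1/2 so that the term η R can be absorbed on the
left. -/
theorem le_of_self_bounding {R D P C A N : ℝ}
    (h : ∀ η > 0, R ≤ D + (η * P + 3000 * (A / η)) + 1002 * N) (hP : P ≤ R + C)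
    (hC : 0 ≤ C) (hA : 0 ≤ A) (hN : 0 < N) (hD : 0 ≤ D) :
    R ≤ 20000 * (A + √(C * A) + N + D) := by
  have hr0 := Real.sqrt_nonneg (C * A)
  rcases le_or_gt R 0 with hR | hR
  · linarith
  rcases le_or_gt C A with hCA | hCA
  · have h1 := h (1 / 2) (by norm_num)
    rw [div_div_eq_mul_div, div_one] at h1
    linarith
  rcases hA.eq_or_lt with hA0 | hA0
  · have hNC : 0 < N + C := by linarith
    -- With A = 0 a smaller η is always better; this one is positive, at most 1/2, and makes η C at
    -- most N.
    have h1 := h (N / (2 * (N + C))) (by positivity)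
    rw [← hA0, zero_div, mul_zero] at h1
    have hη0 : 0 < N / (2 * (N + C)) := by positivity
    have hη : N / (2 * (N + C)) ≤ 1 / 2 := by
      rw [div_le_div_iff₀ (by positivity) two_pos]; linarith
    have hηC : N / (2 * (N + C)) * C ≤ N := by
      rw [div_mul_eq_mul_div, div_le_iff₀ (by positivity)]; nlinarith
    have h2 := mul_le_mul_of_nonneg_left hP hη0.le
    have h3 := mul_le_mul_of_nonneg_right hη hR.le
    linarith
  · have hC0 : 0 < C := by linarith
    have hr : 0 < √(C * A) := Real.sqrt_pos.2 (mul_pos hC0 hA0)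
    have hr2 := Real.sq_sqrt (mul_pos hC0 hA0).le
    have hAr : A ≤ √(C * A) := Real.le_sqrt_of_sq_le (by nlinarith)
    set r := √(C * A)
    -- This is √(A / C) / 2, which makes both η C and A / η multiples of √(C A).
    have h1 := h (A / (2 * r)) (by positivity)
    have hη : A / (2 * r) ≤ 1 / 2 := by
      rw [div_le_div_iff₀ (by positivity) two_pos]; linarith
    have hηC : A / (2 * r) * C = r / 2 := by
      rw [div_mul_eq_mul_div, div_eq_div_iff (by positivity) two_ne_zero]; linarith
    have hAη : A / (A / (2 * r)) = 2 * r := div_div_cancel₀ hA0.ne'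
    rw [hAη] at h1
    have h2 := mul_le_mul_of_nonneg_left hP (show 0 ≤ A / (2 * r) by positivity)
    have h3 := mul_le_mul_of_nonneg_right hη hR.le
    linarith

end SelfBoundingArithmetic

/-! ### Path complexity in terms of the gaps. -/

section Complexity

variable {K T : ℕ} {p : ℕ → Fin K → ℝ} {Δ : Fin K → ℝ}

theorem compl_zeroGapArms : (zeroGapArms Δ)ᶜ = posGapArms Δ := by
  ext i
  simp [zeroGapArms, posGapArms]

theorem gap_pos (hΔ : ∀ i, 0 ≤ Δ i) {i : Fin K} (hi : i ∈ posGapArms Δ) : 0 < Δ i :=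
  (hΔ i).lt_of_ne (Ne.symm (by simpa [posGapArms] using hi))

theorem minGap_le {i : Fin K} (hi : i ∈ posGapArms Δ) : minGap Δ ≤ Δ i :=
  ciInf_le (f := fun i : {i // i ∈ posGapArms Δ} => Δ i) (Set.finite_range _).bddBelow ⟨i, hi⟩

theorem minGap_pos (hΔ : ∀ i, 0 ≤ Δ i) (h : (posGapArms Δ).Nonempty) : 0 < minGap Δ := by
  have : Nonempty {i // i ∈ posGapArms Δ} := h.to_subtype
  obtain ⟨i, hi⟩ := exists_eq_ciInf_of_finite (f := fun i : {i // i ∈ posGapArms Δ} => Δ i)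
  unfold minGap
  rw [← hi]
  exact gap_pos hΔ i.2

theorem complexity_nonneg (hΔ : ∀ i, 0 ≤ Δ i) : 0 ≤ complexity Δ :=
  add_nonneg (div_nonneg (Nat.cast_nonneg _) (Real.iInf_nonneg fun i => hΔ i))
    (Finset.sum_nonneg fun i _ => one_div_nonneg.2 (hΔ i))

/-- AM–GM with gap `Δ i` for each single root, and with `minGap Δ / |U|` for the joint root; each
uses half of η. This is where |U| / Δ_min arises. -/
theorem pathComplexity_zeroGapArms_le (hΔ : ∀ i, 0 ≤ Δ i) (hp : ∀ t < T, ∀ i, 0 ≤ p t i) {Λ η : ℝ}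
    (hΛ : 0 ≤ Λ) (hη : 0 < η) (hU : (zeroGapArms Δ).Nonempty) :
    54 * √Λ * pathComplexity T p (zeroGapArms Δ) ≤
      η * ∑ t ∈ Finset.range T, ∑ i, p t i * Δ i + 3000 * (complexity Δ * Λ / η) := by
  have hP : ∀ i, 0 ≤ ∑ t ∈ Finset.range T, p t i := fun i =>
    Finset.sum_nonneg fun t ht => hp t (Finset.mem_range.1 ht) i
  set P : Fin K → ℝ := fun i => ∑ t ∈ Finset.range T, p t i with hPdef
  have hS : ∑ t ∈ Finset.range T, ∑ i, p t i * Δ i = ∑ i ∈ posGapArms Δ, Δ i * P i := by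
    rw [Finset.sum_comm, ← Finset.sum_add_sum_compl (zeroGapArms Δ), compl_zeroGapArms]
    have h0 : ∑ i ∈ zeroGapArms Δ, ∑ t ∈ Finset.range T, p t i * Δ i = 0 := by
      refine Finset.sum_eq_zero fun i hi => Finset.sum_eq_zero fun t _ => ?_
      have : Δ i = 0 := by simpa [zeroGapArms] using hi
      rw [this, mul_zero]
    rw [h0, zero_add]
    refine Finset.sum_congr rfl fun i _ => ?_
    rw [← Finset.sum_mul, mul_comm]
  have hG := complexity_nonneg hΔ
  unfold pathComplexity
  rw [hS, compl_zeroGapArms]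
  -- Without positive gaps the path complexity is zero, so the value of `minGap` is irrelevant.
  rcases (posGapArms Δ).eq_empty_or_nonempty with hV | hV
  · rw [hV]
    simp only [Finset.sum_empty, mul_zero, Real.sqrt_zero, add_zero]
    positivity
  have hmin := minGap_pos hΔ hV
  have hcard : (0 : ℝ) < ((zeroGapArms Δ).card : ℝ) := by exact_mod_cast hU.card_pos
  have h1 : ∑ i ∈ posGapArms Δ, 54 * (√Λ * √(P i)) ≤
      η / 2 * ∑ i ∈ posGapArms Δ, Δ i * P i +
        1458 * (Λ / η) * ∑ i ∈ posGapArms Δ, 1 / Δ i := by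
    rw [Finset.mul_sum, Finset.mul_sum, ← Finset.sum_add_distrib]
    refine Finset.sum_le_sum fun i hi => ?_
    have hd := gap_pos hΔ hi
    refine (mul_sqrt_mul_sqrt_le hΛ (hP i) hd (half_pos hη)).trans (le_of_eq ?_)
    simp only [hPdef]
    ring
  have h2 : 54 * (√Λ * √(((zeroGapArms Δ).card : ℝ) * ∑ i ∈ posGapArms Δ, P i)) ≤
      η / 2 * ∑ i ∈ posGapArms Δ, Δ i * P i +
        1458 * (Λ / η) * (((zeroGapArms Δ).card : ℝ) / minGap Δ) := by
    refine (mul_sqrt_mul_sqrt_le hΛ (mul_nonneg hcard.le (Finset.sum_nonneg fun i _ => hP i))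
      (div_pos hmin hcard) (half_pos hη)).trans ?_
    have h3 : minGap Δ * ∑ i ∈ posGapArms Δ, P i ≤ ∑ i ∈ posGapArms Δ, Δ i * P i := by
      rw [Finset.mul_sum]
      exact Finset.sum_le_sum fun i hi => mul_le_mul_of_nonneg_right (minGap_le hi) (hP i)
    have e1 : minGap Δ / ((zeroGapArms Δ).card : ℝ) *
        (((zeroGapArms Δ).card : ℝ) * ∑ i ∈ posGapArms Δ, P i) =
        minGap Δ * ∑ i ∈ posGapArms Δ, P i := by field_simp
    have e2 : (54 : ℝ) ^ 2 / 4 * (Λ / (η / 2 * (minGap Δ / ((zeroGapArms Δ).card : ℝ)))) =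
        1458 * (Λ / η) * (((zeroGapArms Δ).card : ℝ) / minGap Δ) := by
      field_simp
      ring
    rw [e1, e2]
    have := mul_le_mul_of_nonneg_left h3 (half_pos hη).le
    linarith
  have h4 : complexity Δ * Λ / η = Λ / η * (((zeroGapArms Δ).card : ℝ) / minGap Δ) +
      Λ / η * ∑ i ∈ posGapArms Δ, 1 / Δ i := by
    unfold complexity; ring
  have h5 : 0 ≤ complexity Δ * Λ / η := by positivity
  rw [← Finset.mul_sum, ← Finset.mul_sum] at h1
  linarith

/-- All arms, including `k`, have positive gap. The joint root is at most the sum of the single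
roots, so AM–GM with 108 = 2 * 54 gives 108² / 4 = 2916. -/
theorem pathComplexity_singleton_le (hΔ : ∀ i, 0 ≤ Δ i) (hp : ∀ t < T, ∀ i, 0 ≤ p t i) {Λ η : ℝ}
    (hΛ : 0 ≤ Λ) (hη : 0 < η) (hU : zeroGapArms Δ = ∅) (k : Fin K) :
    54 * √Λ * pathComplexity T p {k} ≤
      η * ∑ t ∈ Finset.range T, ∑ i, p t i * Δ i + 3000 * (complexity Δ * Λ / η) := by
  have hP : ∀ i, 0 ≤ ∑ t ∈ Finset.range T, p t i := fun i =>
    Finset.sum_nonneg fun t ht => hp t (Finset.mem_range.1 ht) i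
  set P : Fin K → ℝ := fun i => ∑ t ∈ Finset.range T, p t i with hPdef
  have hV : posGapArms Δ = Finset.univ := by rw [← compl_zeroGapArms, hU, Finset.compl_empty]
  have hd : ∀ i, 0 < Δ i := fun i => gap_pos hΔ (hV ▸ Finset.mem_univ i)
  have hS : ∑ t ∈ Finset.range T, ∑ i, p t i * Δ i = ∑ i, Δ i * P i := by
    rw [Finset.sum_comm]
    refine Finset.sum_congr rfl fun i _ => ?_
    rw [← Finset.sum_mul, mul_comm]
  have hG : complexity Δ = ∑ i, 1 / Δ i := by
    unfold complexity
    rw [hV, hU, Finset.card_empty, Nat.cast_zero, zero_div, zero_add]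
  have h1 : pathComplexity T p {k} ≤ 2 * ∑ i, √(P i) := by
    unfold pathComplexity
    rw [Finset.card_singleton, Nat.cast_one, one_mul]
    have h2 := sqrt_sum_le_sum_sqrt ({k}ᶜ : Finset (Fin K)) fun i _ => hP i
    have h3 : ∑ i ∈ ({k}ᶜ : Finset (Fin K)), √(P i) ≤ ∑ i, √(P i) :=
      Finset.sum_le_sum_of_subset_of_nonneg (Finset.subset_univ _)
        fun i _ _ => Real.sqrt_nonneg _
    linarith
  have h4 : ∑ i, 108 * (√Λ * √(P i)) ≤
      η * ∑ i, Δ i * P i + 2916 * (Λ / η) * ∑ i, 1 / Δ i := by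
    rw [Finset.mul_sum, Finset.mul_sum, ← Finset.sum_add_distrib]
    refine Finset.sum_le_sum fun i _ => ?_
    have hdi := hd i
    refine (mul_sqrt_mul_sqrt_le hΛ (hP i) hdi hη).trans (le_of_eq ?_)
    simp only [hPdef]
    ring
  rw [← Finset.mul_sum, ← Finset.mul_sum] at h4
  have h5 := mul_le_mul_of_nonneg_left h1 (show 0 ≤ 54 * √Λ by positivity)
  have h6 : complexity Δ * Λ / η = Λ / η * ∑ i, 1 / Δ i := by rw [hG]; ring
  have h7 : 0 ≤ complexity Δ * Λ / η := by
    have := complexity_nonneg hΔ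
    positivity
  rw [hS]
  linarith

theorem pathComplexity_singleton_le_sqrt (hp : ∀ t < T, p t ∈ openSimplex K) (k : Fin K) :
    pathComplexity T p {k} ≤ 2 * √(K * T) := by
  have hP : ∀ i, 0 ≤ ∑ t ∈ Finset.range T, p t i := fun i =>
    Finset.sum_nonneg fun t ht => ((hp t (Finset.mem_range.1 ht)).1 i).le
  have hsum : ∑ i, ∑ t ∈ Finset.range T, p t i = T := by
    rw [Finset.sum_comm, Finset.sum_congr rfl fun t ht => (hp t (Finset.mem_range.1 ht)).2]
    simp
  have h1 : ∑ i ∈ ({k}ᶜ : Finset (Fin K)), √(∑ t ∈ Finset.range T, p t i) ≤ √(K * T) := by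
    have h := sum_sqrt_le_sqrt_card_mul Finset.univ fun i _ => hP i
    rw [hsum, Finset.card_univ, Fintype.card_fin] at h
    exact (Finset.sum_le_sum_of_subset_of_nonneg (Finset.subset_univ _)
      fun i _ _ => Real.sqrt_nonneg _).trans h
  have h2 : √((({k} : Finset (Fin K)).card : ℝ) *
      ∑ i ∈ ({k}ᶜ : Finset (Fin K)), ∑ t ∈ Finset.range T, p t i) ≤ √(K * T) := by
    refine Real.sqrt_le_sqrt ?_
    rw [Finset.card_singleton, Nat.cast_one, one_mul]
    have h3 : ∑ i ∈ ({k}ᶜ : Finset (Fin K)), ∑ t ∈ Finset.range T, p t i ≤ T := by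
      rw [← hsum]
      exact Finset.sum_le_sum_of_subset_of_nonneg (Finset.subset_univ _) fun i _ _ => hP i
    have hK : (1 : ℝ) ≤ K := by
      have : 1 ≤ K := k.pos
      exact_mod_cast this
    have hT : (0 : ℝ) ≤ T := Nat.cast_nonneg T
    nlinarith
  unfold pathComplexity
  linarith

end Complexity

/-! ### The two regret bounds. -/

section Main

variable {Ω : Type*} [mΩ : MeasurableSpace Ω] {μ : Measure Ω} [IsProbabilityMeasure μ]
  {K T : ℕ} {loss : ℕ → Ω → Fin K → ℝ} {arm : ℕ → Ω → Fin K} {p : ℕ → Ω → Fin K → ℝ}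
  {θ : ℝ} {istar : Fin K}

theorem regret_le_rounds (hI : IsInteraction μ T loss arm p) :
    regret μ T loss arm istar ≤ T := by
  have hle : ∀ ω, ∑ t ∈ Finset.range T, (loss t ω (arm t ω) - loss t ω istar) ≤ T := by
    intro ω
    calc _ ≤ ∑ t ∈ Finset.range T, (1 : ℝ) := Finset.sum_le_sum fun t ht => by
          have ht := Finset.mem_range.1 ht
          linarith [(hI.loss_mem t ht ω (arm t ω)).2, (hI.loss_mem t ht ω istar).1]
      _ = T := by simp
  have bl : ∀ t < T, ∀ i, BoundedMeasurable fun ω => loss t ω i := fun t ht i =>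
    (hI.boundedMeasurable_loss ht i).mono (hI.history_sup_le ht)
  have hint : Integrable
      (fun ω => ∑ t ∈ Finset.range T, (loss t ω (arm t ω) - loss t ω istar)) μ :=
    (BoundedMeasurable.sum _ fun t ht =>
      (BoundedMeasurable.apply_arm (bl t (Finset.mem_range.1 ht))
        (hI.measurable_arm t (Finset.mem_range.1 ht))).sub
          (bl t (Finset.mem_range.1 ht) istar)).integrable
  have h := integral_mono hint (integrable_const (T : ℝ)) hle
  rwa [integral_const, probReal_univ, one_smul] at h

/-- The face of a single arm is a point, so the shadow learner always plays `istar` and has no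
regret. -/
theorem regret_le_singleton [NeZero K] (hK : K ≤ T) (hT : 2 ≤ T)
    (hI : IsInteraction μ T loss arm p) (hθ : θ = √(1 / Real.log T))
    (hF : ∀ ω, IsLogBarrierFTRL 162 θ 0 T (fun t => p t ω) (fun t => arm t ω)
      (fun t => loss t ω)) :
    regret μ T loss arm istar ≤
      54 * √(Real.log T) * ∫ ω, pathComplexity T (fun t => p t ω) {istar} ∂μ +
      1002 * (K * Real.log T) := by
  have h := regret_le (Finset.singleton_nonempty istar) hK hT hI hθ hF istar
  have e : ∀ ω, ∑ t ∈ Finset.range T, ∑ i, competitor θ T (fun s => p s ω) (fun s => arm s ω)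
      (fun s => loss s ω) {istar} t i * (loss t ω i - loss t ω istar) = 0 := by
    intro ω
    refine Finset.sum_eq_zero fun t _ => Finset.sum_eq_zero fun i _ => ?_
    by_cases hi : i = istar
    · rw [hi, sub_self, mul_zero]
    · unfold competitor
      rw [barrierPoint_of_notMem (by simpa using hi), zero_mul]
  simp only [e, integral_zero, zero_add] at h
  exact h

theorem regret_le_sqrt [NeZero K] (hK : K ≤ T) (hT : 2 ≤ T)
    (hI : IsInteraction μ T loss arm p) (hθ : θ = √(1 / Real.log T))
    (hF : ∀ ω, IsLogBarrierFTRL 162 θ 0 T (fun t => p t ω) (fun t => arm t ω)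
      (fun t => loss t ω)) :
    regret μ T loss arm istar ≤ 20000 * √(K * T * Real.log T) := by
  have hΛ := half_lt_log hT
  have hθ0 : 0 ≤ θ := hθ ▸ Real.sqrt_nonneg _
  have hT2 : (2 : ℝ) ≤ T := by exact_mod_cast hT
  have hK0 : (0 : ℝ) ≤ K := Nat.cast_nonneg K
  have hs := Real.sqrt_nonneg (K * T * Real.log T)
  -- In the first case K log T is below √(K T log T) and can be absorbed; in the second the trivial
  -- bound T is already below it.
  rcases le_total (K * Real.log T) (T : ℝ) with h | h
  · have h1 := regret_le_singleton (istar := istar) hK hT hI hθ hF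
    have h2 : ∫ ω, pathComplexity T (fun t => p t ω) {istar} ∂μ ≤ 2 * √(K * T) := by
      have h3 := integral_mono
        (hI.boundedMeasurable_pathComplexity (U := {istar}) hθ0 hF).integrable
        (integrable_const (μ := μ) (2 * √(K * T))) fun ω =>
          pathComplexity_singleton_le_sqrt (fun t ht => (hF ω t ht).1) istar
      rwa [integral_const, probReal_univ, one_smul] at h3
    have h4 : K * Real.log T ≤ √(K * T * Real.log T) := by
      refine Real.le_sqrt_of_sq_le ?_
      have : 0 ≤ K * Real.log T := by positivity
      nlinarith
    have h5 : √(K * T * Real.log T) = √(Real.log T) * √(K * T) := by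
      rw [mul_comm, Real.sqrt_mul (by linarith)]
    have h6 := mul_le_mul_of_nonneg_left h2 (show 0 ≤ 54 * √(Real.log T) by positivity)
    linarith
  · have h1 : (T : ℝ) ≤ √(K * T * Real.log T) := Real.le_sqrt_of_sq_le (by nlinarith)
    have h2 := regret_le_rounds (istar := istar) hI
    linarith

theorem regret_le_of_selfBounding [NeZero K] (hK : K ≤ T) (hT : 2 ≤ T)
    (hI : IsInteraction μ T loss arm p) (hθ : θ = √(1 / Real.log T))
    (hF : ∀ ω, IsLogBarrierFTRL 162 θ 0 T (fun t => p t ω) (fun t => arm t ω)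
      (fun t => loss t ω))
    (hstar : IsBestArm μ T loss istar) {Δ : Fin K → ℝ} {C D : ℝ} (hΔ : ∀ i, 0 ≤ Δ i)
    (hC : 0 ≤ C) (hself : SelfBounding μ T loss arm p istar Δ C)
    (hdev : zeroGapDeviation μ T loss arm istar Δ ≤ D) :
    regret μ T loss arm istar ≤ 20000 * (complexity Δ * Real.log T +
      √(C * (complexity Δ * Real.log T)) + K * Real.log T + D) := by
  have hΛ := half_lt_log hT
  have hΛ0 : 0 ≤ Real.log T := by linarith
  have hθ0 : 0 ≤ θ := hθ ▸ Real.sqrt_nonneg _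
  have hD : 0 ≤ D := (zeroGapDeviation_nonneg hI hstar).trans hdev
  have hp : ∀ ω, ∀ t < T, ∀ i, 0 ≤ p t ω i := fun ω t ht i => ((hF ω t ht).1.1 i).le
  have hKpos : (0 : ℝ) < K := by exact_mod_cast NeZero.pos K
  -- The face consists of the zero-gap arms, or of `istar` alone if there are none.
  obtain ⟨U, hreg, hpath⟩ : ∃ U : Finset (Fin K), regret μ T loss arm istar ≤
      D + 54 * √(Real.log T) * ∫ ω, pathComplexity T (fun t => p t ω) U ∂μ +
        1002 * (K * Real.log T) ∧
      ∀ η > 0, ∀ ω, 54 * √(Real.log T) * pathComplexity T (fun t => p t ω) U ≤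
        η * ∑ t ∈ Finset.range T, ∑ i, p t ω i * Δ i +
          3000 * (complexity Δ * Real.log T / η) := by
    rcases (zeroGapArms Δ).eq_empty_or_nonempty with hU | hU
    · refine ⟨{istar}, ?_, fun η hη ω =>
        pathComplexity_singleton_le hΔ (hp ω) hΛ0 hη hU istar⟩
      have := regret_le_singleton (istar := istar) hK hT hI hθ hF
      linarith
    · refine ⟨zeroGapArms Δ, ?_, fun η hη ω =>
        pathComplexity_zeroGapArms_le hΔ (hp ω) hΛ0 hη hU⟩
      have h1 := regret_le hU hK hT hI hθ hF istar
      have h2 := integral_le_zeroGapDeviation hI hU istar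
        (q := fun t ω => competitor θ T (fun s => p s ω) (fun s => arm s ω)
          (fun s => loss s ω) (zeroGapArms Δ) t)
        (fun t ht i => boundedMeasurable_competitor hU hθ0 hF ht i)
        (fun t _ ω i => (competitor_mem_Icc hU hθ0 t i).1)
        (fun t _ ω i hi => barrierPoint_of_notMem hi)
        (fun t _ ω => sum_competitor hU hθ0 t)
      linarith
  refine le_of_self_bounding (P := ∫ ω, ∑ t ∈ Finset.range T, ∑ i, p t ω i * Δ i ∂μ)
    (fun η hη => ?_) (by unfold SelfBounding at hself; linarith) hC
    (mul_nonneg (complexity_nonneg hΔ) hΛ0) (by positivity) hD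
  have hint : Integrable (fun ω => ∑ t ∈ Finset.range T, ∑ i, p t ω i * Δ i) μ :=
    (BoundedMeasurable.sum _ fun t ht => BoundedMeasurable.sum _ fun i _ =>
      ((boundedMeasurable_play hθ0 hF (Finset.mem_range.1 ht) i).mono
        (history_le hI.measurable_loss hI.measurable_arm (Finset.mem_range.1 ht).le)).mul
          (BoundedMeasurable.const _)).integrable
  have h := integral_mono
    ((hI.boundedMeasurable_pathComplexity (U := U) hθ0 hF).integrable.const_mul
      (54 * √(Real.log T))) ((hint.const_mul η).add
        (integrable_const (3000 * (complexity Δ * Real.log T / η)))) (hpath η hη)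
  simp only [Pi.add_apply] at h
  rw [integral_const_mul, integral_add (hint.const_mul η) (integrable_const _),
    integral_const_mul, integral_const, probReal_univ, one_smul] at h
  linarith

end Main

end Bandit
end

theorem theorem1 :
    ∃ κ : ℝ, 0 < κ ∧
      ∀ (K T : ℕ), K ≤ T → 2 ≤ T →
      ∀ (Ω : Type*) [MeasurableSpace Ω] (μ : Measure Ω) [IsProbabilityMeasure μ]
        (loss : ℕ → Ω → Fin K → ℝ) (arm : ℕ → Ω → Fin K) (p : ℕ → Ω → Fin K → ℝ)
        (istar : Fin K),
        Bandit.IsInteraction μ T loss arm p →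
        (∀ ω, Bandit.IsLogBarrierFTRL 162 (√(1 / Real.log T)) 0 T
          (fun t => p t ω) (fun t => arm t ω) (fun t => loss t ω)) →
        Bandit.IsBestArm μ T loss istar →
        Bandit.regret μ T loss arm istar ≤ κ * √(K * T * Real.log T) ∧
        ∀ (Δ : Fin K → ℝ) (C D : ℝ),
          (∀ i, Δ i ∈ Set.Icc (0 : ℝ) 1) → 0 ≤ C →
          Bandit.SelfBounding μ T loss arm p istar Δ C →
          Bandit.zeroGapDeviation μ T loss arm istar Δ ≤ D →
          Bandit.regret μ T loss arm istar ≤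
            κ * (Bandit.complexity Δ * Real.log T + √(C * Bandit.complexity Δ * Real.log T)
              + (K : ℝ) ^ 2 / √(Real.log T) + K * Real.log T + D) := by
  refine ⟨20000, by norm_num, ?_⟩
  intro K T hK hT Ω _ μ _ loss arm p istar hI hF hstar
  have : NeZero K := ⟨istar.pos.ne'⟩
  refine ⟨Bandit.regret_le_sqrt hK hT hI rfl hF, ?_⟩
  intro Δ C D hΔ hC hself hdev
  have h := Bandit.regret_le_of_selfBounding hK hT hI rfl hF hstar (fun i => (hΔ i).1) hC
    hself hdev
  -- The argument does not produce this term; being nonnegative, it can simply be added.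
  have : 0 ≤ (K : ℝ) ^ 2 / √(Real.log T) := by positivity
  rw [mul_assoc C]
  linarith
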